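/- All quantum codes are CSS codes given by chosen generators of their stabilizer group: finite sets of qubits, of $X$-stabilizers and of $Z$-stabilizers (each generator a subset of the qubits, its support), every $X$-stabilizer sharing an even number of qubits with every $Z$-stabilizer. For a code $C$ let $N$ be the number of qubits; $w_X, w_Z$ the maximum weight of an $X$-, respectively $Z$-stabilizer generator; $q_X, q_Z$ the maximum number of $X$-, respectively $Z$-stabilizer generators acting on one qubit; $K$ the number of logical qubits (the dimension over $\mathbb{F}_2$ of the space of $Z$-type operators commuting with all $X$-stabilizers modulo products of $Z$-stabilizers); and $d_X, d_Z$ the least weight of an $X$-type, respectively $Z$-type operator that commutes with all stabilizers but is not a product of stabilizers ($\infty$ if there is none). Put $\mathrm{dev} = w_X+w_Z+q_X+q_Z$. Parameters of the output code carry a tilde. (1) There are universal constants $w, A, a, b \in \mathbb{N}$ such that for every code $C$ there is a code $\tilde C$ with $\tilde w_X, \tilde q_X, \tilde w_Z, \tilde q_Z \le w$ (so $\tilde C$ is LDPC), $\tilde K = K$, and, with $F = A\,(1+\mathrm{dev})^a\,(1+\lfloor\log_2 N\rfloor)^b$ (where $\log_2 0$ is read as $0$), $$\tilde N \le N F,\qquad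 F\,\tilde d_X \ge d_X,\qquad F\,\tilde d_Z \ge d_Z .$$ (2) For every $c \in \mathbb{N}$ there is a constant $A \in \mathbb{N}$ depending only on $c$ such that for every code $C$ with $w_X, q_X, w_Z, q_Z \le c$ there is a code $\tilde C$ with $$\tilde w_X \le 5,\quad \tilde q_X \le 3,\quad \tilde w_Z \le 5,\quad \tilde q_Z \le 5,$$ $\tilde K = K$, $\tilde N \le A N$, $A\,\tilde d_X \ge d_X$ and $A\,\tilde d_Z \ge d_Z$. -/

import Mathlib

/-- A CSS code with chosen stabilizer generators. Row `s` of `hX` (resp. `hZ`) is the support of the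
`X`-type (resp. `Z`-type) generator `s`; `comm` says that `X`- and `Z`-generators commute.
Equivalently, a complex of based `𝔽₂`-spaces with `∂₁ = hX` and `∂₂ = hZᵀ`. -/
structure CSSCode where
  Qubit : Type
  XStab : Type
  ZStab : Type
  [fintypeQubit : Fintype Qubit]
  [fintypeXStab : Fintype XStab]
  [fintypeZStab : Fintype ZStab]
  hX : Matrix XStab Qubit (ZMod 2)
  hZ : Matrix ZStab Qubit (ZMod 2)
  comm : hX * hZ.transpose = 0

namespace CSSCode

attribute [instance] fintypeQubit fintypeXStab fintypeZStab

/-- The number of physical qubits. -/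
def N (C : CSSCode) : ℕ := Fintype.card C.Qubit

/-- The maximum weight of an `X`-stabilizer generator. -/
def wX (C : CSSCode) : ℕ := Finset.univ.sup fun s : C.XStab => hammingNorm (C.hX s)

/-- The maximum weight of a `Z`-stabilizer generator. -/
def wZ (C : CSSCode) : ℕ := Finset.univ.sup fun s : C.ZStab => hammingNorm (C.hZ s)

/-- The maximum number of `X`-stabilizer generators acting on a qubit. -/
def qX (C : CSSCode) : ℕ :=
  Finset.univ.sup fun q : C.Qubit => hammingNorm fun s : C.XStab => C.hX s q

/-- The maximum number of `Z`-stabilizer generators acting on a qubit. -/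
def qZ (C : CSSCode) : ℕ :=
  Finset.univ.sup fun q : C.Qubit => hammingNorm fun s : C.ZStab => C.hZ s q

/-- `Z`-type operators commuting with all `X`-stabilizers: the `1`-cycles. -/
def zCycles (C : CSSCode) : Submodule (ZMod 2) (C.Qubit → ZMod 2) :=
  LinearMap.ker C.hX.mulVecLin

/-- Products of `Z`-stabilizer generators: the `1`-boundaries. -/
def zBoundaries (C : CSSCode) : Submodule (ZMod 2) (C.Qubit → ZMod 2) :=
  LinearMap.range C.hZ.transpose.mulVecLin

/-- `X`-type operators commuting with all `Z`-stabilizers: the `1`-cocycles. -/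
def xCycles (C : CSSCode) : Submodule (ZMod 2) (C.Qubit → ZMod 2) :=
  LinearMap.ker C.hZ.mulVecLin

/-- Products of `X`-stabilizer generators: the `1`-coboundaries. -/
def xBoundaries (C : CSSCode) : Submodule (ZMod 2) (C.Qubit → ZMod 2) :=
  LinearMap.range C.hX.transpose.mulVecLin

/-- The number of logical qubits, the dimension of `H₁`. -/
noncomputable def K (C : CSSCode) : ℕ :=
  Module.finrank (ZMod 2) (C.zCycles ⧸ C.zBoundaries.submoduleOf C.zCycles)

/-- The `Z`-distance: the least weight of a nontrivial `Z`-type logical operator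
(`⊤` if there is none, that is, if `K = 0`). -/
noncomputable def dZ (C : CSSCode) : ℕ∞ :=
  ⨅ v ∈ {v : C.Qubit → ZMod 2 | v ∈ C.zCycles ∧ v ∉ C.zBoundaries}, (hammingNorm v : ℕ∞)

/-- The `X`-distance: the least weight of a nontrivial `X`-type logical operator
(`⊤` if there is none, that is, if `K = 0`). -/
noncomputable def dX (C : CSSCode) : ℕ∞ :=
  ⨅ v ∈ {v : C.Qubit → ZMod 2 | v ∈ C.xCycles ∧ v ∉ C.xBoundaries}, (hammingNorm v : ℕ∞)

/-- The deviation from LDPC. A quantity is polynomial in `wX, wZ, qX, qZ` exactly when it is bounded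
by `A * (1 + dev) ^ a` for some constants `A` and `a`. -/
def dev (C : CSSCode) : ℕ := C.wX + C.wZ + C.qX + C.qZ

end CSSCode

/-!
A code is a complex `Z → Q → X` of based spaces over `𝔽₂`. Every code is replaced, in three moves,
by one whose weights are at most `5, 3, 5, 3`; each move keeps the homology in the middle and
changes sizes and distances by factors polynomial in the old weights. So the factor needs no
logarithm of `N`, and both parts of the theorem are instances of one statement
(`CSSCode.exists_sparse`). The moves are compared by `LocalQuasiIso`: a map on `Z`-type operators
that is an isomorphism on homology, whose rows are light and whose inverse on homology can be
realized without making cycles much heavier. Such a map preserves `K`, bounds `d_Z` directly, and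
bounds `d_X` through its transpose, because the homologies of `X`- and `Z`-type are dual.

*Resolving.* The rows of a grid index classes of `X`-checks that never touch a common qubit or a
common `Z`-stabilizer; each qubit has a position, and qubits near each other have different ones.
A qubit is copied along the rows, and the copy in the row of an `X`-check `s` feeds a chain of
small pieces of `s`, one for each position, joined by links. Now `X`-checks have weight at most `3`
and meet each qubit at most `3` times, and cycles correspond to cycles
(`eq_resolve_of_isCycle`).

*Thickening.* The code is multiplied by an interval with a slot for each colour of a colouring of
the `Z`-stabilizers, and the stabilizer `z` is placed in the middle of its slot. A product cell is
cut in two in a slot only if it meets a stabilizer placed there. A face has about as many sides as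
its qubit has `X`-checks, plus one for each of these that is cut; that this stays at most `5` is the
delicate point (`Layout.not_event`), and is the reason why qubits sit at odd positions only.

*Filling.* The stabilizers themselves may still be heavy. Each `z` is replaced by a disc: a
two-dimensional complex with nodes of bounded degree and small faces, over whose nodes the qubits
of `z` are spread, while every `X`-check that meets `z` is attached to the edge between the two
qubits that they share. The nodes become the new `Z`-stabilizers, the edges new qubits and the faces
new `X`-checks. Connectedness of the disc keeps the product of the new stabilizers equal to `z`,
and the vanishing of its first cohomology lets cycles be pushed off it
(`Filling.localQuasiIso`). The same grid serves for all discs; only the edges `t`, which accompany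
the links that carry `z`, depend on `z`. Because resolving has brought the pieces of the
`X`-checks into the plane of the grid, no logarithmic overhead arises.
-/

set_option linter.unusedSectionVars false

/-! ### Counting nonzero coordinates -/

theorem ZMod.two_eq_one_of_ne_zero {a : ZMod 2} (h : a ≠ 0) : a = 1 := by
  revert h; revert a; decide

section HammingNorm

variable {α β γ : Type*} [Fintype α] [Fintype β] [Fintype γ]

theorem hammingNorm_sum (v : α ⊕ β → ZMod 2) :
    hammingNorm v = hammingNorm (fun a => v (.inl a)) + hammingNorm (fun b => v (.inr b)) := by
  simp only [hammingNorm, Finset.card_filter, Fintype.sum_sum_type]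

theorem hammingNorm_le_of_injOn {v : α → ZMod 2} {w : β → ZMod 2} (g : α → β)
    (hg : ∀ a, v a ≠ 0 → w (g a) ≠ 0)
    (hinj : ∀ a b, v a ≠ 0 → v b ≠ 0 → g a = g b → a = b) :
    hammingNorm v ≤ hammingNorm w := by
  refine Finset.card_le_card_of_injOn g (fun a ha => ?_) fun a ha b hb h => ?_
  · simpa using hg a (by simpa using ha)
  · exact hinj a b (by simpa using ha) (by simpa using hb) h

theorem hammingNorm_le_card_of_injOn {v : α → ZMod 2} (g : α → β)
    (hinj : ∀ a b, v a ≠ 0 → v b ≠ 0 → g a = g b → a = b) :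
    hammingNorm v ≤ Fintype.card β := by
  refine (hammingNorm_le_of_injOn (w := fun _ => 1) g (by simp) hinj).trans ?_
  exact hammingNorm_le_card_fintype

theorem hammingNorm_le_one {v : α → ZMod 2} (h : ∀ a b, v a ≠ 0 → v b ≠ 0 → a = b) :
    hammingNorm v ≤ 1 :=
  hammingNorm_le_card_of_injOn (β := Unit) (fun _ => ()) fun a b ha hb _ => h a b ha hb

theorem hammingNorm_le_zero {v : α → ZMod 2} (h : ∀ a, v a = 0) : hammingNorm v ≤ 0 := by
  rw [Nat.le_zero, hammingNorm_eq_zero]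
  exact funext h

theorem hammingNorm_le_two {v : α → ZMod 2} (P : α → Prop)
    (h : ∀ a b, v a ≠ 0 → v b ≠ 0 → (P a ↔ P b) → a = b) : hammingNorm v ≤ 2 := by
  classical
  refine (hammingNorm_le_card_of_injOn (β := Bool) (fun a => decide (P a)) ?_).trans (by simp)
  intro a b ha hb hab
  exact h a b ha hb (by simpa using hab)

theorem hammingNorm_mono {v w : α → ZMod 2} (h : ∀ a, v a ≠ 0 → w a ≠ 0) :
    hammingNorm v ≤ hammingNorm w :=
  hammingNorm_le_of_injOn id h fun _ _ _ _ h => h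

theorem hammingNorm_add_le (v w : α → ZMod 2) :
    hammingNorm (v + w) ≤ hammingNorm v + hammingNorm w := by
  classical
  refine (Finset.card_le_card fun a ha => ?_).trans (Finset.card_union_le _ _)
  simp only [Finset.mem_filter, Finset.mem_univ, true_and, Finset.mem_union, Pi.add_apply] at ha ⊢
  by_contra! h
  exact ha (by rw [h.1, h.2, add_zero])

/-- A vector whose nonzero coordinates lie over those of `w`, with at most `k` of them over each,
has at most `k * hammingNorm w` nonzero coordinates. -/
theorem hammingNorm_le_mul {v : α → ZMod 2} {w : β → ZMod 2} {k : ℕ}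
    (R : β → α → ZMod 2) (hR : ∀ b, w b ≠ 0 → hammingNorm (R b) ≤ k)
    (h : ∀ a, v a ≠ 0 → ∃ b, w b ≠ 0 ∧ R b a ≠ 0) : hammingNorm v ≤ k * hammingNorm w := by
  classical
  have : (Finset.univ.filter fun a => v a ≠ 0) ⊆
      (Finset.univ.filter fun b => w b ≠ 0).biUnion
        fun b => Finset.univ.filter fun a => R b a ≠ 0 := by
    intro a ha
    simpa using h a (by simpa using ha)
  calc hammingNorm v ≤ _ := Finset.card_le_card this
    _ ≤ ∑ b ∈ Finset.univ.filter fun b => w b ≠ 0, k := by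
        refine Finset.card_biUnion_le.trans (Finset.sum_le_sum fun b hb => ?_)
        exact hR b (by simpa using hb)
    _ = k * hammingNorm w := by rw [Finset.sum_const, smul_eq_mul, mul_comm]; rfl

theorem hammingNorm_le_of_prod {v : α × β → ZMod 2} {w : α → ZMod 2} (m : β)
    (h : ∀ a b, v (a, b) ≠ 0 → b = m ∧ w a ≠ 0) : hammingNorm v ≤ hammingNorm w := by
  refine hammingNorm_le_of_injOn Prod.fst (fun p hp => (h _ _ hp).2) fun p p' hp hp' hpp => ?_
  exact Prod.ext hpp ((h _ _ hp).1.trans (h _ _ hp').1.symm)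

theorem hammingNorm_le_of_prod' {v : α × β → ZMod 2} {w : β → ZMod 2} (m : α)
    (h : ∀ a b, v (a, b) ≠ 0 → a = m ∧ w b ≠ 0) : hammingNorm v ≤ hammingNorm w := by
  refine hammingNorm_le_of_injOn Prod.snd (fun p hp => (h _ _ hp).2) fun p p' hp hp' hpp => ?_
  exact Prod.ext ((h _ _ hp).1.trans (h _ _ hp').1.symm) hpp

theorem natCast_hammingNorm (v : α → ZMod 2) : (hammingNorm v : ZMod 2) = ∑ a, v a := by
  classical
  rw [hammingNorm, Finset.card_filter, Nat.cast_sum]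
  refine Finset.sum_congr rfl fun a _ => ?_
  by_cases h : v a = 0
  · simp [h]
  · rw [if_pos h, ZMod.two_eq_one_of_ne_zero h, Nat.cast_one]

theorem hammingNorm_count_le [DecidableEq α] (l : List α) :
    hammingNorm (fun a => (l.count a : ZMod 2)) ≤ l.length := by
  refine (Finset.card_le_card fun a ha => ?_).trans l.toFinset_card_le
  rw [List.mem_toFinset]
  by_contra h
  simp [List.count_eq_zero_of_not_mem h] at ha

theorem sum_count_mul [DecidableEq α] (l : List α) (g : α → ZMod 2) :
    ∑ a, (l.count a : ZMod 2) * g a = (l.map g).sum := by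
  induction l with
  | nil => simp
  | cons b l ih =>
    simp only [List.count_cons, beq_iff_eq, Nat.cast_add, Nat.cast_ite, Nat.cast_one,
      Nat.cast_zero, add_mul, Finset.sum_add_distrib, ih, List.map_cons, List.sum_cons]
    simp [add_comm]

theorem hammingNorm_prod_le {v : α × β → ZMod 2} {w : α → ZMod 2}
    (h : ∀ a b, v (a, b) ≠ 0 → w a ≠ 0) :
    hammingNorm v ≤ Fintype.card β * hammingNorm w := by
  classical
  refine hammingNorm_le_mul (fun a p => if p.1 = a then 1 else 0) (fun a _ => ?_) fun p hp =>
    ⟨p.1, h p.1 p.2 hp, by simp⟩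
  refine hammingNorm_le_card_of_injOn Prod.snd ?_
  rintro ⟨a, σ⟩ ⟨b, τ⟩ ha hb hab
  simp at ha hb hab
  rw [ha, hb, hab]

end HammingNorm

theorem sum_sum_ite_eq {α β M : Type*} [Fintype α] [Fintype β] [AddCommMonoid M]
    (a : α) [∀ x, Decidable (x = a)] (f : α → β → M) :
    (∑ x, ∑ y, if x = a then f x y else 0) = ∑ y, f a y := by
  rw [Fintype.sum_eq_single a fun x hx => by simp [hx]]; simp

theorem sum_sum_ite_eq' {α β M : Type*} [Fintype α] [Fintype β] [AddCommMonoid M]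
    (a : α) [∀ x, Decidable (a = x)] (f : α → β → M) :
    (∑ x, ∑ y, if a = x then f x y else 0) = ∑ y, f a y := by
  rw [Fintype.sum_eq_single a fun x hx => by simp [hx.symm]]; simp

/-! ### Comparing the homology of two codes -/

namespace CSSCode

open Matrix

variable {C C' : CSSCode}

theorem wX_le_iff {k : ℕ} : C.wX ≤ k ↔ ∀ s, hammingNorm (C.hX s) ≤ k := by
  simp [wX, Finset.sup_le_iff]

theorem wZ_le_iff {k : ℕ} : C.wZ ≤ k ↔ ∀ s, hammingNorm (C.hZ s) ≤ k := by
  simp [wZ, Finset.sup_le_iff]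

theorem qX_le_iff {k : ℕ} : C.qX ≤ k ↔ ∀ q, hammingNorm (fun s => C.hX s q) ≤ k := by
  simp [qX, Finset.sup_le_iff]

theorem qZ_le_iff {k : ℕ} : C.qZ ≤ k ↔ ∀ q, hammingNorm (fun s => C.hZ s q) ≤ k := by
  simp [qZ, Finset.sup_le_iff]

theorem mem_zCycles {v : C.Qubit → ZMod 2} : v ∈ C.zCycles ↔ ∀ s, C.hX s ⬝ᵥ v = 0 := by
  rw [zCycles, LinearMap.mem_ker, Matrix.mulVecLin_apply, funext_iff]; rfl

theorem mem_xCycles {v : C.Qubit → ZMod 2} : v ∈ C.xCycles ↔ ∀ s, C.hZ s ⬝ᵥ v = 0 := by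
  rw [xCycles, LinearMap.mem_ker, Matrix.mulVecLin_apply, funext_iff]; rfl

theorem zBoundaries_eq_span : C.zBoundaries = Submodule.span (ZMod 2) (Set.range C.hZ) := by
  rw [zBoundaries, Matrix.range_mulVecLin]; rfl

theorem xBoundaries_eq_span : C.xBoundaries = Submodule.span (ZMod 2) (Set.range C.hX) := by
  rw [xBoundaries, Matrix.range_mulVecLin]; rfl

/-- Every `X`-type operator that commutes with all `Z`-type cycles is a product of
`X`-stabilizers. -/
theorem mem_xBoundaries_of_forall {v : C.Qubit → ZMod 2} (h : ∀ w ∈ C.zCycles, v ⬝ᵥ w = 0) :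
    v ∈ C.xBoundaries := by
  classical
  let L : (C.Qubit → ZMod 2) → (C.Qubit → ZMod 2) →ₗ[ZMod 2] ZMod 2 :=
    fun u => dotProductBilin (ZMod 2) (ZMod 2) u
  have hker : ⨅ s, LinearMap.ker (L (C.hX s)) ≤ LinearMap.ker (L v) := by
    intro w hw
    simp only [Submodule.mem_iInf, LinearMap.mem_ker] at hw
    exact h w (mem_zCycles.2 hw)
  have := mem_span_of_iInf_ker_le_ker hker
  obtain ⟨y, hy⟩ := (Submodule.mem_span_range_iff_exists_fun (ZMod 2)).1 this
  rw [xBoundaries_eq_span]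
  refine (Submodule.mem_span_range_iff_exists_fun (ZMod 2)).2 ⟨y, ?_⟩
  ext q
  have := congrArg (fun g => g (Pi.single q 1)) hy
  simpa [L, LinearMap.sum_apply, Finset.sum_apply] using this

theorem dotProduct_eq_zero_of_mem_xBoundaries {v w : C.Qubit → ZMod 2} (hv : v ∈ C.xBoundaries)
    (hw : w ∈ C.zCycles) : v ⬝ᵥ w = 0 := by
  rw [xBoundaries_eq_span] at hv
  induction hv using Submodule.span_induction with
  | mem x hx => obtain ⟨s, rfl⟩ := hx; exact mem_zCycles.1 hw s
  | zero => simp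
  | add x y _ _ hx hy => rw [add_dotProduct, hx, hy, add_zero]
  | smul a x _ hx => rw [smul_dotProduct, hx, smul_zero]

theorem dotProduct_eq_zero_of_mem_zBoundaries {v w : C.Qubit → ZMod 2} (hv : v ∈ C.xCycles)
    (hw : w ∈ C.zBoundaries) : v ⬝ᵥ w = 0 := by
  rw [zBoundaries_eq_span] at hw
  induction hw using Submodule.span_induction with
  | mem x hx => obtain ⟨s, rfl⟩ := hx; rw [dotProduct_comm]; exact mem_xCycles.1 hv s
  | zero => simp
  | add x y _ _ hx hy => rw [dotProduct_add, hx, hy, add_zero]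
  | smul a x _ hx => rw [dotProduct_smul, hx, smul_zero]

theorem add_eq_sub {α : Type*} (v w : α → ZMod 2) : v + w = v - w := by
  ext q; exact (CharTwo.sub_eq_add _ _).symm

/-- `C'` has the same number of logical qubits as `C`, and distances smaller by factors of at most
`F` and `G`. -/
structure Reduces (C C' : CSSCode) (F G : ℕ) : Prop where
  K_eq : C'.K = C.K
  dX_le : C.dX ≤ C'.dX * (F : ℕ∞)
  dZ_le : C.dZ ≤ C'.dZ * (G : ℕ∞)

theorem Reduces.trans {C₁ C₂ C₃ : CSSCode} {F F' G G' : ℕ} (h : Reduces C₁ C₂ F G)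
    (h' : Reduces C₂ C₃ F' G') : Reduces C₁ C₃ (F' * F) (G' * G) where
  K_eq := h'.K_eq.trans h.K_eq
  dX_le := h.dX_le.trans (by push_cast; rw [← mul_assoc]; gcongr; exact h'.dX_le)
  dZ_le := h.dZ_le.trans (by push_cast; rw [← mul_assoc]; gcongr; exact h'.dZ_le)

section Chain

variable {Q X Z Q' X' Z' : Type*} [Fintype Q] [Fintype Z] [Fintype Q'] [Fintype Z']

/-- `v` commutes with all rows of `hX`. -/
def IsCycle (hX : Matrix X Q (ZMod 2)) (v : Q → ZMod 2) : Prop := ∀ s, hX s ⬝ᵥ v = 0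

/-- `v` is a combination of the rows of `hZ`. -/
def IsBoundary (hZ : Matrix Z Q (ZMod 2)) (v : Q → ZMod 2) : Prop :=
  ∃ y : Z → ZMod 2, ∀ q, v q = ∑ z, y z * hZ z q

theorem isBoundary_iff {hZ : Matrix Z Q (ZMod 2)} {v : Q → ZMod 2} :
    IsBoundary hZ v ↔ v ∈ Submodule.span (ZMod 2) (Set.range fun z => hZ z) := by
  rw [Submodule.mem_span_range_iff_exists_fun]
  simp only [IsBoundary, funext_iff, Finset.sum_apply, Pi.smul_apply, smul_eq_mul, eq_comm]

theorem IsBoundary.row (hZ : Matrix Z Q (ZMod 2)) (z : Z) : IsBoundary hZ (hZ z) :=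
  isBoundary_iff.2 (Submodule.subset_span ⟨z, rfl⟩)

theorem IsBoundary.add {hZ : Matrix Z Q (ZMod 2)} {v w : Q → ZMod 2} (hv : IsBoundary hZ v)
    (hw : IsBoundary hZ w) : IsBoundary hZ (v + w) := by
  rw [isBoundary_iff] at *
  exact add_mem hv hw

theorem IsBoundary.sum {ι : Type*} {hZ : Matrix Z Q (ZMod 2)} (s : Finset ι)
    {v : ι → Q → ZMod 2} (hv : ∀ i, IsBoundary hZ (v i)) : IsBoundary hZ (∑ i ∈ s, v i) := by
  simp only [isBoundary_iff] at *
  exact sum_mem fun i _ => hv i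

theorem IsBoundary.smul {hZ : Matrix Z Q (ZMod 2)} {v : Q → ZMod 2} (a : ZMod 2)
    (hv : IsBoundary hZ v) : IsBoundary hZ (a • v) := by
  rw [isBoundary_iff] at *
  exact Submodule.smul_mem _ a hv

theorem IsBoundary.isCycle {hX : Matrix X Q (ZMod 2)} {hZ : Matrix Z Q (ZMod 2)}
    (comm : ∀ s z, hX s ⬝ᵥ hZ z = 0) {v : Q → ZMod 2} (hv : IsBoundary hZ v) : IsCycle hX v := by
  obtain ⟨y, hy⟩ := hv
  have : v = ∑ z, y z • hZ z := by ext q; simp [hy, Finset.sum_apply]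
  intro s
  rw [this, dotProduct_sum]
  exact Finset.sum_eq_zero fun z _ => by rw [dotProduct_smul, comm, smul_zero]

/-- A map on `Z`-type operators between two codes, given by their check matrices, that carries
cycles to cycles and boundaries to boundaries. It is a quasi-isomorphism in the degree of the
qubits (`inj`, `surj`), and both it and its inverse on homology spread supports in a controlled
way: a qubit of the second code meets the images of at most `F` qubits of the first, and each cycle
of the second code comes from a cycle of the first that is at most `G` times heavier. -/
structure LocalQuasiIso (hX : Matrix X Q (ZMod 2)) (hZ : Matrix Z Q (ZMod 2))
    (hX' : Matrix X' Q' (ZMod 2)) (hZ' : Matrix Z' Q' (ZMod 2)) (F G : ℕ) where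
  toFun : (Q → ZMod 2) →ₗ[ZMod 2] (Q' → ZMod 2)
  cycle : ∀ v, IsCycle hX v → IsCycle hX' (toFun v)
  boundary : ∀ z, IsBoundary hZ' (toFun (hZ z))
  inj : ∀ v, IsCycle hX v → IsBoundary hZ' (toFun v) → IsBoundary hZ v
  surj : ∀ v', IsCycle hX' v' → ∃ v, IsCycle hX v ∧
    IsBoundary hZ' (v' + toFun v) ∧ hammingNorm v ≤ G * hammingNorm v'
  row : ∀ q' : Q', ∃ R : Q → ZMod 2, hammingNorm R ≤ F ∧
    ∀ v, toFun v q' ≠ 0 → ∃ q, v q ≠ 0 ∧ R q ≠ 0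

end Chain

theorem isCycle_iff {v : C.Qubit → ZMod 2} : IsCycle C.hX v ↔ v ∈ C.zCycles :=
  mem_zCycles.symm

theorem isBoundary_iff_mem {v : C.Qubit → ZMod 2} : IsBoundary C.hZ v ↔ v ∈ C.zBoundaries := by
  rw [zBoundaries_eq_span]; exact isBoundary_iff

theorem iInf_hammingNorm_le_mul {α β : Type*} [Fintype α] [Fintype β] {S : Set (α → ZMod 2)}
    {T : Set (β → ZMod 2)} {G : ℕ} (hG : 1 ≤ G)
    (h : ∀ w ∈ T, ∃ v ∈ S, hammingNorm v ≤ G * hammingNorm w) :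
    (⨅ v ∈ S, (hammingNorm v : ℕ∞)) ≤ (⨅ w ∈ T, (hammingNorm w : ℕ∞)) * (G : ℕ∞) := by
  rcases T.eq_empty_or_nonempty with rfl | hT
  · have : (⊤ : ℕ∞) * (G : ℕ∞) = ⊤ := ENat.top_mul (by exact_mod_cast (by omega : G ≠ 0))
    simp [this]
  · have : Nonempty T := hT.to_subtype
    obtain ⟨⟨w, hw⟩, hmin⟩ := ENat.exists_eq_iInf fun w : T => (hammingNorm w.1 : ℕ∞)
    obtain ⟨v, hv, hle⟩ := h w hw
    rw [← iInf_subtype'' T fun w => (hammingNorm w : ℕ∞), ← hmin]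
    refine (iInf₂_le v hv).trans ?_
    rw [mul_comm]
    exact_mod_cast hle

namespace LocalQuasiIso

variable {F G : ℕ}

theorem boundary_le (f : LocalQuasiIso C.hX C.hZ C'.hX C'.hZ F G)
    {v : C.Qubit → ZMod 2} (hv : v ∈ C.zBoundaries) : f.toFun v ∈ C'.zBoundaries := by
  rw [zBoundaries_eq_span] at hv
  induction hv using Submodule.span_induction with
  | mem x hx => obtain ⟨s, rfl⟩ := hx; exact isBoundary_iff_mem.1 (f.boundary s)
  | zero => simp
  | add x y _ _ hx hy => rw [map_add]; exact add_mem hx hy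
  | smul a x _ hx => rw [map_smul]; exact Submodule.smul_mem _ _ hx

theorem K_eq (f : LocalQuasiIso C.hX C.hZ C'.hX C'.hZ F G) :
    C'.K = C.K := by
  let g : C.zCycles →ₗ[ZMod 2] C'.zCycles :=
    f.toFun.restrict (p := C.zCycles) (q := C'.zCycles) fun v hv =>
      isCycle_iff.1 (f.cycle v (isCycle_iff.2 hv))
  have hg : C.zBoundaries.submoduleOf C.zCycles ≤
      (C'.zBoundaries.submoduleOf C'.zCycles).comap g := fun v hv => f.boundary_le hv
  refine (LinearEquiv.finrank_eq (LinearEquiv.ofBijective (Submodule.mapQ _ _ g hg) ⟨?_, ?_⟩)).symm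
  · rw [← LinearMap.ker_eq_bot, eq_bot_iff]
    intro x hx
    obtain ⟨v, rfl⟩ := Submodule.Quotient.mk_surjective _ x
    rw [LinearMap.mem_ker, Submodule.mapQ_apply, Submodule.Quotient.mk_eq_zero] at hx
    rw [Submodule.mem_bot, Submodule.Quotient.mk_eq_zero]
    exact isBoundary_iff_mem.1 (f.inj v (isCycle_iff.2 v.2) (isBoundary_iff_mem.2 hx))
  · intro x
    obtain ⟨v', rfl⟩ := Submodule.Quotient.mk_surjective _ x
    obtain ⟨v, hv, hb, -⟩ := f.surj v' (isCycle_iff.2 v'.2)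
    refine ⟨Submodule.Quotient.mk ⟨v, isCycle_iff.1 hv⟩, ?_⟩
    rw [Submodule.mapQ_apply, eq_comm, Submodule.Quotient.eq]
    rw [add_eq_sub, isBoundary_iff_mem] at hb
    exact hb

theorem dZ_le (f : LocalQuasiIso C.hX C.hZ C'.hX C'.hZ F G)
    (hG : 1 ≤ G) :
    C.dZ ≤ C'.dZ * (G : ℕ∞) := by
  refine iInf_hammingNorm_le_mul hG ?_
  rintro v' ⟨hv', hb'⟩
  obtain ⟨v, hv, hb, hle⟩ := f.surj v' (isCycle_iff.2 hv')
  refine ⟨v, ⟨isCycle_iff.1 hv, fun h => hb' ?_⟩, hle⟩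
  rw [add_eq_sub, isBoundary_iff_mem] at hb
  simpa using add_mem hb (f.boundary_le h)

/-- The transpose of a `LocalQuasiIso` carries nontrivial `X`-type logical operators to nontrivial
ones. -/
theorem dX_le (f : LocalQuasiIso C.hX C.hZ C'.hX C'.hZ F G)
    (hF : 1 ≤ F) :
    C.dX ≤ C'.dX * (F : ℕ∞) := by
  classical
  refine iInf_hammingNorm_le_mul hF ?_
  rintro v' ⟨hv', hb'⟩
  let u : C.Qubit → ZMod 2 := fun q => v' ⬝ᵥ f.toFun (Pi.single q 1)
  have hu : ∀ w, u ⬝ᵥ w = v' ⬝ᵥ f.toFun w := by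
    intro w
    have h1 : w = ∑ q, w q • (Pi.single q 1 : C.Qubit → ZMod 2) := by
      ext q
      simp [Finset.sum_apply, Pi.single_apply]
    conv_rhs => rw [h1]
    simp only [map_sum, map_smul, dotProduct_sum, dotProduct_smul, smul_eq_mul]
    exact Finset.sum_congr rfl fun q _ => mul_comm _ _
  choose R hR hR' using f.row
  refine ⟨u, ⟨?_, fun hb => hb' ?_⟩, ?_⟩
  · rw [mem_xCycles]
    intro z
    rw [dotProduct_comm, hu]
    exact dotProduct_eq_zero_of_mem_zBoundaries hv' (isBoundary_iff_mem.1 (f.boundary z))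
  · refine mem_xBoundaries_of_forall fun w' hw' => ?_
    obtain ⟨w, hw, hwb, -⟩ := f.surj w' (isCycle_iff.2 hw')
    have h1 := dotProduct_eq_zero_of_mem_zBoundaries hv' (isBoundary_iff_mem.1 hwb)
    rw [dotProduct_add, ← hu,
      dotProduct_eq_zero_of_mem_xBoundaries hb (isCycle_iff.1 hw), add_zero] at h1
    exact h1
  · refine hammingNorm_le_mul R (fun b _ => hR b) fun q hq => ?_
    obtain ⟨q', -, hq'⟩ := Finset.exists_ne_zero_of_sum_ne_zero hq
    refine ⟨q', left_ne_zero_of_mul hq', ?_⟩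
    obtain ⟨q₁, h1, h2⟩ := hR' q' _ (right_ne_zero_of_mul hq')
    rw [Pi.single_apply, ne_eq, ite_eq_right_iff, not_forall] at h1
    obtain ⟨rfl, -⟩ := h1
    exact h2

theorem reduces (f : LocalQuasiIso C.hX C.hZ C'.hX C'.hZ F G)
    (hF : 1 ≤ F) (hG : 1 ≤ G) :
    Reduces C C' F G :=
  ⟨f.K_eq, f.dX_le hF, f.dZ_le hG⟩

end LocalQuasiIso

end CSSCode

namespace CSSCode

open Matrix

/-! ### Coning off stabilizers -/

section Cone

variable {Q X Z₁ Z₂ V E F : Type} [Fintype Q] [Fintype X] [Fintype Z₁] [Fintype Z₂] [Fintype V]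
  [Fintype E] [Fintype F]

/-- The data needed to replace each `Z`-stabilizer `z : Z₂` of a code by a two-dimensional complex
with nodes `V`, edges `E` and faces `F`. The edge `e` has boundary `d z e`, the face `f` has
boundary `φ z f`; the node `v` carries the part `a z v` of the support of `z`, and the `X`-check
`s` is attached to the edges `L z s`. The complex is connected (`conn`) and has no first
cohomology (`exact`). -/
structure Filling (hX : Matrix X Q (ZMod 2)) (h₁ : Matrix Z₁ Q (ZMod 2))
    (h₂ : Matrix Z₂ Q (ZMod 2)) (V E F : Type) [Fintype V] [Fintype E] where
  d : Z₂ → E → V → ZMod 2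
  φ : Z₂ → F → E → ZMod 2
  a : Z₂ → V → Q → ZMod 2
  L : Z₂ → X → E → ZMod 2
  comm₁ : ∀ s z, hX s ⬝ᵥ h₁ z = 0
  sum_a : ∀ z, ∑ v, a z v = h₂ z
  comm : ∀ z s v, hX s ⬝ᵥ a z v + ∑ e, L z s e * d z e v = 0
  face : ∀ z f v, ∑ e, φ z f e * d z e v = 0
  d_sum : ∀ z e, ∑ v, d z e v = 0
  conn : ∀ z (y : V → ZMod 2), (∀ e, ∑ v, d z e v * y v = 0) → ∀ u v, y u = y v
  exact : ∀ z (α : E → ZMod 2), (∀ f, ∑ e, φ z f e * α e = 0) →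
    ∃ y : V → ZMod 2, ∀ e, α e = ∑ v, d z e v * y v

namespace Filling

variable {hX : Matrix X Q (ZMod 2)} {h₁ : Matrix Z₁ Q (ZMod 2)} {h₂ : Matrix Z₂ Q (ZMod 2)}

open Classical in
/-- The `X`-checks after coning: the old ones, now acting also on the edges they are attached to,
and one for each face. -/
noncomputable def coneX (D : Filling hX h₁ h₂ V E F) : Matrix (X ⊕ Z₂ × F) (Q ⊕ Z₂ × E) (ZMod 2) :=
  Matrix.of fun
    | .inl s => Sum.elim (hX s) fun p => D.L p.1 s p.2
    | .inr t => Sum.elim 0 fun p => if p.1 = t.1 then D.φ t.1 t.2 p.2 else 0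

open Classical in
/-- The `Z`-checks after coning: those in `Z₁`, and one for each node. -/
noncomputable def coneZ (D : Filling hX h₁ h₂ V E F) : Matrix (Z₁ ⊕ Z₂ × V) (Q ⊕ Z₂ × E) (ZMod 2) :=
  Matrix.of fun
    | .inl z => Sum.elim (h₁ z) 0
    | .inr t => Sum.elim (D.a t.1 t.2) fun p => if p.1 = t.1 then D.d t.1 p.2 t.2 else 0

theorem cone_comm (D : Filling hX h₁ h₂ V E F) (s z) : D.coneX s ⬝ᵥ D.coneZ z = 0 := by
  classical
  rw [dotProduct, Fintype.sum_sum_type, Fintype.sum_prod_type]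
  rcases s with s | ⟨t, f⟩ <;> rcases z with z | ⟨u, v⟩
  · simpa [coneX, coneZ, dotProduct] using D.comm₁ s z
  · simpa [coneX, coneZ, dotProduct, sum_sum_ite_eq] using D.comm u s v
  · simp [coneX, coneZ]
  · by_cases h : u = t
    · subst h
      simpa [coneX, coneZ, sum_sum_ite_eq] using D.face u f v
    · simp [coneX, coneZ, h]

variable [Nonempty V]

/-- The inclusion of the old qubits is a quasi-isomorphism. A cycle of the cone code is pushed off
the complexes node by node; this changes it only by parts of stabilizers `z` whose complex it
meets, which have weight at most `W`. -/
noncomputable def localQuasiIso (D : Filling hX h₁ h₂ V E F) (W : ℕ)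
    (hW : ∀ z, ∃ R : Q → ZMod 2, hammingNorm R ≤ W ∧ ∀ v q, D.a z v q ≠ 0 → R q ≠ 0) :
    LocalQuasiIso hX (fromRows h₁ h₂) D.coneX D.coneZ 1 (1 + W) where
  toFun :=
    { toFun := fun v => Sum.elim v 0
      map_add' := fun v w => by ext (q | p) <;> simp
      map_smul' := fun c v => by ext (q | p) <;> simp }
  cycle v hv := by
    rintro (s | ⟨z, f⟩)
    · simpa [dotProduct, coneX] using hv s
    · simp [dotProduct, coneX]
  boundary z := by
    rcases z with z | z
    · exact IsBoundary.row D.coneZ (.inl z)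
    · convert IsBoundary.sum Finset.univ fun v => IsBoundary.row D.coneZ (.inr (z, v)) using 1
      ext (q | ⟨t, e⟩)
      · simpa [Finset.sum_apply, coneZ] using (congrFun (D.sum_a z) q).symm
      · by_cases h : t = z
        · subst h
          simpa [Finset.sum_apply, coneZ] using (D.d_sum t e).symm
        · simp [coneZ, h]
  inj v _ hb := by
    classical
    obtain ⟨y, hy⟩ := hb
    have hE : ∀ z e, ∑ u, D.d z e u * y (.inr (z, u)) = 0 := fun z e => by
      have := hy (.inr (z, e))
      rw [Fintype.sum_sum_type, Fintype.sum_prod_type] at this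
      simpa [coneZ, mul_comm, sum_sum_ite_eq'] using this.symm
    have hconst : ∀ z u u', y (.inr (z, u)) = y (.inr (z, u')) := fun z => D.conn z _ (hE z)
    let u₀ := Classical.arbitrary V
    refine ⟨Sum.elim (fun z => y (.inl z)) fun z => y (.inr (z, u₀)), fun q => ?_⟩
    have hq := hy (.inl q)
    rw [Fintype.sum_sum_type, Fintype.sum_prod_type] at hq
    rw [Fintype.sum_sum_type]
    refine Eq.trans hq ?_
    congr 1
    refine Finset.sum_congr rfl fun z _ => ?_
    have h3 := congrFun (D.sum_a z) q
    rw [Finset.sum_apply] at h3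
    rw [fromRows_apply_inr, ← h3, Finset.mul_sum]
    exact Finset.sum_congr rfl fun u _ => by rw [hconst z u u₀]; rfl
  surj v' hv' := by
    classical
    have hex : ∀ z, ∃ y : V → ZMod 2, (∀ e, v' (.inr (z, e)) = ∑ v, D.d z e v * y v) ∧
        ((∀ e, v' (.inr (z, e)) = 0) → y = 0) := by
      intro z
      by_cases h0 : ∀ e, v' (.inr (z, e)) = 0
      · exact ⟨0, fun e => by simp [h0], fun _ => rfl⟩
      · obtain ⟨y, hy⟩ := D.exact z (fun e => v' (.inr (z, e))) fun f => by
          have := hv' (.inr (z, f))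
          rw [dotProduct, Fintype.sum_sum_type, Fintype.sum_prod_type] at this
          simpa [coneX, sum_sum_ite_eq] using this
        exact ⟨y, hy, fun h => absurd h h0⟩
    choose y hy hy0 using hex
    let x : Q → ZMod 2 := (fun q => v' (.inl q)) + ∑ z, ∑ u, y z u • D.a z u
    have hb : v' + Sum.elim x 0 = ∑ z, ∑ u, y z u • D.coneZ (.inr (z, u)) := by
      ext (q | ⟨t, e⟩)
      · simp [x, coneZ, Finset.sum_apply, ← add_assoc, CharTwo.add_self_eq_zero]
      · simp [coneZ, Finset.sum_apply, hy t e, mul_comm]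
    have hbd : IsBoundary D.coneZ (v' + Sum.elim x 0) := by
      rw [hb]
      exact .sum _ fun z => .sum _ fun u => .smul _ (.row _ _)
    refine ⟨x, fun s => ?_, hbd, ?_⟩
    · have h1 := hbd.isCycle D.cone_comm (.inl s)
      rw [dotProduct_add, hv', zero_add] at h1
      simpa [dotProduct, coneX] using h1
    · choose R hR hR' using hW
      have hw : hammingNorm (∑ z, ∑ u, y z u • D.a z u) ≤
          W * hammingNorm (fun p => v' (.inr p)) := by
        refine hammingNorm_le_mul (fun p => R p.1) (fun p _ => hR p.1) fun q hq => ?_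
        rw [Finset.sum_apply] at hq
        obtain ⟨z, -, hz⟩ := Finset.exists_ne_zero_of_sum_ne_zero hq
        rw [Finset.sum_apply] at hz
        obtain ⟨u, -, hu⟩ := Finset.exists_ne_zero_of_sum_ne_zero hz
        have hα : ∃ e, v' (.inr (z, e)) ≠ 0 := by
          by_contra! h
          rw [hy0 z h] at hu
          simp at hu
        obtain ⟨e, he⟩ := hα
        exact ⟨(z, e), he, hR' z u q (right_ne_zero_of_mul hu)⟩
      have h3 := hammingNorm_add_le (fun q => v' (.inl q)) (∑ z, ∑ u, y z u • D.a z u)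
      rw [hammingNorm_sum v']
      change hammingNorm x ≤ _ at h3
      nlinarith [Nat.zero_le (W * hammingNorm (fun q => v' (.inl q)))]
  row q' := by
    classical
    rcases q' with q | p
    · refine ⟨Pi.single q 1, ?_, fun v hv => ⟨q, hv, by simp⟩⟩
      refine hammingNorm_le_one fun a b ha hb => ?_
      rw [ne_eq, Pi.single_apply, ite_eq_right_iff, Classical.not_imp] at ha hb
      rw [ha.1, hb.1]
    · exact ⟨0, by simp, fun v hv => absurd rfl hv⟩

end Filling

end Cone

end CSSCode

namespace CSSCode

open Matrix

/-! ### Thickening with event slices -/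

section Thicken

variable {Q X Z : Type} [Fintype Q] [Fintype X] [Fintype Z] {n : ℕ}

/-- The qubits of the thickened code. In this order: a copy of each qubit at each height
`k : Fin (n + 1)`, a copy in each slot `k : Fin n` between the heights `k` and `k + 1`, and, for
each `X`-check and each slot, the lower and the upper half of the segment that joins the two
copies of the check at the ends of the slot. -/
abbrev ThickQ (Q X : Type) (n : ℕ) : Type :=
  (Q × Fin (n + 1)) ⊕ ((Q × Fin n) ⊕ ((X × Fin n) ⊕ (X × Fin n)))

/-- The `X`-checks of the thickened code: the copies at the heights and those in the slots. -/
abbrev ThickX (X : Type) (n : ℕ) : Type := (X × Fin (n + 1)) ⊕ (X × Fin n)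

/-- The faces of the thickened code: the lower and the upper part of each qubit times each slot. -/
abbrev ThickF (Q : Type) (n : ℕ) : Type := (Q × Fin n) ⊕ (Q × Fin n)

variable (hX : Matrix X Q (ZMod 2)) (hZ : Matrix Z Q (ZMod 2)) (c : Z → Fin n)

/-- The qubit `x` lies on a `Z`-stabilizer that is placed in the slot `k`. -/
def EvQ (x : Q) (k : Fin n) : Prop := ∃ z, c z = k ∧ hZ z x ≠ 0

/-- The `X`-check `s` meets a `Z`-stabilizer that is placed in the slot `k`. -/
def EvX (s : X) (k : Fin n) : Prop := ∃ x, hX s x ≠ 0 ∧ EvQ hZ c x k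

open Classical in
/-- The `X`-checks of the thickened code. A slot copy of `s` subdivides the segment of `s` in that
slot only where `EvX` holds; elsewhere the lower half is the whole segment, and the slot copy
just fixes the upper half. -/
noncomputable def thickX : Matrix (ThickX X n) (ThickQ Q X n) (ZMod 2) :=
  Matrix.of fun
    | .inl (s, m), .inl (x, k) => if k = m then hX s x else 0
    | .inl _, .inr (.inl _) => 0
    | .inl (s, m), .inr (.inr (.inl (t, k))) =>
      if t = s ∧ (m = k.castSucc ∨ m = k.succ ∧ ¬ EvX hX hZ c s k) then 1 else 0
    | .inl (s, m), .inr (.inr (.inr (t, k))) =>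
      if t = s ∧ m = k.succ ∧ EvX hX hZ c s k then 1 else 0
    | .inr _, .inl _ => 0
    | .inr (s, m), .inr (.inl (x, k)) => if k = m ∧ EvQ hZ c x k then hX s x else 0
    | .inr (s, m), .inr (.inr (.inl (t, k))) =>
      if t = s ∧ k = m ∧ EvX hX hZ c s k then 1 else 0
    | .inr (s, m), .inr (.inr (.inr (t, k))) => if t = s ∧ k = m then 1 else 0

open Classical in
/-- The faces of the thickened code. A slot copy of the qubit `x` cuts the face of `x` in that slot
in two only where `EvQ` holds; elsewhere the lower face is the whole face, and the upper one just
fixes the slot copy. -/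
noncomputable def thickF : Matrix (ThickF Q n) (ThickQ Q X n) (ZMod 2) :=
  Matrix.of fun
    | .inl (x, m), .inl (y, k) =>
      if y = x ∧ (k = m.castSucc ∨ k = m.succ ∧ ¬ EvQ hZ c x m) then 1 else 0
    | .inl (x, m), .inr (.inl (y, k)) => if y = x ∧ k = m ∧ EvQ hZ c x m then 1 else 0
    | .inl (x, m), .inr (.inr (.inl (s, k))) => if k = m then hX s x else 0
    | .inl (x, m), .inr (.inr (.inr (s, k))) =>
      if k = m ∧ ¬ EvQ hZ c x m ∧ EvX hX hZ c s m then hX s x else 0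
    | .inr (x, m), .inl (y, k) => if y = x ∧ k = m.succ ∧ EvQ hZ c x m then 1 else 0
    | .inr (x, m), .inr (.inl (y, k)) => if y = x ∧ k = m then 1 else 0
    | .inr _, .inr (.inr (.inl _)) => 0
    | .inr (x, m), .inr (.inr (.inr (s, k))) => if k = m ∧ EvQ hZ c x m then hX s x else 0

open Classical in
/-- The old `Z`-stabilizers, each placed in its slot. -/
noncomputable def thickZ : Matrix Z (ThickQ Q X n) (ZMod 2) :=
  Matrix.of fun
    | z, .inr (.inl (x, k)) => if k = c z then hZ z x else 0
    | _, _ => 0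

variable {hX hZ c}

open Classical in
theorem thickX_inl_dotProduct (s : X) (m : Fin (n + 1)) (v : ThickQ Q X n → ZMod 2) :
    thickX hX hZ c (.inl (s, m)) ⬝ᵥ v = ∑ x, hX s x * v (.inl (x, m)) +
      ((∑ k : Fin n, if m = k.castSucc then v (.inr (.inr (.inl (s, k)))) else 0) +
      ∑ k : Fin n, if m = k.succ then
        if EvX hX hZ c s k then v (.inr (.inr (.inr (s, k)))) else v (.inr (.inr (.inl (s, k))))
        else 0) := by
  simp only [dotProduct, Fintype.sum_sum_type, Fintype.sum_prod_type, thickX, of_apply, ite_mul,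
    zero_mul, one_mul, Finset.sum_const_zero, zero_add]
  congr 1
  · simp
  · simp only [ite_and, sum_sum_ite_eq]
    rw [← Finset.sum_add_distrib, ← Finset.sum_add_distrib]
    refine Finset.sum_congr rfl fun k _ => ?_
    have hne : k.castSucc ≠ k.succ := Fin.castSucc_lt_succ.ne
    by_cases h1 : m = k.castSucc
    · subst h1; simp [hne]
    · by_cases h2 : EvX hX hZ c s k <;> simp [h1, h2]

open Classical in
theorem thickX_inr_dotProduct (s : X) (m : Fin n) (v : ThickQ Q X n → ZMod 2) :
    thickX hX hZ c (.inr (s, m)) ⬝ᵥ v =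
      (∑ x, if EvQ hZ c x m then hX s x * v (.inr (.inl (x, m))) else 0) +
      ((if EvX hX hZ c s m then v (.inr (.inr (.inl (s, m)))) else 0) +
        v (.inr (.inr (.inr (s, m))))) := by
  simp only [dotProduct, Fintype.sum_sum_type, Fintype.sum_prod_type, thickX, of_apply, ite_mul,
    zero_mul, one_mul, Finset.sum_const_zero, zero_add, ite_and, sum_sum_ite_eq]
  simp

theorem thick_comm (s : ThickX X n) (f : ThickF Q n) :
    thickX hX hZ c s ⬝ᵥ thickF hX hZ c f = 0 := by
  classical
  have hev : ∀ s x k, EvQ hZ c x k → hX s x ≠ 0 → EvX hX hZ c s k := fun s x k h h' => ⟨x, h', h⟩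
  rcases s with ⟨s, m⟩ | ⟨s, m⟩ <;> rcases f with ⟨x, k⟩ | ⟨x, k⟩
  · have hne : k.castSucc ≠ k.succ := Fin.castSucc_lt_succ.ne
    rw [thickX_inl_dotProduct, Fintype.sum_eq_single x fun y hy => by simp [thickF, hy],
      Fintype.sum_eq_single k fun j hj => by simp [thickF, hj],
      Fintype.sum_eq_single k fun j hj => by simp [thickF, hj]]
    simp only [thickF, of_apply, true_and, if_true]
    by_cases h0 : hX s x = 0
    · simp [h0]
    · by_cases h1 : m = k.castSucc
      · subst h1
        simp [hne, CharTwo.add_self_eq_zero]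
      · by_cases h2 : EvQ hZ c x k
        · simp [h1, h2, hev s x k h2 h0]
        · by_cases h3 : EvX hX hZ c s k <;> by_cases h4 : m = k.succ <;>
            simp [h2, h3, h4, hne.symm, CharTwo.add_self_eq_zero]
  · rw [thickX_inl_dotProduct, Fintype.sum_eq_single x fun y hy => by simp [thickF, hy],
      Fintype.sum_eq_single k fun j hj => by simp [thickF],
      Fintype.sum_eq_single k fun j hj => by simp [thickF, hj]]
    simp only [thickF, of_apply, true_and]
    by_cases h0 : hX s x = 0
    · simp [h0]
    · by_cases h2 : EvQ hZ c x k
      · by_cases h4 : m = k.succ <;> simp [h2, h4, hev s x k h2 h0, CharTwo.add_self_eq_zero]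
      · simp [h2]
  · rw [thickX_inr_dotProduct, Fintype.sum_eq_single x fun y hy => by simp [thickF, hy]]
    simp only [thickF, of_apply, true_and]
    by_cases h1 : m = k
    · subst h1
      by_cases h0 : hX s x = 0
      · simp [h0]
      · by_cases h2 : EvQ hZ c x m
        · simp [h2, hev s x m h2 h0, CharTwo.add_self_eq_zero]
        · by_cases h3 : EvX hX hZ c s m <;> simp [h2, h3, CharTwo.add_self_eq_zero]
    · simp [h1]
  · rw [thickX_inr_dotProduct, Fintype.sum_eq_single x fun y hy => by simp [thickF, hy]]
    simp only [thickF, of_apply, true_and]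
    by_cases h1 : m = k
    · subst h1
      by_cases h2 : EvQ hZ c x m <;> simp [h2, CharTwo.add_self_eq_zero]
    · simp [h1]

theorem thickX_dotProduct_thickZ (comm : ∀ s z, hX s ⬝ᵥ hZ z = 0) (s : ThickX X n) (z : Z) :
    thickX hX hZ c s ⬝ᵥ thickZ hZ c z = 0 := by
  classical
  rcases s with ⟨s, m⟩ | ⟨s, m⟩
  · rw [thickX_inl_dotProduct]
    simp [thickZ]
  · rw [thickX_inr_dotProduct]
    by_cases h : m = c z
    · subst h
      refine Eq.trans ?_ (comm s z)
      simp only [thickZ, of_apply, if_true, ite_self, add_zero, dotProduct]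
      refine Finset.sum_congr rfl fun x _ => ?_
      by_cases h0 : hZ z x = 0
      · simp [h0]
      · rw [if_pos ⟨z, rfl, h0⟩]
    · simp [thickZ, h]

/-- The operators that touch no copy of a qubit except at the lowest height. -/
def lowSubmodule (Q X : Type) (n : ℕ) : Submodule (ZMod 2) (ThickQ Q X n → ZMod 2) where
  carrier := {v | (∀ x k, k ≠ 0 → v (.inl (x, k)) = 0) ∧ ∀ x k, v (.inr (.inl (x, k))) = 0}
  add_mem' hv hw :=
    ⟨fun x k hk => by simp [hv.1 x k hk, hw.1 x k hk], fun x k => by simp [hv.2 x k, hw.2 x k]⟩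
  zero_mem' := ⟨fun _ _ _ => rfl, fun _ _ => rfl⟩
  smul_mem' a v hv := ⟨fun x k hk => by simp [hv.1 x k hk], fun x k => by simp [hv.2 x k]⟩

/-- Faces push every operator down to the lowest height. -/
theorem low_sup_faces : lowSubmodule Q X n ⊔
    Submodule.span (ZMod 2) (Set.range fun f => thickF hX hZ c f) = ⊤ := by
  classical
  set S := lowSubmodule Q X n ⊔ Submodule.span (ZMod 2) (Set.range fun f => thickF hX hZ c f)
    with hS
  have hlow : ∀ v ∈ lowSubmodule Q X n, v ∈ S := fun v hv => Submodule.mem_sup_left hv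
  have hface : ∀ f, thickF hX hZ c f ∈ S :=
    fun f => Submodule.mem_sup_right (Submodule.subset_span ⟨f, rfl⟩)
  let e : ThickQ Q X n → ThickQ Q X n → ZMod 2 := fun y => Pi.single y 1
  -- climbing one slot: both the slot copy and the upper copy are reached from the lower copy
  have hstep : ∀ x k, e (.inl (x, k.castSucc)) ∈ S →
      e (.inr (.inl (x, k))) ∈ S ∧ e (.inl (x, k.succ)) ∈ S := by
    intro x k hk
    have hne : k.castSucc ≠ k.succ := Fin.castSucc_lt_succ.ne
    by_cases h : EvQ hZ c x k
    · have h1 : thickF hX hZ c (.inl (x, k)) + e (.inl (x, k.castSucc)) + e (.inr (.inl (x, k)))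
          ∈ S := by
        refine hlow _ ⟨fun y j hj => ?_, fun y j => ?_⟩
        · by_cases hy : y = x <;> by_cases hj : j = k.castSucc <;>
            simp [thickF, e, h, hy, hj, CharTwo.add_self_eq_zero]
        · by_cases hy : y = x <;> by_cases hj : j = k <;>
            simp [thickF, e, h, hy, hj, CharTwo.add_self_eq_zero]
      have h2 : e (.inr (.inl (x, k))) ∈ S := by
        have := sub_mem (sub_mem h1 (hface (.inl (x, k)))) hk
        convert this using 1; abel
      have h3 : thickF hX hZ c (.inr (x, k)) + e (.inr (.inl (x, k))) + e (.inl (x, k.succ))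
          ∈ S := by
        refine hlow _ ⟨fun y j hj => ?_, fun y j => ?_⟩
        · by_cases hy : y = x <;> by_cases hj : j = k.succ <;>
            simp [thickF, e, h, hy, hj, CharTwo.add_self_eq_zero]
        · by_cases hy : y = x <;> by_cases hj : j = k <;>
            simp [thickF, e, hy, hj, CharTwo.add_self_eq_zero]
      refine ⟨h2, ?_⟩
      have := sub_mem (sub_mem h3 (hface (.inr (x, k)))) h2
      convert this using 1; abel
    · refine ⟨?_, ?_⟩
      · convert hface (.inr (x, k)) using 1
        ext (⟨y, j⟩ | ⟨y, j⟩ | ⟨s, j⟩ | ⟨s, j⟩) <;> simp [thickF, e, Pi.single_apply, h]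
      · have h1 : thickF hX hZ c (.inl (x, k)) + e (.inl (x, k.castSucc)) + e (.inl (x, k.succ))
            ∈ S := by
          refine hlow _ ⟨fun y j hj => ?_, fun y j => ?_⟩
          · by_cases hy : y = x <;> by_cases hj : j = k.castSucc <;>
              by_cases hj' : j = k.succ <;>
              simp_all [thickF, e, CharTwo.add_self_eq_zero]
          · simp [thickF, e, h]
        have := sub_mem (sub_mem h1 (hface (.inl (x, k)))) hk
        convert this using 1; abel
  have hgen : ∀ x k, e (.inl (x, k)) ∈ S := by
    intro x k
    induction k using Fin.induction with
    | zero =>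
      exact hlow _ ⟨fun y j hj => by simp [e, hj], fun y j => by simp [e]⟩
    | succ k ih => exact (hstep x k ih).2
  have hall : ∀ y, e y ∈ S := by
    rintro (⟨x, k⟩ | ⟨x, k⟩ | ⟨s, k⟩ | ⟨s, k⟩)
    · exact hgen x k
    · exact (hstep x k (hgen x _)).1
    · exact hlow _ ⟨fun _ _ _ => by simp [e], fun _ _ => by simp [e]⟩
    · exact hlow _ ⟨fun _ _ _ => by simp [e], fun _ _ => by simp [e]⟩
  rw [eq_top_iff]
  intro v _
  have hv : v = ∑ y, v y • e y := by
    ext y; simp only [Finset.sum_apply, e, Pi.smul_apply, Pi.single_apply]; simp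
  rw [hv]
  exact sum_mem fun y _ => Submodule.smul_mem _ _ (hall y)

open Classical in
/-- The projection of the thickened code to the old one, on qubits. Slot copies that lie on no
stabilizer placed in the slot are ignored. -/
noncomputable def collapse (hZ : Matrix Z Q (ZMod 2)) (c : Z → Fin n) (v : ThickQ Q X n → ZMod 2)
    (x : Q) : ZMod 2 :=
  ∑ k, v (.inl (x, k)) + ∑ k, if EvQ hZ c x k then v (.inr (.inl (x, k))) else 0

theorem collapse_add (v w : ThickQ Q X n → ZMod 2) :
    collapse hZ c (v + w) = collapse hZ c v + collapse hZ c w := by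
  classical
  ext x
  have h : ∀ k, (if EvQ hZ c x k then v (.inr (.inl (x, k))) + w (.inr (.inl (x, k))) else 0) =
      (if EvQ hZ c x k then v (.inr (.inl (x, k))) else 0) +
        if EvQ hZ c x k then w (.inr (.inl (x, k))) else 0 := fun k => by split_ifs <;> simp
  simp only [collapse, Pi.add_apply, h, Finset.sum_add_distrib]
  ring

theorem collapse_smul (a : ZMod 2) (v : ThickQ Q X n → ZMod 2) :
    collapse hZ c (a • v) = a • collapse hZ c v := by
  ext x
  simp only [collapse, Pi.smul_apply, smul_eq_mul, mul_add, Finset.mul_sum, mul_ite, mul_zero]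

theorem collapse_thickF (f : ThickF Q n) : collapse hZ c (thickF hX hZ c f) = 0 := by
  classical
  ext x
  rcases f with ⟨y, k⟩ | ⟨y, k⟩
  · have hne : k.castSucc ≠ k.succ := Fin.castSucc_lt_succ.ne
    by_cases hy : x = y
    · subst hy
      by_cases h : EvQ hZ c x k
      · have h2 : (∑ j, if EvQ hZ c x j then thickF hX hZ c (.inl (x, k)) (.inr (.inl (x, j)))
            else 0) = 1 := by
          rw [Fintype.sum_eq_single k fun j hj => by simp [thickF, hj]]
          simp [thickF, h]
        rw [collapse, h2]
        simp [thickF, h, CharTwo.add_self_eq_zero]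
      · have : ∀ j : Fin (n + 1), (if j = k.castSucc ∨ j = k.succ then (1 : ZMod 2) else 0) =
            (if j = k.castSucc then 1 else 0) + if j = k.succ then 1 else 0 := by
          intro j
          by_cases h1 : j = k.castSucc
          · simp [h1, hne]
          · simp [h1]
        simp [collapse, thickF, h, this, Finset.sum_add_distrib, CharTwo.add_self_eq_zero]
    · simp [collapse, thickF, hy]
  · by_cases hy : x = y
    · subst hy
      have h2 : (∑ j, if EvQ hZ c x j then thickF hX hZ c (.inr (x, k)) (.inr (.inl (x, j)))
          else 0) = if EvQ hZ c x k then 1 else 0 := by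
        rw [Fintype.sum_eq_single k fun j hj => by simp [thickF, hj]]
        simp [thickF]
      rw [collapse, h2]
      by_cases h : EvQ hZ c x k <;> simp [thickF, h, CharTwo.add_self_eq_zero]
    · simp [collapse, thickF, hy]

theorem collapse_thickZ (z : Z) : collapse hZ c (thickZ (X := X) hZ c z) = hZ z := by
  classical
  ext x
  rw [collapse, Fintype.sum_eq_single (c z) fun j hj => by simp [thickZ, hj]]
  by_cases h : hZ z x = 0
  · simp [thickZ, h]
  · simp [thickZ, show EvQ hZ c x (c z) from ⟨z, rfl, h⟩]

theorem collapse_of_isBoundary {b : ThickQ Q X n → ZMod 2} (hb : IsBoundary (thickF hX hZ c) b) :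
    collapse hZ c b = 0 := by
  rw [isBoundary_iff] at hb
  induction hb using Submodule.span_induction with
  | mem x hx => obtain ⟨f, rfl⟩ := hx; exact collapse_thickF f
  | zero => ext x; simp [collapse]
  | add x y _ _ hx hy => rw [collapse_add, hx, hy, add_zero]
  | smul a x _ hx => rw [collapse_smul, hx, smul_zero]

theorem hammingNorm_collapse_le (v : ThickQ Q X n → ZMod 2) :
    hammingNorm (collapse hZ c v) ≤ hammingNorm v := by
  classical
  rw [← one_mul (hammingNorm v)]
  refine hammingNorm_le_mul (fun y x => match y with
    | .inl (y, _) => if x = y then 1 else 0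
    | .inr (.inl (y, _)) => if x = y then 1 else 0
    | _ => 0) (fun y _ => hammingNorm_le_one fun a b ha hb => ?_) fun x hx => ?_
  · rcases y with ⟨y, k⟩ | ⟨y, k⟩ | ⟨s, k⟩ | ⟨s, k⟩ <;> simp_all
  · by_cases h : ∑ k, v (.inl (x, k)) = 0
    · rw [collapse, h, zero_add] at hx
      obtain ⟨k, -, hk⟩ := Finset.exists_ne_zero_of_sum_ne_zero hx
      refine ⟨.inr (.inl (x, k)), fun h0 => hk ?_, by simp⟩
      rw [h0, ite_self]
    · obtain ⟨k, -, hk⟩ := Finset.exists_ne_zero_of_sum_ne_zero h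
      exact ⟨.inl (x, k), hk, by simp⟩

/-- The inclusion of the old code at the lowest height, on qubits. -/
def lowest (Q X : Type) (n : ℕ) : (Q → ZMod 2) →ₗ[ZMod 2] (ThickQ Q X n → ZMod 2) where
  toFun v := Sum.elim (fun p => if p.2 = 0 then v p.1 else 0) 0
  map_add' v w := by
    ext (⟨x, k⟩ | y)
    · by_cases hk : k = 0 <;> simp [hk]
    · simp
  map_smul' a v := by
    ext (⟨x, k⟩ | y)
    · by_cases hk : k = 0 <;> simp [hk]
    · simp

theorem lowest_inl (v : Q → ZMod 2) (x : Q) (k : Fin (n + 1)) :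
    lowest Q X n v (.inl (x, k)) = if k = 0 then v x else 0 := rfl

theorem lowest_inr (v : Q → ZMod 2) (y) : lowest Q X n v (.inr y) = 0 := rfl

theorem collapse_lowest (v : Q → ZMod 2) : collapse hZ c (lowest Q X n v) = v := by
  ext x
  simp [collapse, lowest_inl, lowest_inr]

/-- A cycle of the thickened code that touches no copy of a qubit except at the lowest height
contains no segment, because a topmost segment would have an uncovered upper end. -/
theorem eq_lowest_of_isCycle {u : ThickQ Q X n → ZMod 2} (hu : u ∈ lowSubmodule Q X n)
    (hc : IsCycle (thickX hX hZ c) u) : u = lowest Q X n fun x => u (.inl (x, 0)) := by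
  classical
  have hev : ∀ s k, (if EvX hX hZ c s k then u (.inr (.inr (.inl (s, k)))) else 0) +
      u (.inr (.inr (.inr (s, k)))) = 0 := by
    intro s k
    have := hc (.inr (s, k))
    rw [thickX_inr_dotProduct] at this
    simpa [hu.2] using this
  have hlo : ∀ d (s : X) (k : Fin n), n ≤ k + d → u (.inr (.inr (.inl (s, k)))) = 0 := by
    intro d
    induction d with
    | zero => intro s k hk; omega
    | succ d ih =>
      intro s k hk
      have h1 := hc (.inl (s, k.succ))
      rw [thickX_inl_dotProduct,
        Fintype.sum_eq_zero _ fun x => by rw [hu.1 x _ (Fin.succ_ne_zero k), mul_zero],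
        Fintype.sum_eq_zero _ fun j => ?_,
        Fintype.sum_eq_single k fun j hj => by simp [Ne.symm hj], if_pos rfl] at h1
      · by_cases h : EvX hX hZ c s k
        · have h2 := hev s k
          rw [if_pos h] at h1 h2
          simp only [zero_add] at h1
          rwa [h1, add_zero] at h2
        · simpa [h] using h1
      · by_cases hj : k.succ = j.castSucc
        · rw [if_pos hj, ih]
          have := congrArg Fin.val hj
          simp at this
          omega
        · rw [if_neg hj]
  ext (⟨x, k⟩ | ⟨x, k⟩ | ⟨s, k⟩ | ⟨s, k⟩)
  · by_cases hk : k = 0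
    · subst hk; rfl
    · rw [hu.1 x k hk, lowest_inl, if_neg hk]
  · rw [hu.2, lowest_inr]
  · rw [hlo n s k (by omega), lowest_inr]
  · have := hev s k
    rw [hlo n s k (by omega), ite_self, zero_add] at this
    rw [this, lowest_inr]

/-- Every cycle of the thickened code is homologous, through faces, to its projection. -/
theorem isBoundary_add_lowest_collapse {v : ThickQ Q X n → ZMod 2}
    (hv : IsCycle (thickX hX hZ c) v) :
    IsBoundary (thickF hX hZ c) (v + lowest Q X n (collapse hZ c v)) := by
  have h : v ∈ lowSubmodule Q X n ⊔
      Submodule.span (ZMod 2) (Set.range fun f => thickF hX hZ c f) := by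
    rw [low_sup_faces]; trivial
  obtain ⟨u, hu, b, hb, rfl⟩ := Submodule.mem_sup.1 h
  have hb' : IsBoundary (thickF hX hZ c) b := isBoundary_iff.2 hb
  have huc : IsCycle (thickX hX hZ c) u := fun s => by
    have h1 := hv s
    rwa [dotProduct_add, hb'.isCycle thick_comm s, add_zero] at h1
  have h1 := eq_lowest_of_isCycle hu huc
  have h2 : lowest Q X n (collapse hZ c (u + b)) = u := by
    rw [collapse_add, collapse_of_isBoundary hb', add_zero, h1, collapse_lowest]
  rw [h2]
  convert hb' using 1
  ext q
  simp only [Pi.add_apply]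
  rw [add_right_comm, CharTwo.add_self_eq_zero, zero_add]

theorem isBoundary_fromRows {Z₁ Z₂ : Type} [Fintype Z₁] [Fintype Z₂] {h₁ : Matrix Z₁ Q (ZMod 2)}
    {h₂ : Matrix Z₂ Q (ZMod 2)} {v : Q → ZMod 2} (h : IsBoundary h₁ v) :
    IsBoundary (fromRows h₁ h₂) v := by
  obtain ⟨y, hy⟩ := h
  refine ⟨Sum.elim y 0, fun q => ?_⟩
  simp [Fintype.sum_sum_type, hy]

/-- The inclusion at the lowest height is a quasi-isomorphism. -/
noncomputable def thickLocalQuasiIso (comm : ∀ s z, hX s ⬝ᵥ hZ z = 0) :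
    LocalQuasiIso hX hZ (thickX hX hZ c) (fromRows (thickF hX hZ c) (thickZ hZ c)) 1 1 where
  toFun := lowest Q X n
  cycle v hv := by
    classical
    rintro (⟨s, m⟩ | ⟨s, m⟩)
    · rw [thickX_inl_dotProduct]
      simp only [lowest_inl, lowest_inr, ite_self, Finset.sum_const_zero, add_zero]
      by_cases hm : m = 0
      · simpa [hm, dotProduct] using hv s
      · simp [hm]
    · rw [thickX_inr_dotProduct]
      simp [lowest_inr]
  boundary z := by
    have h1 := isBoundary_add_lowest_collapse (c := c)
      (v := thickZ hZ c z) fun s => thickX_dotProduct_thickZ comm s z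
    rw [collapse_thickZ] at h1
    have h2 := (isBoundary_fromRows (h₂ := thickZ hZ c) h1).add
      (IsBoundary.row (fromRows (thickF hX hZ c) (thickZ hZ c)) (.inr z))
    convert h2 using 1
    ext q
    simp only [Pi.add_apply, fromRows_apply_inr]
    rw [add_right_comm, CharTwo.add_self_eq_zero, zero_add]
  inj v _ hb := by
    obtain ⟨y, hy⟩ := hb
    have h1 : lowest Q X n v = ∑ f, y (.inl f) • thickF hX hZ c f +
        ∑ z, y (.inr z) • thickZ hZ c z := by
      ext q
      rw [hy q, Fintype.sum_sum_type]
      simp [Finset.sum_apply]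
    have h2 : IsBoundary (thickF hX hZ c) (∑ f, y (.inl f) • thickF hX hZ c f) :=
      .sum _ fun f => .smul _ (.row _ f)
    have h3 : v = collapse hZ c (∑ z, y (.inr z) • thickZ (X := X) hZ c z) := by
      rw [← collapse_lowest (hZ := hZ) (c := c) (X := X) v, h1, collapse_add,
        collapse_of_isBoundary h2, zero_add]
    refine ⟨fun z => y (.inr z), fun q => ?_⟩
    let L : (ThickQ Q X n → ZMod 2) →ₗ[ZMod 2] (Q → ZMod 2) :=
      ⟨⟨collapse hZ c, collapse_add⟩, collapse_smul⟩
    have h4 : v = L (∑ z, y (.inr z) • thickZ (X := X) hZ c z) := h3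
    rw [h4, map_sum, Finset.sum_apply]
    refine Finset.sum_congr rfl fun z _ => ?_
    rw [map_smul, Pi.smul_apply, smul_eq_mul]
    exact congrArg _ (congrFun (collapse_thickZ z) q)
  surj v' hv' := by
    classical
    have hb := isBoundary_add_lowest_collapse hv'
    refine ⟨collapse hZ c v', fun s => ?_, isBoundary_fromRows hb, by
      rw [one_mul]; exact hammingNorm_collapse_le v'⟩
    have h1 := hb.isCycle thick_comm (.inl (s, 0))
    rw [dotProduct_add, hv', zero_add, thickX_inl_dotProduct] at h1
    simpa [lowest_inl, lowest_inr, dotProduct] using h1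
  row q' := by
    classical
    rcases q' with ⟨q, k⟩ | p
    · refine ⟨Pi.single q 1, ?_, fun v hv => ⟨q, ?_, by simp⟩⟩
      · refine hammingNorm_le_one fun a b ha hb => ?_
        rw [ne_eq, Pi.single_apply, ite_eq_right_iff, Classical.not_imp] at ha hb
        rw [ha.1, hb.1]
      · rw [lowest_inl] at hv
        exact fun h => hv (by rw [h, ite_self])
    · exact ⟨0, by simp, fun v hv => absurd (lowest_inr v p) hv⟩

end Thicken

end CSSCode

namespace CSSCode

open Matrix

/-! ### Resolving the `X`-checks -/

section Resolve

variable {Q X Z : Type} [Fintype Q] [Fintype X] [Fintype Z] {R n : ℕ}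

/-- The qubits of the resolved code. The rows `ρ : Fin (R + 1)` index classes of `X`-checks. In
this order: for each qubit and each row two copies of the qubit (here called *front* and *back*),
and a third one (the *leg*) that feeds the `X`-check of that row; and for each `X`-check the
links that join its pieces. -/
abbrev ResQ (Q X : Type) (R n : ℕ) : Type :=
  (Q × Fin (R + 1)) ⊕ ((Q × Fin (R + 1)) ⊕ ((Q × Fin (R + 1)) ⊕ (X × Fin n)))

/-- The `X`-checks of the resolved code. In this order: those that equate front and back copies,
those that equate a back copy with the next front copy, those that equate a back copy with the
leg, and the pieces of the old `X`-checks, one for each position. -/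
abbrev ResX (Q X : Type) (R n : ℕ) : Type :=
  (Q × Fin (R + 1)) ⊕ ((Q × Fin R) ⊕ ((Q × Fin (R + 1)) ⊕ (X × Fin (n + 1))))

variable (hX : Matrix X Q (ZMod 2)) (row : X → Fin (R + 1)) (pos : Q → Fin (n + 1))

/-- Some `X`-check in the row `ρ` acts on the qubit `q`. -/
def HasLeg (q : Q) (ρ : Fin (R + 1)) : Prop := ∃ s, hX s q ≠ 0 ∧ row s = ρ

open Classical in
/-- The `X`-checks of the resolved code. -/
noncomputable def resX : Matrix (ResX Q X R n) (ResQ Q X R n) (ZMod 2) :=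
  Matrix.of fun
    | .inl t, .inl p => if p = t then 1 else 0
    | .inl t, .inr (.inl p) => if p = t then 1 else 0
    | .inl _, .inr (.inr _) => 0
    | .inr (.inl t), .inl p => if p = (t.1, t.2.succ) then 1 else 0
    | .inr (.inl t), .inr (.inl p) => if p = (t.1, t.2.castSucc) then 1 else 0
    | .inr (.inl _), .inr (.inr _) => 0
    | .inr (.inr (.inl _)), .inl _ => 0
    | .inr (.inr (.inl t)), .inr (.inl p) => if p = t ∧ HasLeg hX row t.1 t.2 then 1 else 0
    | .inr (.inr (.inl t)), .inr (.inr (.inl p)) => if p = t then 1 else 0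
    | .inr (.inr (.inl _)), .inr (.inr (.inr _)) => 0
    | .inr (.inr (.inr _)), .inl _ => 0
    | .inr (.inr (.inr _)), .inr (.inl _) => 0
    | .inr (.inr (.inr (s, m))), .inr (.inr (.inl (q, ρ))) =>
      if row s = ρ ∧ pos q = m then hX s q else 0
    | .inr (.inr (.inr (s, m))), .inr (.inr (.inr (t, j))) =>
      if t = s ∧ (m = j.castSucc ∨ m = j.succ) then 1 else 0

open Classical in
/-- The map of `Z`-type operators to the resolved code. A link of `s` carries the parity of the
operator on the part of `s` beyond it. -/
noncomputable def resolve : (Q → ZMod 2) →ₗ[ZMod 2] (ResQ Q X R n → ZMod 2) where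
  toFun v
    | .inl (q, _) => v q
    | .inr (.inl (q, _)) => v q
    | .inr (.inr (.inl (q, ρ))) => if HasLeg hX row q ρ then v q else 0
    | .inr (.inr (.inr (s, j))) => ∑ q, if (j : ℕ) < pos q then hX s q * v q else 0
  map_add' v w := by
    ext (⟨q, ρ⟩ | ⟨q, ρ⟩ | ⟨q, ρ⟩ | ⟨s, j⟩)
    · rfl
    · rfl
    · by_cases h : HasLeg hX row q ρ <;> simp [h]
    · simp only [Pi.add_apply, ← Finset.sum_add_distrib]
      refine Finset.sum_congr rfl fun q _ => ?_
      split_ifs <;> ring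
  map_smul' a v := by
    ext (⟨q, ρ⟩ | ⟨q, ρ⟩ | ⟨q, ρ⟩ | ⟨s, j⟩)
    · rfl
    · rfl
    · by_cases h : HasLeg hX row q ρ <;> simp [h]
    · simp only [Pi.smul_apply, smul_eq_mul, Finset.mul_sum, RingHom.id_apply]
      refine Finset.sum_congr rfl fun q _ => ?_
      split_ifs <;> ring

variable {hX row pos}

theorem resolve_front (v : Q → ZMod 2) (q ρ) : resolve hX row pos v (.inl (q, ρ)) = v q := rfl

theorem resolve_back (v : Q → ZMod 2) (q ρ) : resolve hX row pos v (.inr (.inl (q, ρ))) = v q :=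
  rfl

open Classical in
theorem resolve_leg (v : Q → ZMod 2) (q ρ) : resolve hX row pos v (.inr (.inr (.inl (q, ρ)))) =
    if HasLeg hX row q ρ then v q else 0 := rfl

open Classical in
theorem resolve_link (v : Q → ZMod 2) (s j) : resolve hX row pos v (.inr (.inr (.inr (s, j)))) =
    ∑ q, if (j : ℕ) < pos q then hX s q * v q else 0 := by
  rw [resolve]; simp

theorem resX_front_dotProduct (q ρ) (v : ResQ Q X R n → ZMod 2) :
    resX hX row pos (.inl (q, ρ)) ⬝ᵥ v = v (.inl (q, ρ)) + v (.inr (.inl (q, ρ))) := by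
  simp [dotProduct, Fintype.sum_sum_type, resX]

theorem resX_back_dotProduct (q) (ρ : Fin R) (v : ResQ Q X R n → ZMod 2) :
    resX hX row pos (.inr (.inl (q, ρ))) ⬝ᵥ v =
      v (.inl (q, ρ.succ)) + v (.inr (.inl (q, ρ.castSucc))) := by
  simp [dotProduct, Fintype.sum_sum_type, resX]

open Classical in
theorem resX_leg_dotProduct (q ρ) (v : ResQ Q X R n → ZMod 2) :
    resX hX row pos (.inr (.inr (.inl (q, ρ)))) ⬝ᵥ v =
      (if HasLeg hX row q ρ then v (.inr (.inl (q, ρ))) else 0) +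
        v (.inr (.inr (.inl (q, ρ)))) := by
  by_cases h : HasLeg hX row q ρ <;> simp [dotProduct, Fintype.sum_sum_type, resX, h]

open Classical in
theorem resX_piece_dotProduct (s m) (v : ResQ Q X R n → ZMod 2) :
    resX hX row pos (.inr (.inr (.inr (s, m)))) ⬝ᵥ v =
      (∑ q, if pos q = m then hX s q * v (.inr (.inr (.inl (q, row s)))) else 0) +
      ((∑ j : Fin n, if m = j.castSucc then v (.inr (.inr (.inr (s, j)))) else 0) +
        ∑ j : Fin n, if m = j.succ then v (.inr (.inr (.inr (s, j)))) else 0) := by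
  simp only [dotProduct, Fintype.sum_sum_type, Fintype.sum_prod_type, resX, of_apply, ite_mul,
    zero_mul, one_mul, Finset.sum_const_zero, zero_add, ite_and, sum_sum_ite_eq,
    Finset.sum_ite_eq, Finset.mem_univ, if_true]
  congr 1
  rw [← Finset.sum_add_distrib]
  refine Finset.sum_congr rfl fun j _ => ?_
  have hne : j.castSucc ≠ j.succ := Fin.castSucc_lt_succ.ne
  by_cases h1 : m = j.castSucc
  · subst h1; simp [hne]
  · simp [h1]

theorem isCycle_resolve {v : Q → ZMod 2} (hv : IsCycle hX v) :
    IsCycle (resX hX row pos) (resolve hX row pos v) := by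
  classical
  rintro (⟨q, ρ⟩ | ⟨q, ρ⟩ | ⟨q, ρ⟩ | ⟨s, m⟩)
  · rw [resX_front_dotProduct, resolve_front, resolve_back, CharTwo.add_self_eq_zero]
  · rw [resX_back_dotProduct, resolve_front, resolve_back, CharTwo.add_self_eq_zero]
  · rw [resX_leg_dotProduct, resolve_leg, resolve_back, CharTwo.add_self_eq_zero]
  · rw [resX_piece_dotProduct]
    simp only [resolve_leg, resolve_link]
    have h0 : (∑ q, if pos q = m then
        hX s q * (if HasLeg hX row q (row s) then v q else 0) else 0) =
        ∑ q, if pos q = m then hX s q * v q else 0 := by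
      refine Finset.sum_congr rfl fun q _ => ?_
      by_cases h : hX s q = 0
      · simp [h]
      · rw [if_pos (show HasLeg hX row q (row s) from ⟨s, h, rfl⟩)]
    have h1 : (∑ j : Fin n, if m = j.castSucc then
        ∑ q, if (j : ℕ) < pos q then hX s q * v q else 0 else 0) =
        ∑ q, if m < pos q then hX s q * v q else 0 := by
      induction m using Fin.lastCases with
      | last =>
        rw [Fintype.sum_eq_zero _ fun j => if_neg (Fin.castSucc_lt_last j).ne',
          Fintype.sum_eq_zero _ fun q => if_neg (Fin.le_last _).not_gt]
      | cast m =>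
        rw [Fintype.sum_eq_single m fun j hj => by simp [Ne.symm hj], if_pos rfl]
        rfl
    have h2 : (∑ j : Fin n, if m = j.succ then
        ∑ q, if (j : ℕ) < pos q then hX s q * v q else 0 else 0) =
        ∑ q, if m ≤ pos q then hX s q * v q else 0 := by
      induction m using Fin.cases with
      | zero =>
        rw [Fintype.sum_eq_zero _ fun j => if_neg (Fin.succ_ne_zero j).symm]
        simpa [dotProduct] using (hv s).symm
      | succ m =>
        rw [Fintype.sum_eq_single m fun j hj => by simp [Ne.symm hj], if_pos rfl]
        rfl
    rw [h0, h1, h2, ← Finset.sum_add_distrib, ← Finset.sum_add_distrib]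
    refine Finset.sum_eq_zero fun q _ => ?_
    rcases lt_trichotomy (pos q) m with h | h | h
    · simp [h.ne, h.not_gt, h.not_ge]
    · simp [h, CharTwo.add_self_eq_zero]
    · simp [h.ne', h, h.le, CharTwo.add_self_eq_zero]

/-- A cycle of the resolved code is determined by its values on the front copies in the first row:
summing the pieces of `s` beyond a link yields the value there. -/
theorem eq_resolve_of_isCycle {w : ResQ Q X R n → ZMod 2} (hw : IsCycle (resX hX row pos) w) :
    IsCycle hX (fun q => w (.inl (q, 0))) ∧
      w = resolve hX row pos fun q => w (.inl (q, 0)) := by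
  classical
  have heq : ∀ {a b : ZMod 2}, a + b = 0 → b = a := fun {a b} h => by
    rw [CharTwo.add_eq_zero] at h; exact h.symm
  have hF : ∀ q ρ, w (.inl (q, ρ)) = w (.inl (q, 0)) ∧
      w (.inr (.inl (q, ρ))) = w (.inl (q, 0)) := by
    intro q ρ
    have hb : ∀ ρ, w (.inr (.inl (q, ρ))) = w (.inl (q, ρ)) := fun ρ => by
      have := hw (.inl (q, ρ))
      rw [resX_front_dotProduct] at this
      exact heq this
    have hf : w (.inl (q, ρ)) = w (.inl (q, 0)) := by
      induction ρ using Fin.induction with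
      | zero => rfl
      | succ ρ ih =>
        have := hw (.inr (.inl (q, ρ)))
        rw [resX_back_dotProduct] at this
        rw [← heq this, hb, ih]
    exact ⟨hf, (hb ρ).trans hf⟩
  have hL : ∀ q ρ, w (.inr (.inr (.inl (q, ρ)))) =
      if HasLeg hX row q ρ then w (.inl (q, 0)) else 0 := by
    intro q ρ
    have := hw (.inr (.inr (.inl (q, ρ))))
    rw [resX_leg_dotProduct, (hF q ρ).2] at this
    exact heq this
  have hleg : ∀ s q, hX s q * w (.inr (.inr (.inl (q, row s)))) = hX s q * w (.inl (q, 0)) := by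
    intro s q
    by_cases h : hX s q = 0
    · simp [h]
    · rw [hL, if_pos ⟨s, h, rfl⟩]
  -- the sum of the pieces of `s` at the positions in a set `A`
  have hsum : ∀ s (A : Fin (n + 1) → Prop) [DecidablePred A],
      (∑ q, if A (pos q) then hX s q * w (.inl (q, 0)) else 0) +
      ((∑ j : Fin n, if A j.castSucc then w (.inr (.inr (.inr (s, j)))) else 0) +
        ∑ j : Fin n, if A j.succ then w (.inr (.inr (.inr (s, j)))) else 0) = 0 := by
    intro s A _
    have h0 : ∑ m, (if A m then resX hX row pos (.inr (.inr (.inr (s, m)))) ⬝ᵥ w else 0) = 0 :=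
      Finset.sum_eq_zero fun m _ => by rw [hw, ite_self]
    refine Eq.trans ?_ h0
    have h1 : ∀ {ι : Type} [Fintype ι] (p : ι → Fin (n + 1)) (g : ι → ZMod 2),
        (∑ i, if A (p i) then g i else 0) =
          ∑ m, if A m then ∑ i, if m = p i then g i else 0 else 0 := by
      intro ι _ p g
      have h2 : ∀ m, (if A m then ∑ i, if m = p i then g i else 0 else 0) =
          ∑ i, if m = p i then if A (p i) then g i else 0 else 0 := by
        intro m
        by_cases hA : A m
        · rw [if_pos hA]
          refine Finset.sum_congr rfl fun i _ => ?_
          by_cases hm : m = p i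
          · subst hm; simp [hA]
          · simp [hm]
        · rw [if_neg hA, Fintype.sum_eq_zero]
          intro i
          by_cases hm : m = p i
          · subst hm; simp [hA]
          · simp [hm]
      rw [Fintype.sum_congr _ _ h2, Finset.sum_comm]
      simp
    rw [h1 pos, h1 Fin.castSucc, h1 Fin.succ, ← Finset.sum_add_distrib, ← Finset.sum_add_distrib]
    refine Finset.sum_congr rfl fun m _ => ?_
    rw [resX_piece_dotProduct]
    by_cases hA : A m
    · simp only [hA, if_true, hleg, eq_comm (a := m)]
    · simp [hA]
  refine ⟨fun s => ?_, ?_⟩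
  · have := hsum s fun _ => True
    simpa [CharTwo.add_self_eq_zero, dotProduct] using this
  · ext (⟨q, ρ⟩ | ⟨q, ρ⟩ | ⟨q, ρ⟩ | ⟨s, j⟩)
    · exact (hF q ρ).1
    · exact (hF q ρ).2
    · exact hL q ρ
    · have := hsum s fun m => (j : ℕ) < m
      rw [← Finset.sum_add_distrib, Fintype.sum_eq_single j fun k hk => ?_] at this
      · rw [resolve_link]
        simp only [Fin.val_castSucc, lt_irrefl, if_false, Fin.val_succ, Nat.lt_succ_self,
          if_true, zero_add] at this
        exact heq this
      · have hk' : (k : ℕ) ≠ j := fun h => hk (Fin.ext h)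
        by_cases h : (j : ℕ) < k
        · simp [h, h.trans (Nat.lt_succ_self _), CharTwo.add_self_eq_zero]
        · have : ¬ (j : ℕ) < k + 1 := by omega
          simp [h, this]

/-- Resolving is a quasi-isomorphism, indeed an isomorphism on cycles. -/
noncomputable def resLocalQuasiIso (hZ : Matrix Z Q (ZMod 2)) (F : ℕ) (hF : 1 ≤ F)
    (hw : ∀ s, hammingNorm (hX s) ≤ F) :
    LocalQuasiIso hX hZ (resX hX row pos) (Matrix.of fun z => resolve hX row pos (hZ z)) F 1 where
  toFun := resolve hX row pos
  cycle _ hv := isCycle_resolve hv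
  boundary z := IsBoundary.row (Matrix.of fun z => resolve hX row pos (hZ z)) z
  inj v _ hb := by
    obtain ⟨y, hy⟩ := hb
    exact ⟨y, fun q => hy (.inl (q, 0))⟩
  surj w hw := by
    obtain ⟨h1, h2⟩ := eq_resolve_of_isCycle hw
    refine ⟨_, h1, ⟨0, fun q => ?_⟩, ?_⟩
    · rw [← h2]
      simp [CharTwo.add_self_eq_zero]
    · rw [one_mul]
      exact hammingNorm_le_of_injOn (fun q => .inl (q, 0)) (fun _ h => h) fun a b _ _ h => by
        simpa using h
  row q' := by
    classical
    have hs : ∀ q : Q, hammingNorm (Pi.single q 1 : Q → ZMod 2) ≤ F := by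
      refine fun q => (hammingNorm_le_one fun a b ha hb => ?_).trans hF
      rw [ne_eq, Pi.single_apply, ite_eq_right_iff, Classical.not_imp] at ha hb
      rw [ha.1, hb.1]
    rcases q' with ⟨q, ρ⟩ | ⟨q, ρ⟩ | ⟨q, ρ⟩ | ⟨s, j⟩
    · exact ⟨Pi.single q 1, hs q, fun v hv => ⟨q, hv, by simp⟩⟩
    · exact ⟨Pi.single q 1, hs q, fun v hv => ⟨q, hv, by simp⟩⟩
    · refine ⟨Pi.single q 1, hs q, fun v hv => ⟨q, fun h => hv ?_, by simp⟩⟩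
      rw [resolve_leg, h, ite_self]
    · refine ⟨hX s, hw s, fun v hv => ?_⟩
      rw [resolve_link] at hv
      obtain ⟨q, -, hq⟩ := Finset.exists_ne_zero_of_sum_ne_zero hv
      refine ⟨q, fun h => hq (by simp [h]), fun h => hq (by simp [h])⟩

end Resolve

end CSSCode

namespace CSSCode

open Matrix

/-! ### Stabilizers with disc-like fillings -/

section Sheet

variable {Q X Z V E F : Type} [Fintype Q] [Fintype X] [Fintype Z] [Fintype V] [Fintype E]
  [Fintype F]

/-- For each `Z`-stabilizer `z` of a code, a two-dimensional complex with nodes `V`, edges `E` and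
faces `F`, connected (`conn`) and without first cohomology (`exact`), over which `z` spreads: its
qubit `x` sits at the node `ν z x`. Edges have two ends, which may coincide, and the boundary of a
face is a list of edges. The edges `lab z s` form a chain whose boundary is the set of nodes at
which an odd number of the qubits shared by `z` and the `X`-check `s` sit; `comm` states this by
testing against functions `y` on the nodes. -/
structure Sheet (hX : Matrix X Q (ZMod 2)) (hZ : Matrix Z Q (ZMod 2)) (V E F : Type) [Fintype E]
    where
  src : E → V
  tgt : Z → E → V
  bd : Z → F → List E
  ν : Z → Q → V
  lab : Z → X → E → ZMod 2
  comm : ∀ z s (y : V → ZMod 2), ∑ x, hX s x * (y (ν z x) * hZ z x) +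
    ∑ e, lab z s e * (y (src e) + y (tgt z e)) = 0
  face : ∀ z f (y : V → ZMod 2), ((bd z f).map fun e => y (src e) + y (tgt z e)).sum = 0
  conn : ∀ z (y : V → ZMod 2), (∀ e, y (src e) = y (tgt z e)) → ∀ u v, y u = y v
  exact : ∀ z (α : E → ZMod 2), (∀ f, ((bd z f).map α).sum = 0) →
    ∃ y : V → ZMod 2, ∀ e, α e = y (src e) + y (tgt z e)

namespace Sheet

variable {hX : Matrix X Q (ZMod 2)} {hZ : Matrix Z Q (ZMod 2)}

open Classical in
/-- The boundary of an edge. -/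
noncomputable def d (S : Sheet hX hZ V E F) (z : Z) (e : E) (v : V) : ZMod 2 :=
  (if S.src e = v then 1 else 0) + if S.tgt z e = v then 1 else 0

open Classical in
/-- The boundary of a face. -/
noncomputable def φ (S : Sheet hX hZ V E F) (z : Z) (f : F) (e : E) : ZMod 2 :=
  ((S.bd z f).count e : ZMod 2)

theorem sum_d_mul (S : Sheet hX hZ V E F) (z : Z) (e : E) (y : V → ZMod 2) :
    ∑ v, S.d z e v * y v = y (S.src e) + y (S.tgt z e) := by
  classical
  simp [d, add_mul, Finset.sum_add_distrib]

theorem sum_φ_mul (S : Sheet hX hZ V E F) (z : Z) (f : F) (α : E → ZMod 2) :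
    ∑ e, S.φ z f e * α e = ((S.bd z f).map α).sum := by
  classical
  exact sum_count_mul _ _

variable {n : ℕ}

open Classical in
/-- The fillings of the stabilizers placed in the slots of the thickened code. -/
noncomputable def filling (S : Sheet hX hZ V E F) (c : Z → Fin n) :
    Filling (thickX hX hZ c) (thickF hX hZ c) (thickZ hZ c) V E F where
  d := S.d
  φ := S.φ
  a z v
    | .inr (.inl (x, k)) => if k = c z ∧ S.ν z x = v then hZ z x else 0
    | _ => 0
  L z
    | .inr (s, k) => fun e => if k = c z then S.lab z s e else 0
    | .inl _ => 0
  comm₁ := thick_comm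
  sum_a z := by
    ext (⟨x, k⟩ | ⟨x, k⟩ | ⟨s, k⟩ | ⟨s, k⟩) <;> simp [Finset.sum_apply, thickZ, ite_and]
  comm z s v := by
    rcases s with ⟨s, m⟩ | ⟨s, m⟩
    · rw [thickX_inl_dotProduct]
      simp
    · rw [thickX_inr_dotProduct]
      by_cases h : m = c z
      · subst h
        have h1 := S.comm z s fun w => if w = v then 1 else 0
        simp only [true_and, if_true, ite_self, add_zero]
        refine Eq.trans ?_ h1
        congr 1
        refine Finset.sum_congr rfl fun x _ => ?_
        by_cases h0 : hZ z x = 0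
        · simp [h0]
        · rw [if_pos (show EvQ hZ c x (c z) from ⟨z, rfl, h0⟩)]
          simp
      · simp [h]
  face z f v := by
    have := S.face z f fun w => if w = v then 1 else 0
    rw [sum_φ_mul]
    exact this
  d_sum z e := by
    have := S.sum_d_mul z e 1
    simpa [CharTwo.add_self_eq_zero] using this
  conn z y h := S.conn z y fun e => by
    have := h e
    rwa [sum_d_mul, CharTwo.add_eq_zero] at this
  exact z α h := by
    obtain ⟨y, hy⟩ := S.exact z α fun f => by rw [← sum_φ_mul]; exact h f
    exact ⟨y, fun e => by rw [hy, sum_d_mul]⟩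

/-- The code obtained by thickening and then filling every stabilizer. -/
noncomputable def code (S : Sheet hX hZ V E F) (c : Z → Fin n) : CSSCode where
  Qubit := ThickQ Q X n ⊕ Z × E
  XStab := ThickX X n ⊕ Z × F
  ZStab := ThickF Q n ⊕ Z × V
  hX := (S.filling c).coneX
  hZ := (S.filling c).coneZ
  comm := by
    ext s z
    exact (S.filling c).cone_comm s z

/-- The code obtained by thickening. -/
noncomputable def thickCode (c : Z → Fin n) (comm : ∀ s z, hX s ⬝ᵥ hZ z = 0) : CSSCode where
  Qubit := ThickQ Q X n
  XStab := ThickX X n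
  ZStab := ThickF Q n ⊕ Z
  hX := thickX hX hZ c
  hZ := fromRows (thickF hX hZ c) (thickZ hZ c)
  comm := by
    ext s (f | z)
    · exact thick_comm s f
    · exact thickX_dotProduct_thickZ comm s z

theorem filling_support (S : Sheet hX hZ V E F) (c : Z → Fin n) (W : ℕ)
    (hW : ∀ z, hammingNorm (hZ z) ≤ W) (z : Z) : ∃ R : ThickQ Q X n → ZMod 2, hammingNorm R ≤ W ∧
      ∀ v q, (S.filling c).a z v q ≠ 0 → R q ≠ 0 := by
  classical
  refine ⟨thickZ hZ c z, ?_, ?_⟩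
  · rw [hammingNorm_sum, hammingNorm_sum]
    have h1 := hammingNorm_le_zero (v := fun a => thickZ (X := X) hZ c z (.inl a)) fun a => by
      simp [thickZ]
    have h2 := (hammingNorm_le_of_prod (v := fun a => thickZ (X := X) hZ c z (.inr (.inl a)))
      (w := hZ z) (c z) fun x k hk => by simpa [thickZ] using hk).trans (hW z)
    have h3 := hammingNorm_le_zero (v := fun a => thickZ (X := X) hZ c z (.inr (.inr a))) (by
      intro a
      rcases a with a | a <;> simp [thickZ])
    omega
  · rintro v (⟨x, k⟩ | ⟨x, k⟩ | ⟨s, k⟩ | ⟨s, k⟩) hq <;> simp [filling, thickZ] at hq ⊢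
    exact ⟨hq.1, hq.2.2⟩

/-- The conditions on a family of fillings, in terms of the code and the slots `c` of its
`Z`-stabilizers, under which filling all stabilizers leaves a code with small weights. The vector
`w` in `not_event` marks the `X`-checks at `x` that are cut in the slot `k`, so that `not_event`
bounds the number of sides of the face of an uncut `x`; in `node_le` it marks the qubits of `z` that
sit at the node `v`. -/
structure IsSparse (S : Sheet hX hZ V E F) (c : Z → Fin n) : Prop where
  comm : ∀ s z, hX s ⬝ᵥ hZ z = 0
  wX_le : ∀ s, hammingNorm (hX s) ≤ 3
  qX_le : ∀ x, hammingNorm (fun s => hX s x) ≤ 3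
  eq_of_meets : ∀ z z' s x x', c z = c z' → hX s x ≠ 0 → hZ z x ≠ 0 → hX s x' ≠ 0 →
    hZ z' x' ≠ 0 → z = z'
  eq_of_common : ∀ z z' x, c z = c z' → hZ z x ≠ 0 → hZ z' x ≠ 0 → z = z'
  not_event : ∀ x k, ¬ EvQ hZ c x k → ∀ w : X → ZMod 2,
    (∀ s, w s ≠ 0 → hX s x ≠ 0 ∧ EvX hX hZ c s k) →
      hammingNorm (fun s => hX s x) + hammingNorm w ≤ 3
  lab_meets : ∀ z s e, S.lab z s e ≠ 0 → ∃ x, hX s x ≠ 0 ∧ hZ z x ≠ 0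
  lab_unique : ∀ z s e e', S.lab z s e ≠ 0 → S.lab z s e' ≠ 0 → e = e'
  face_le : ∀ z f, (S.bd z f).length ≤ 5
  edge_le : ∀ z e, hammingNorm (fun s => S.lab z s e) + hammingNorm (fun f => S.φ z f e) ≤ 3
  node_le : ∀ z v (w : Q → ZMod 2), (∀ x, w x ≠ 0 → S.ν z x = v ∧ hZ z x ≠ 0) →
    hammingNorm w + hammingNorm (fun e => S.d z e v) ≤ 5

namespace IsSparse

variable {S : Sheet hX hZ V E F} {c : Z → Fin n}

/-- At most two qubits of an `X`-check are events in a given slot: they belong to a single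
`Z`-stabilizer, which meets the check evenly. -/
theorem hammingNorm_event_le (h : S.IsSparse c) (s : X) (k : Fin n) (w : Q → ZMod 2)
    (hw : ∀ x, w x ≠ 0 → hX s x ≠ 0 ∧ EvQ hZ c x k) : hammingNorm w ≤ 2 := by
  by_cases h0 : ∃ x, w x ≠ 0
  · obtain ⟨x, hx⟩ := h0
    obtain ⟨hsx, z, hz, hzx⟩ := hw x hx
    have h1 : hammingNorm w ≤ hammingNorm fun x => hX s x * hZ z x := by
      refine hammingNorm_mono fun x' hx' => ?_
      obtain ⟨hsx', z', hz', hzx'⟩ := hw x' hx'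
      obtain rfl := h.eq_of_meets z z' s x x' (hz.trans hz'.symm) hsx hzx hsx' hzx'
      exact mul_ne_zero hsx' hzx'
    have h2 : (hammingNorm fun x => hX s x * hZ z x) ≤ 3 :=
      (hammingNorm_mono fun x hx => left_ne_zero_of_mul hx).trans (h.wX_le s)
    have h3 : 2 ∣ hammingNorm fun x => hX s x * hZ z x := by
      rw [← ZMod.natCast_eq_zero_iff, natCast_hammingNorm]
      exact h.comm s z
    omega
  · push Not at h0
    exact (hammingNorm_le_zero h0).trans (by norm_num)

theorem hammingNorm_coneX_le (h : S.IsSparse c) (s) :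
    hammingNorm ((S.filling c).coneX s) ≤ 5 := by
  classical
  rcases s with (⟨s, m⟩ | ⟨s, m⟩) | ⟨z, f⟩
  · rw [hammingNorm_sum, hammingNorm_sum, hammingNorm_sum]
    have h1 := (hammingNorm_le_of_prod (v := fun a => (S.filling c).coneX (.inl (.inl (s, m)))
      (.inl (.inl a))) (w := hX s) m fun x k hk => by
        simpa [Filling.coneX, thickX] using hk).trans (h.wX_le s)
    have h2 := hammingNorm_le_zero (v := fun a => (S.filling c).coneX (.inl (.inl (s, m)))
      (.inl (.inr (.inl a)))) fun a => by simp [Filling.coneX, thickX]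
    have h3 := hammingNorm_le_two (v := fun a => (S.filling c).coneX (.inl (.inl (s, m)))
      (.inl (.inr (.inr a)))) (fun a => (match a with | .inl p => p.2 | .inr p => p.2).castSucc = m)
      (by
        rintro (⟨t, k⟩ | ⟨t, k⟩) (⟨t', k'⟩ | ⟨t', k'⟩) ha hb hab <;>
          simp [Filling.coneX, thickX] at ha hb hab <;>
          grind [Fin.castSucc_inj, Fin.succ_inj, Fin.castSucc_lt_succ])
    have h4 := hammingNorm_le_zero (v := fun a => (S.filling c).coneX (.inl (.inl (s, m)))
      (.inr a)) fun a => by simp [Filling.coneX, filling]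
    omega
  · rw [hammingNorm_sum, hammingNorm_sum, hammingNorm_sum, hammingNorm_sum]
    have h1 := hammingNorm_le_zero (v := fun a => (S.filling c).coneX (.inl (.inr (s, m)))
      (.inl (.inl a))) fun a => by simp [Filling.coneX, thickX]
    have h4 := hammingNorm_le_one (v := fun a => (S.filling c).coneX (.inl (.inr (s, m)))
      (.inl (.inr (.inr (.inr a))))) (by
        rintro ⟨t, k⟩ ⟨t', k'⟩ ha hb
        simp [Filling.coneX, thickX] at ha hb
        simp [ha, hb])
    by_cases hs : EvX hX hZ c s m
    · have h2 := (hammingNorm_le_of_prod (v := fun a => (S.filling c).coneX (.inl (.inr (s, m)))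
        (.inl (.inr (.inl a)))) (w := fun x => if EvQ hZ c x m then hX s x else 0) m
        fun x k hk => by
          simp only [Filling.coneX, thickX, of_apply, Sum.elim_inl] at hk
          rw [ne_eq, ite_eq_right_iff, Classical.not_imp] at hk
          obtain ⟨⟨rfl, h5⟩, h6⟩ := hk
          exact ⟨rfl, by rwa [if_pos h5]⟩).trans
        (h.hammingNorm_event_le s m _ fun x hx => by
          rw [ne_eq, ite_eq_right_iff, Classical.not_imp] at hx
          exact hx.symm)
      have h3 := hammingNorm_le_one (v := fun a => (S.filling c).coneX (.inl (.inr (s, m)))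
        (.inl (.inr (.inr (.inl a))))) (by
          rintro ⟨t, k⟩ ⟨t', k'⟩ ha hb
          simp [Filling.coneX, thickX] at ha hb
          simp [ha, hb])
      have h5 := hammingNorm_le_one (v := fun a => (S.filling c).coneX (.inl (.inr (s, m)))
        (.inr a)) (by
          rintro ⟨z, e⟩ ⟨z', e'⟩ ha hb
          simp [Filling.coneX, filling] at ha hb
          obtain ⟨rfl, ha⟩ := ha
          obtain ⟨hz, hb⟩ := hb
          obtain ⟨x, hx, hx'⟩ := h.lab_meets _ _ _ ha
          obtain ⟨y, hy, hy'⟩ := h.lab_meets _ _ _ hb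
          obtain rfl := h.eq_of_meets z z' s x y hz hx hx' hy hy'
          rw [h.lab_unique z s e e' ha hb])
      omega
    · have h2 := hammingNorm_le_zero (v := fun a => (S.filling c).coneX (.inl (.inr (s, m)))
        (.inl (.inr (.inl a)))) (by
          rintro ⟨x, k⟩
          simp only [Filling.coneX, thickX, of_apply, Sum.elim_inl]
          by_contra hk
          rw [ite_eq_right_iff, Classical.not_imp] at hk
          obtain ⟨⟨rfl, h5⟩, h6⟩ := hk
          exact hs ⟨x, h6, h5⟩)
      have h3 := hammingNorm_le_zero (v := fun a => (S.filling c).coneX (.inl (.inr (s, m)))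
        (.inl (.inr (.inr (.inl a))))) (by
          rintro ⟨t, k⟩
          simp only [Filling.coneX, thickX, of_apply, Sum.elim_inl]
          refine if_neg ?_
          rintro ⟨rfl, rfl, h5⟩
          exact hs h5)
      have h5 := hammingNorm_le_zero (v := fun a => (S.filling c).coneX (.inl (.inr (s, m)))
        (.inr a)) (by
          rintro ⟨z, e⟩
          simp only [Filling.coneX, filling, of_apply, Sum.elim_inr]
          by_contra hk
          rw [ite_eq_right_iff, Classical.not_imp] at hk
          obtain ⟨rfl, h5⟩ := hk
          obtain ⟨x, hx, hx'⟩ := h.lab_meets _ _ _ h5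
          exact hs ⟨x, hx, z, rfl, hx'⟩)
      omega
  · rw [hammingNorm_sum]
    have h1 := hammingNorm_le_zero (v := fun a => (S.filling c).coneX (.inr (z, f)) (.inl a))
      fun a => by simp [Filling.coneX]
    have h2 := ((hammingNorm_le_of_prod' (v := fun a => (S.filling c).coneX (.inr (z, f)) (.inr a))
      (w := S.φ z f) z fun t e he => by simpa [Filling.coneX, filling] using he).trans
        (hammingNorm_count_le _)).trans (h.face_le z f)
    omega

theorem hammingNorm_coneX_col_le (h : S.IsSparse c) (q) :
    hammingNorm (fun s => (S.filling c).coneX s q) ≤ 3 := by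
  classical
  rw [hammingNorm_sum, hammingNorm_sum]
  rcases q with (⟨x, k⟩ | ⟨x, k⟩ | ⟨s, k⟩ | ⟨s, k⟩) | ⟨z, e⟩
  · have h1 := (hammingNorm_le_of_prod (v := fun a => (S.filling c).coneX (.inl (.inl a))
      (.inl (.inl (x, k)))) (w := fun s => hX s x) k fun s m hm => by
        simp [Filling.coneX, thickX] at hm; exact ⟨hm.1.symm, hm.2⟩).trans (h.qX_le x)
    have h2 := hammingNorm_le_zero (v := fun a => (S.filling c).coneX (.inl (.inr a))
      (.inl (.inl (x, k)))) fun a => by simp [Filling.coneX, thickX]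
    have h3 := hammingNorm_le_zero (v := fun a => (S.filling c).coneX (.inr a)
      (.inl (.inl (x, k)))) fun a => by simp [Filling.coneX]
    omega
  · have h1 := (hammingNorm_le_of_prod (v := fun a => (S.filling c).coneX (.inl (.inr a))
      (.inl (.inr (.inl (x, k))))) (w := fun s => hX s x) k fun s m hm => by
        simp [Filling.coneX, thickX] at hm; exact ⟨hm.1.symm, hm.2.2⟩).trans (h.qX_le x)
    have h2 := hammingNorm_le_zero (v := fun a => (S.filling c).coneX (.inl (.inl a))
      (.inl (.inr (.inl (x, k))))) fun a => by simp [Filling.coneX, thickX]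
    have h3 := hammingNorm_le_zero (v := fun a => (S.filling c).coneX (.inr a)
      (.inl (.inr (.inl (x, k))))) fun a => by simp [Filling.coneX]
    omega
  · have h3 := hammingNorm_le_zero (v := fun a => (S.filling c).coneX (.inr a)
      (.inl (.inr (.inr (.inl (s, k)))))) fun a => by simp [Filling.coneX]
    have h1 := hammingNorm_le_two (v := fun a => (S.filling c).coneX (.inl (.inl a))
      (.inl (.inr (.inr (.inl (s, k)))))) (fun a => a.2 = k.castSucc) (by
        rintro ⟨t, m⟩ ⟨t', m'⟩ ha hb hab
        simp [Filling.coneX, thickX] at ha hb hab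
        ext <;> simp <;> grind)
    have h2 := hammingNorm_le_one (v := fun a => (S.filling c).coneX (.inl (.inr a))
      (.inl (.inr (.inr (.inl (s, k)))))) (by
        rintro ⟨t, m⟩ ⟨t', m'⟩ ha hb
        simp [Filling.coneX, thickX] at ha hb
        ext <;> simp <;> grind)
    omega
  · have h3 := hammingNorm_le_zero (v := fun a => (S.filling c).coneX (.inr a)
      (.inl (.inr (.inr (.inr (s, k)))))) fun a => by simp [Filling.coneX]
    have h1 := hammingNorm_le_one (v := fun a => (S.filling c).coneX (.inl (.inl a))
      (.inl (.inr (.inr (.inr (s, k)))))) (by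
        rintro ⟨t, m⟩ ⟨t', m'⟩ ha hb
        simp [Filling.coneX, thickX] at ha hb
        ext <;> simp <;> grind)
    have h2 := hammingNorm_le_one (v := fun a => (S.filling c).coneX (.inl (.inr a))
      (.inl (.inr (.inr (.inr (s, k)))))) (by
        rintro ⟨t, m⟩ ⟨t', m'⟩ ha hb
        simp [Filling.coneX, thickX] at ha hb
        ext <;> simp <;> grind)
    omega
  · have h0 := h.edge_le z e
    have h1 := hammingNorm_le_zero (v := fun a => (S.filling c).coneX (.inl (.inl a))
      (.inr (z, e))) fun a => by simp [Filling.coneX, filling]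
    have h2 := hammingNorm_le_of_prod (v := fun a => (S.filling c).coneX (.inl (.inr a))
      (.inr (z, e))) (w := fun s => S.lab z s e) (c z) fun s k hk => by
        simpa [Filling.coneX, filling] using hk
    have h3 := hammingNorm_le_of_prod' (v := fun a => (S.filling c).coneX (.inr a)
      (.inr (z, e))) (w := fun f => S.φ z f e) z fun t f hf => by
        simp [Filling.coneX, filling] at hf
        obtain ⟨rfl, hf⟩ := hf
        exact ⟨rfl, hf⟩
    omega

theorem hammingNorm_coneZ_le (h : S.IsSparse c) (z) :
    hammingNorm ((S.filling c).coneZ z) ≤ 5 := by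
  classical
  rcases z with (⟨x, m⟩ | ⟨x, m⟩) | ⟨z, v⟩
  · rw [hammingNorm_sum, hammingNorm_sum, hammingNorm_sum, hammingNorm_sum]
    have h0 := hammingNorm_le_zero (v := fun a => (S.filling c).coneZ (.inl (.inl (x, m)))
      (.inr a)) fun a => by simp [Filling.coneZ]
    have h3 := hammingNorm_le_of_prod (v := fun a => (S.filling c).coneZ (.inl (.inl (x, m)))
      (.inl (.inr (.inr (.inl a))))) (w := fun s => hX s x) m fun s k hk => by
        simpa [Filling.coneZ, thickF] using hk
    by_cases hx : EvQ hZ c x m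
    · have h1 := hammingNorm_le_one (v := fun a => (S.filling c).coneZ (.inl (.inl (x, m)))
        (.inl (.inl a))) (by
          rintro ⟨t, k⟩ ⟨t', k'⟩ ha hb
          simp [Filling.coneZ, thickF, hx] at ha hb
          ext <;> simp <;> grind)
      have h2 := hammingNorm_le_one (v := fun a => (S.filling c).coneZ (.inl (.inl (x, m)))
        (.inl (.inr (.inl a)))) (by
          rintro ⟨t, k⟩ ⟨t', k'⟩ ha hb
          simp [Filling.coneZ, thickF] at ha hb
          ext <;> simp <;> grind)
      have h4 := hammingNorm_le_zero (v := fun a => (S.filling c).coneZ (.inl (.inl (x, m)))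
        (.inl (.inr (.inr (.inr a))))) fun a => by simp [Filling.coneZ, thickF, hx]
      have := h.qX_le x
      omega
    · have h1 := hammingNorm_le_two (v := fun a => (S.filling c).coneZ (.inl (.inl (x, m)))
        (.inl (.inl a))) (fun a => a.2 = m.castSucc) (by
          rintro ⟨t, k⟩ ⟨t', k'⟩ ha hb hab
          simp [Filling.coneZ, thickF] at ha hb hab
          ext <;> simp <;> grind)
      have h2 := hammingNorm_le_zero (v := fun a => (S.filling c).coneZ (.inl (.inl (x, m)))
        (.inl (.inr (.inl a)))) fun a => by simp [Filling.coneZ, thickF, hx]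
      have h4 := hammingNorm_le_of_prod (v := fun a => (S.filling c).coneZ (.inl (.inl (x, m)))
        (.inl (.inr (.inr (.inr a))))) (w := fun s => if EvX hX hZ c s m then hX s x else 0) m
        fun s k hk => by
          simp [Filling.coneZ, thickF] at hk
          obtain ⟨rfl, -, h5, h6⟩ := hk
          simp [h5, h6]
      have h5 := h.not_event x m hx (fun s => if EvX hX hZ c s m then hX s x else 0) fun s hs => by
        rw [ne_eq, ite_eq_right_iff, Classical.not_imp] at hs
        exact hs.symm
      omega
  · rw [hammingNorm_sum, hammingNorm_sum, hammingNorm_sum, hammingNorm_sum]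
    have h0 := hammingNorm_le_zero (v := fun a => (S.filling c).coneZ (.inl (.inr (x, m)))
      (.inr a)) fun a => by simp [Filling.coneZ]
    have h1 := hammingNorm_le_one (v := fun a => (S.filling c).coneZ (.inl (.inr (x, m)))
      (.inl (.inl a))) (by
        rintro ⟨t, k⟩ ⟨t', k'⟩ ha hb
        simp [Filling.coneZ, thickF] at ha hb
        ext <;> simp <;> grind)
    have h2 := hammingNorm_le_one (v := fun a => (S.filling c).coneZ (.inl (.inr (x, m)))
      (.inl (.inr (.inl a)))) (by
        rintro ⟨t, k⟩ ⟨t', k'⟩ ha hb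
        simp [Filling.coneZ, thickF] at ha hb
        ext <;> simp <;> grind)
    have h3 := hammingNorm_le_zero (v := fun a => (S.filling c).coneZ (.inl (.inr (x, m)))
      (.inl (.inr (.inr (.inl a))))) fun a => by simp [Filling.coneZ, thickF]
    have h4 := (hammingNorm_le_of_prod (v := fun a => (S.filling c).coneZ (.inl (.inr (x, m)))
      (.inl (.inr (.inr (.inr a))))) (w := fun s => hX s x) m fun s k hk => by
        simp [Filling.coneZ, thickF] at hk
        exact ⟨hk.1, hk.2.2⟩).trans (h.qX_le x)
    omega
  · rw [hammingNorm_sum, hammingNorm_sum, hammingNorm_sum]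
    have h0 := h.node_le z v (fun x => if S.ν z x = v then hZ z x else 0) fun x hx => by
      rw [ne_eq, ite_eq_right_iff, Classical.not_imp] at hx
      exact hx
    have h1 := hammingNorm_le_zero (v := fun a => (S.filling c).coneZ (.inr (z, v))
      (.inl (.inl a))) fun a => by simp [Filling.coneZ, filling]
    have h2 := hammingNorm_le_of_prod (v := fun a => (S.filling c).coneZ (.inr (z, v))
      (.inl (.inr (.inl a)))) (w := fun x => if S.ν z x = v then hZ z x else 0) (c z)
      fun x k hk => by
        simp [Filling.coneZ, filling] at hk
        simp [hk]
    have h3 := hammingNorm_le_zero (v := fun a => (S.filling c).coneZ (.inr (z, v))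
      (.inl (.inr (.inr a)))) fun a => by rcases a with a | a <;> simp [Filling.coneZ, filling]
    have h4 := hammingNorm_le_of_prod' (v := fun a => (S.filling c).coneZ (.inr (z, v))
      (.inr a)) (w := fun e => S.d z e v) z fun t e he => by
        simpa [Filling.coneZ, filling] using he
    omega

theorem hammingNorm_coneZ_col_le (h : S.IsSparse c) (q) :
    hammingNorm (fun z => (S.filling c).coneZ z q) ≤ 3 := by
  classical
  rw [hammingNorm_sum, hammingNorm_sum]
  rcases q with (⟨x, k⟩ | ⟨x, k⟩ | ⟨s, k⟩ | ⟨s, k⟩) | ⟨z, e⟩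
  · have h0 := hammingNorm_le_zero (v := fun a => (S.filling c).coneZ (.inr a)
      (.inl (.inl (x, k)))) fun a => by simp [Filling.coneZ, filling]
    have h1 := hammingNorm_le_two (v := fun a => (S.filling c).coneZ (.inl (.inl a))
      (.inl (.inl (x, k)))) (fun a => k = a.2.castSucc) (by
        rintro ⟨t, m⟩ ⟨t', m'⟩ ha hb hab
        simp [Filling.coneZ, thickF] at ha hb hab
        ext <;> simp <;> grind [Fin.castSucc_inj, Fin.succ_inj])
    have h2 := hammingNorm_le_one (v := fun a => (S.filling c).coneZ (.inl (.inr a))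
      (.inl (.inl (x, k)))) (by
        rintro ⟨t, m⟩ ⟨t', m'⟩ ha hb
        simp [Filling.coneZ, thickF] at ha hb
        ext <;> simp <;> grind [Fin.castSucc_inj, Fin.succ_inj])
    omega
  · have h1 := hammingNorm_le_one (v := fun a => (S.filling c).coneZ (.inl (.inl a))
      (.inl (.inr (.inl (x, k))))) (by
        rintro ⟨t, m⟩ ⟨t', m'⟩ ha hb
        simp [Filling.coneZ, thickF] at ha hb
        ext <;> simp <;> grind)
    have h2 := hammingNorm_le_one (v := fun a => (S.filling c).coneZ (.inl (.inr a))
      (.inl (.inr (.inl (x, k))))) (by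
        rintro ⟨t, m⟩ ⟨t', m'⟩ ha hb
        simp [Filling.coneZ, thickF] at ha hb
        ext <;> simp <;> grind)
    have h3 := hammingNorm_le_one (v := fun a => (S.filling c).coneZ (.inr a)
      (.inl (.inr (.inl (x, k))))) (by
        rintro ⟨z, v⟩ ⟨z', v'⟩ ha hb
        simp [Filling.coneZ, filling] at ha hb
        obtain rfl := h.eq_of_common z z' x (ha.1.symm.trans hb.1) ha.2.2 hb.2.2
        rw [← ha.2.1, ← hb.2.1])
    omega
  · have h0 := hammingNorm_le_zero (v := fun a => (S.filling c).coneZ (.inr a)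
      (.inl (.inr (.inr (.inl (s, k)))))) fun a => by simp [Filling.coneZ, filling]
    have h1 := (hammingNorm_le_of_prod (v := fun a => (S.filling c).coneZ (.inl (.inl a))
      (.inl (.inr (.inr (.inl (s, k)))))) (w := hX s) k fun x m hm => by
        simp [Filling.coneZ, thickF] at hm
        exact ⟨hm.1.symm, hm.2⟩).trans (h.wX_le s)
    have h2 := hammingNorm_le_zero (v := fun a => (S.filling c).coneZ (.inl (.inr a))
      (.inl (.inr (.inr (.inl (s, k)))))) fun a => by simp [Filling.coneZ, thickF]
    omega
  · have h0 := hammingNorm_le_zero (v := fun a => (S.filling c).coneZ (.inr a)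
      (.inl (.inr (.inr (.inr (s, k)))))) fun a => by simp [Filling.coneZ, filling]
    have h1 := (hammingNorm_le_of_injOn (v := fun a => (S.filling c).coneZ (.inl a)
      (.inl (.inr (.inr (.inr (s, k)))))) (w := hX s) (Sum.elim Prod.fst Prod.fst) (by
        rintro (⟨x, m⟩ | ⟨x, m⟩) ha <;> simp [Filling.coneZ, thickF] at ha <;> grind) (by
        rintro (⟨x, m⟩ | ⟨x, m⟩) (⟨x', m'⟩ | ⟨x', m'⟩) ha hb hab <;>
          simp [Filling.coneZ, thickF] at ha hb hab <;> grind)).trans (h.wX_le s)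
    rw [hammingNorm_sum] at h1
    omega
  · have h0 := hammingNorm_le_zero (v := fun a => (S.filling c).coneZ (.inl (.inl a))
      (.inr (z, e))) fun a => by simp [Filling.coneZ]
    have h1 := hammingNorm_le_zero (v := fun a => (S.filling c).coneZ (.inl (.inr a))
      (.inr (z, e))) fun a => by simp [Filling.coneZ]
    have h2 := hammingNorm_le_two (v := fun a => (S.filling c).coneZ (.inr a)
      (.inr (z, e))) (fun a => S.src e = a.2) (by
        rintro ⟨t, v⟩ ⟨t', v'⟩ ha hb hab
        simp [Filling.coneZ, filling, d] at ha hb hab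
        grind)
    omega

end IsSparse

end Sheet

end Sheet

end CSSCode

namespace CSSCode

open Matrix

/-! ### A disc with terminals -/

/-- The nodes of the disc: two columns of terminals `A i ρ` and `B i ρ` at each position `i`, and,
between consecutive positions, the nodes `G j ρ` with a pendant terminal `E j ρ`. -/
inductive DiscV (R N : ℕ) : Type
  | A (i : Fin (N + 2)) (ρ : Fin (R + 1))
  | B (i : Fin (N + 2)) (ρ : Fin (R + 1))
  | G (j : Fin (N + 1)) (ρ : Fin (R + 1))
  | E (j : Fin (N + 1)) (ρ : Fin (R + 1))

/-- The edges of the disc. The column at the position `i` runs through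
`A i 0, B i 0, A i 1, B i 1, …` along the edges `w₀` and `w₁`; the columns are joined by the edges
`ha` and, through the nodes `G`, by `gl` and `gr`; `h` leads to the pendant terminals, and `t`
joins consecutive pendant terminals. -/
inductive DiscE (R N : ℕ) : Type
  | w₀ (i : Fin (N + 2)) (ρ : Fin (R + 1))
  | w₁ (i : Fin (N + 2)) (ρ : Fin R)
  | ha (j : Fin (N + 1)) (ρ : Fin (R + 1))
  | gl (j : Fin (N + 1)) (ρ : Fin (R + 1))
  | gr (j : Fin (N + 1)) (ρ : Fin (R + 1))
  | h (j : Fin (N + 1)) (ρ : Fin (R + 1))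
  | t (l : Fin N) (ρ : Fin (R + 1))

/-- The faces of the disc. Between consecutive positions, the faces `P₀` and `P₁` alternate upwards;
the boundary of `T` consists of an edge `t` and of the path below it that joins its ends. -/
inductive DiscF (R N : ℕ) : Type
  | P₀ (j : Fin (N + 1)) (ρ : Fin (R + 1))
  | P₁ (j : Fin (N + 1)) (ρ : Fin R)
  | T (l : Fin N) (ρ : Fin (R + 1))

section Card

variable {R N : ℕ}

/-- An enumeration of the nodes. -/
def DiscV.code : DiscV R N → Fin 4 × Fin (N + 2) × Fin (R + 1)
  | A i ρ => (0, i, ρ)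
  | B i ρ => (1, i, ρ)
  | G j ρ => (2, j.castSucc, ρ)
  | E j ρ => (3, j.castSucc, ρ)

theorem DiscV.code_injective : Function.Injective (code : DiscV R N → _) := by
  rintro (_ | _ | _ | _) (_ | _ | _ | _) h <;> simp [code] at h ⊢ <;> exact h

/-- An enumeration of the edges. -/
def DiscE.code : DiscE R N → Fin 7 × Fin (N + 2) × Fin (R + 1)
  | w₀ i ρ => (0, i, ρ)
  | w₁ i ρ => (1, i, ρ.castSucc)
  | ha j ρ => (2, j.castSucc, ρ)
  | gl j ρ => (3, j.castSucc, ρ)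
  | gr j ρ => (4, j.castSucc, ρ)
  | h j ρ => (5, j.castSucc, ρ)
  | t l ρ => (6, l.castSucc.castSucc, ρ)

theorem DiscE.code_injective : Function.Injective (code : DiscE R N → _) := by
  rintro (_ | _ | _ | _ | _ | _ | _) (_ | _ | _ | _ | _ | _ | _) h <;>
    simp [code] at h ⊢ <;> exact h

/-- An enumeration of the faces. -/
def DiscF.code : DiscF R N → Fin 3 × Fin (N + 1) × Fin (R + 1)
  | P₀ j ρ => (0, j, ρ)
  | P₁ j ρ => (1, j, ρ.castSucc)
  | T l ρ => (2, l.castSucc, ρ)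

theorem DiscF.code_injective : Function.Injective (code : DiscF R N → _) := by
  rintro (_ | _ | _) (_ | _ | _) h <;> simp [code] at h ⊢ <;> exact h

noncomputable instance : Fintype (DiscV R N) := Fintype.ofInjective _ DiscV.code_injective
noncomputable instance : Fintype (DiscE R N) := Fintype.ofInjective _ DiscE.code_injective
noncomputable instance : Fintype (DiscF R N) := Fintype.ofInjective _ DiscF.code_injective

theorem DiscE.card_le : Fintype.card (DiscE R N) ≤ 7 * ((N + 2) * (R + 1)) := by
  refine (Fintype.card_le_of_injective _ DiscE.code_injective).trans ?_
  simp

instance : Nonempty (DiscV R N) := ⟨.A 0 0⟩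

end Card

namespace Disc

variable {R N : ℕ} (lk : Fin N → Fin (R + 1) → Prop)

/-- The first end of an edge. -/
def src : DiscE R N → DiscV R N
  | .w₀ i ρ => .A i ρ
  | .w₁ i ρ => .B i ρ.castSucc
  | .ha j ρ => .A j.castSucc ρ
  | .gl j ρ => .B j.castSucc ρ
  | .gr j ρ => .G j ρ
  | .h j ρ => .G j ρ
  | .t l ρ => .E l.castSucc ρ

open Classical in
/-- The second end of an edge. An edge `t` that is not linked is a loop. -/
noncomputable def tgt : DiscE R N → DiscV R N
  | .w₀ i ρ => .B i ρ
  | .w₁ i ρ => .A i ρ.succ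
  | .ha j ρ => .A j.succ ρ
  | .gl j ρ => .G j ρ
  | .gr j ρ => .B j.succ ρ
  | .h j ρ => .E j ρ
  | .t l ρ => if lk l ρ then .E l.succ ρ else .E l.castSucc ρ

open Classical in
/-- The boundary of a face. A face `T` at an edge that is not linked fills that loop. -/
noncomputable def bd : DiscF R N → List (DiscE R N)
  | .P₀ j ρ => [.w₀ j.castSucc ρ, .w₀ j.succ ρ, .ha j ρ, .gl j ρ, .gr j ρ]
  | .P₁ j ρ => [.w₁ j.castSucc ρ, .w₁ j.succ ρ, .gl j ρ.castSucc, .gr j ρ.castSucc, .ha j ρ.succ]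
  | .T l ρ => if lk l ρ then
      [.t l ρ, .h l.castSucc ρ, .h l.succ ρ, .gr l.castSucc ρ, .gl l.succ ρ] else [.t l ρ]

variable {lk}

theorem length_bd_le (f : DiscF R N) : (bd lk f).length ≤ 5 := by
  classical
  rcases f with _ | _ | ⟨l, ρ⟩
  · simp [bd]
  · simp [bd]
  · by_cases h : lk l ρ <;> simp [bd, h]

theorem face (f : DiscF R N) (y : DiscV R N → ZMod 2) :
    ((bd lk f).map fun e => y (src e) + y (tgt lk e)).sum = 0 := by
  have h2 : (2 : ZMod 2) = 0 := rfl
  rcases f with ⟨j, ρ⟩ | ⟨j, ρ⟩ | ⟨l, ρ⟩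
  · simp only [bd, List.map_cons, List.map_nil, List.sum_cons, List.sum_nil, src, tgt]
    ring_nf
    simp [h2]
  · simp only [bd, List.map_cons, List.map_nil, List.sum_cons, List.sum_nil, src, tgt]
    ring_nf
    simp [h2]
  · by_cases h : lk l ρ
    · simp only [bd, h, if_true, List.map_cons, List.map_nil, List.sum_cons, List.sum_nil, src,
        tgt, Fin.succ_castSucc]
      ring_nf
      simp [h2]
    · simp [bd, h, src, tgt, CharTwo.add_self_eq_zero]

theorem conn (y : DiscV R N → ZMod 2) (h : ∀ e, y (src e) = y (tgt lk e)) (u v) : y u = y v := by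
  have hA : ∀ i ρ, y (.A i ρ) = y (.A 0 0) := by
    intro i ρ
    induction ρ using Fin.induction with
    | zero =>
      induction i using Fin.induction with
      | zero => rfl
      | succ j ih => rw [← ih]; exact (h (.ha j 0)).symm
    | succ ρ ih => rw [← ih]; exact ((h (.w₀ i ρ.castSucc)).trans (h (.w₁ i ρ))).symm
  have hB : ∀ i ρ, y (.B i ρ) = y (.A 0 0) := fun i ρ => (h (.w₀ i ρ)).symm.trans (hA i ρ)
  have hG : ∀ j ρ, y (.G j ρ) = y (.A 0 0) := fun j ρ =>
    (h (.gl j ρ)).symm.trans (hB j.castSucc ρ)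
  have hE : ∀ j ρ, y (.E j ρ) = y (.A 0 0) := fun j ρ => (h (.h j ρ)).symm.trans (hG j ρ)
  have : ∀ u, y u = y (.A 0 0) := by
    rintro (⟨i, ρ⟩ | ⟨i, ρ⟩ | ⟨j, ρ⟩ | ⟨j, ρ⟩)
    · exact hA i ρ
    · exact hB i ρ
    · exact hG j ρ
    · exact hE j ρ
  rw [this, this v]

theorem exists_potential {m : ℕ} (y₀ : ZMod 2) (g : Fin m → ZMod 2) :
    ∃ y : Fin (m + 1) → ZMod 2, y 0 = y₀ ∧ ∀ j, y j.succ = y j.castSucc + g j :=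
  ⟨fun i => Fin.induction (motive := fun _ => ZMod 2) y₀ (fun j a => a + g j) i, rfl,
    fun j => Fin.induction_succ (motive := fun _ => ZMod 2) y₀ (fun j a => a + g j) j⟩

/-- A cochain that vanishes on all faces is a coboundary: a potential is built along the bottom row
and up the columns; the faces show that it fits the other edges. -/
theorem exact (α : DiscE R N → ZMod 2) (hα : ∀ f, ((bd lk f).map α).sum = 0) :
    ∃ y : DiscV R N → ZMod 2, ∀ e, α e = y (src e) + y (tgt lk e) := by
  have h2 : (2 : ZMod 2) = 0 := rfl
  have hadd : ∀ a : ZMod 2, a + a = 0 := CharTwo.add_self_eq_zero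
  obtain ⟨y₀, -, hy₀⟩ := exists_potential 0 fun j => α (.ha j 0)
  choose y hy0 hy using fun i => exists_potential (y₀ i) fun ρ : Fin R =>
    α (.w₀ i ρ.castSucc) + α (.w₁ i ρ)
  have hP₀ : ∀ j ρ, α (.gl j ρ) + α (.gr j ρ) =
      α (.w₀ j.castSucc ρ) + α (.w₀ j.succ ρ) + α (.ha j ρ) := fun j ρ => by
    have := hα (.P₀ j ρ)
    simp only [bd, List.map_cons, List.map_nil, List.sum_cons, List.sum_nil, add_zero] at this
    rw [← CharTwo.add_eq_zero]
    rw [← this]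
    ring
  have hha : ∀ j ρ, α (.ha j ρ) = y j.castSucc ρ + y j.succ ρ := by
    intro j ρ
    induction ρ using Fin.induction with
    | zero =>
      rw [hy0, hy0, hy₀, ← add_assoc, hadd, zero_add]
    | succ ρ ih =>
      have h3 := hα (.P₁ j ρ)
      simp only [bd, List.map_cons, List.map_nil, List.sum_cons, List.sum_nil, add_zero] at h3
      have h4 := hP₀ j ρ.castSucc
      rw [hy, hy]
      rw [← CharTwo.add_eq_zero]
      linear_combination h3 - h4 - ih
  let yB : Fin (N + 2) → Fin (R + 1) → ZMod 2 := fun i ρ => y i ρ + α (.w₀ i ρ)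
  let yG : Fin (N + 1) → Fin (R + 1) → ZMod 2 := fun j ρ => yB j.castSucc ρ + α (.gl j ρ)
  have hgr : ∀ j ρ, α (.gr j ρ) = yG j ρ + yB j.succ ρ := by
    intro j ρ
    have h4 := hP₀ j ρ
    have h5 := hha j ρ
    simp only [yG, yB]
    linear_combination h4 - h5 +
      (α (.ha j ρ) - y j.castSucc ρ - α (.gl j ρ) - y j.succ ρ) * h2
  refine ⟨fun
    | .A i ρ => y i ρ
    | .B i ρ => yB i ρ
    | .G j ρ => yG j ρ
    | .E j ρ => yG j ρ + α (.h j ρ), ?_⟩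
  rintro (⟨i, ρ⟩ | ⟨i, ρ⟩ | ⟨j, ρ⟩ | ⟨j, ρ⟩ | ⟨j, ρ⟩ | ⟨j, ρ⟩ | ⟨l, ρ⟩)
  · simp only [src, tgt, yB]
    rw [← add_assoc, hadd, zero_add]
  · simp only [src, tgt, yB]
    rw [hy]
    linear_combination -(y i ρ.castSucc + α (.w₀ i ρ.castSucc)) * h2
  · exact hha j ρ
  · simp only [src, tgt, yG]
    rw [← add_assoc, hadd, zero_add]
  · exact hgr j ρ
  · simp only [src, tgt]
    rw [← add_assoc, hadd, zero_add]
  · have h3 := hα (.T l ρ)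
    by_cases h : lk l ρ
    · simp only [bd, h, if_true, List.map_cons, List.map_nil, List.sum_cons, List.sum_nil,
        add_zero] at h3
      have h4 := hgr l.castSucc ρ
      simp only [src, tgt, h, if_true]
      simp only [Fin.succ_castSucc] at h4
      simp only [yG, yB] at h4 ⊢
      linear_combination h3 - h4 - (y l.castSucc.castSucc ρ + α (.w₀ l.castSucc.castSucc ρ) +
        α (.gl l.castSucc ρ) + α (.h l.castSucc ρ) + y l.succ.castSucc ρ +
        α (.w₀ l.succ.castSucc ρ) + α (.gl l.succ ρ) + α (.h l.succ ρ)) * h2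
    · simp only [bd, h, if_false, List.map_cons, List.map_nil, List.sum_cons, List.sum_nil,
        add_zero] at h3
      simp [src, tgt, h, h3, hadd]

end Disc

end CSSCode

namespace CSSCode

open Matrix

/-! ### Filling the stabilizers of the resolved code -/

section Layout

variable {Q X Z : Type} [Fintype Q] [Fintype X] [Fintype Z]

/-- The `X`-check `s` and the `Z`-stabilizer `z` share a qubit. -/
def Meets (hX : Matrix X Q (ZMod 2)) (hZ : Matrix Z Q (ZMod 2)) (s : X) (z : Z) : Prop :=
  ∃ q, hX s q ≠ 0 ∧ hZ z q ≠ 0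

/-- A distribution of the `X`-checks over rows, of the qubits over columns and of the
`Z`-stabilizers over slots, such that objects near each other are kept apart. -/
structure Layout (hX : Matrix X Q (ZMod 2)) (hZ : Matrix Z Q (ZMod 2)) (T : ℕ) where
  row : X → Fin (T + 1)
  col : Q → Fin T
  slot : Z → Fin T
  comm : ∀ s z, hX s ⬝ᵥ hZ z = 0
  row_inj : ∀ s s' q, hX s q ≠ 0 → hX s' q ≠ 0 → row s = row s' → s = s'
  row_inj' : ∀ s s' z, Meets hX hZ s z → Meets hX hZ s' z → row s = row s' → s = s'
  col_inj : ∀ q q' s, hX s q ≠ 0 → hX s q' ≠ 0 → col q = col q' → q = q'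
  col_inj' : ∀ q q' z, hZ z q ≠ 0 → hZ z q' ≠ 0 → col q = col q' → q = q'
  slot_inj : ∀ z z' q, hZ z q ≠ 0 → hZ z' q ≠ 0 → slot z = slot z' → z = z'
  slot_inj' : ∀ z z' s, Meets hX hZ s z → Meets hX hZ s z' → slot z = slot z' → z = z'

namespace Layout

variable {hX : Matrix X Q (ZMod 2)} {hZ : Matrix Z Q (ZMod 2)} {T : ℕ} (D : Layout hX hZ T)

/-- The position of a qubit. Positions of qubits are odd, so that of two consecutive positions one
is free. -/
def pos (q : Q) : Fin (2 * T + 1 + 1) := ⟨2 * D.col q + 1, by omega⟩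

/-- The gap before the position of a qubit. -/
def gapL (q : Q) : Fin (2 * T + 1) := ⟨2 * D.col q, by omega⟩

/-- The gap after the position of a qubit. -/
def gapR (q : Q) : Fin (2 * T + 1) := ⟨2 * D.col q + 1, by omega⟩

theorem succ_gapL (q : Q) : (D.gapL q).succ = D.pos q := rfl

theorem castSucc_gapR (q : Q) : (D.gapR q).castSucc = D.pos q := rfl

theorem col_eq_of_pos_eq {q q' : Q} (h : D.pos q = D.pos q') : D.col q = D.col q' := by
  have := congrArg Fin.val h
  simp only [pos] at this
  exact Fin.ext (by omega)

/-- The checks of the resolved code. -/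
noncomputable abbrev X₁ : Matrix (ResX Q X T (2 * T + 1)) (ResQ Q X T (2 * T + 1)) (ZMod 2) :=
  resX hX D.row D.pos

/-- The `Z`-stabilizers of the resolved code. -/
noncomputable def Z₁ : Matrix Z (ResQ Q X T (2 * T + 1)) (ZMod 2) :=
  Matrix.of fun z => resolve hX D.row D.pos (hZ z)

/-- The parity of the common support of `s` and `z` at the positions from `k` on. -/
def beyond (z : Z) (s : X) (k : ℕ) : ZMod 2 := ∑ q, if k ≤ D.pos q then hX s q * hZ z q else 0

/-- In the row `ρ`, the stabilizer `z` has odd overlap with some `X`-check from `k` on. -/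
def On (z : Z) (ρ : Fin (T + 1)) (k : ℕ) : Prop := ∃ s, D.row s = ρ ∧ D.beyond z s k ≠ 0

variable {D}

theorem Z₁_front (z q ρ) : D.Z₁ z (.inl (q, ρ)) = hZ z q := rfl

theorem Z₁_back (z q ρ) : D.Z₁ z (.inr (.inl (q, ρ))) = hZ z q := rfl

open Classical in
theorem Z₁_leg (z q ρ) : D.Z₁ z (.inr (.inr (.inl (q, ρ)))) =
    if HasLeg hX D.row q ρ then hZ z q else 0 := rfl

theorem Z₁_link (z s j) : D.Z₁ z (.inr (.inr (.inr (s, j)))) = D.beyond z s (j + 1) := by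
  rw [Z₁, of_apply, resolve_link]
  rfl

theorem beyond_zero (z s) : D.beyond z s 0 = 0 := by
  have := D.comm s z
  simpa [beyond, dotProduct] using this

theorem beyond_last (z s) : D.beyond z s (2 * T + 2) = 0 := by
  refine Finset.sum_eq_zero fun q _ => if_neg ?_
  have := (D.pos q).2
  omega

theorem meets_of_beyond {z s k} (h : D.beyond z s k ≠ 0) : Meets hX hZ s z := by
  obtain ⟨q, -, hq⟩ := Finset.exists_ne_zero_of_sum_ne_zero h
  refine ⟨q, fun h0 => hq (by simp [h0]), fun h0 => hq (by simp [h0])⟩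

theorem on_row_iff {z s k} (h : Meets hX hZ s z) : D.On z (D.row s) k ↔ D.beyond z s k ≠ 0 := by
  refine ⟨?_, fun h0 => ⟨s, rfl, h0⟩⟩
  rintro ⟨s', hs', h0⟩
  obtain rfl := D.row_inj' s' s z (meets_of_beyond h0) h hs'
  exact h0

theorem beyond_add_beyond_succ (z s) (k : ℕ) : D.beyond z s k + D.beyond z s (k + 1) =
    ∑ q, if (D.pos q : ℕ) = k then hX s q * hZ z q else 0 := by
  rw [beyond, beyond, ← Finset.sum_add_distrib]
  refine Finset.sum_congr rfl fun q _ => ?_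
  rcases lt_trichotomy (D.pos q : ℕ) k with h | h | h
  · rw [if_neg (by omega), if_neg (by omega), if_neg (by omega), add_zero]
  · rw [if_pos (by omega), if_neg (by omega), if_pos (by omega), add_zero]
  · rw [if_pos (by omega), if_pos (by omega), if_neg (by omega), CharTwo.add_self_eq_zero]

theorem beyond_ne_iff (z s) (k : ℕ) : D.beyond z s k ≠ D.beyond z s (k + 1) ↔
    ∃ q, (D.pos q : ℕ) = k ∧ hX s q ≠ 0 ∧ hZ z q ≠ 0 := by
  rw [ne_eq, ← CharTwo.add_eq_zero, beyond_add_beyond_succ]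
  constructor
  · intro h
    obtain ⟨q, -, hq⟩ := Finset.exists_ne_zero_of_sum_ne_zero h
    rw [ne_eq, ite_eq_right_iff, Classical.not_imp] at hq
    exact ⟨q, hq.1, left_ne_zero_of_mul hq.2, right_ne_zero_of_mul hq.2⟩
  · rintro ⟨q, hq, h1, h2⟩
    rw [Fintype.sum_eq_single q fun q' hq' => ?_, if_pos hq]
    · exact mul_ne_zero h1 h2
    · by_contra h3
      rw [ite_eq_right_iff, Classical.not_imp] at h3
      refine hq' (D.col_inj q' q s (left_ne_zero_of_mul h3.2) h1 (D.col_eq_of_pos_eq ?_))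
      exact Fin.ext (h3.1.trans hq.symm)

/-- Two consecutive positions cannot both change the parity. -/
theorem beyond_eq_or_eq (z z' s s') (k : ℕ) : D.beyond z s k = D.beyond z s (k + 1) ∨
    D.beyond z' s' (k + 1) = D.beyond z' s' (k + 1 + 1) := by
  by_contra! h
  rw [beyond_ne_iff, beyond_ne_iff] at h
  obtain ⟨⟨q, hq, -⟩, q', hq', -⟩ := h
  simp only [pos] at hq hq'
  omega

theorem on_iff_of_leg {z q s} (hs : hX s q ≠ 0) (hz : hZ z q ≠ 0) :
    D.On z (D.row s) (D.pos q) ↔ ¬ D.On z (D.row s) (D.pos q + 1) := by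
  rw [on_row_iff ⟨q, hs, hz⟩, on_row_iff ⟨q, hs, hz⟩, not_not]
  have := (beyond_ne_iff (D := D) z s (D.pos q)).2 ⟨q, rfl, hs, hz⟩
  constructor
  · intro h
    by_contra h'
    rw [ZMod.two_eq_one_of_ne_zero h, ZMod.two_eq_one_of_ne_zero h'] at this
    exact this rfl
  · intro h h'
    rw [h, h'] at this
    exact this rfl

variable (D)

/-- The edge `t l ρ` of the filling of `z` joins two terminals only where the links of `z` in the
row `ρ` run through both its gaps. -/
def Linked (z : Z) (l : Fin (2 * T)) (ρ : Fin (T + 1)) : Prop :=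
  D.On z ρ (l + 1) ∧ D.On z ρ (l + 2)

open Classical in
/-- The node of the disc at which a qubit of `z` sits. A leg sits on the side on which the
links of its `X`-check carry `z`. -/
noncomputable def node (z : Z) : ResQ Q X T (2 * T + 1) → DiscV T (2 * T)
  | .inl (q, ρ) => .A (D.pos q) ρ
  | .inr (.inl (q, ρ)) => .B (D.pos q) ρ
  | .inr (.inr (.inl (q, ρ))) =>
    if D.On z ρ (D.pos q + 1) then .G (D.gapR q) ρ else .G (D.gapL q) ρ
  | .inr (.inr (.inr (s, j))) => .E j (D.row s)

open Classical in
/-- The edge from a terminal `B` to the node of the leg. -/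
noncomputable def legEdge (z : Z) (q : Q) (ρ : Fin (T + 1)) : DiscE T (2 * T) :=
  if D.On z ρ (D.pos q + 1) then .gl (D.gapR q) ρ else .gr (D.gapL q) ρ

/-- The edge that joins the qubits of `z` on the piece of `s` at the position `m`: two links, or the
leg and one link. -/
def PieceEdge (z : Z) (s : X) (m : Fin (2 * T + 1 + 1)) : DiscE T (2 * T) → Prop
  | .t l ρ => ρ = D.row s ∧ m = l.succ.castSucc ∧
      D.beyond z s m ≠ 0 ∧ D.beyond z s (m + 1) ≠ 0
  | .h j ρ => ρ = D.row s ∧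
      ((m = j.castSucc ∧ D.beyond z s m = 0 ∧ D.beyond z s (m + 1) ≠ 0) ∨
        (m = j.succ ∧ D.beyond z s m ≠ 0 ∧ D.beyond z s (m + 1) = 0))
  | _ => False

open Classical in
/-- The edge to which an `X`-check that meets `z` is attached. -/
noncomputable def label (z : Z) : ResX Q X T (2 * T + 1) → DiscE T (2 * T) → ZMod 2
  | .inl (q, ρ), e => if e = .w₀ (D.pos q) ρ ∧ hZ z q ≠ 0 then 1 else 0
  | .inr (.inl (q, ρ)), e => if e = .w₁ (D.pos q) ρ ∧ hZ z q ≠ 0 then 1 else 0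
  | .inr (.inr (.inl (q, ρ))), e =>
    if e = D.legEdge z q ρ ∧ hZ z q ≠ 0 ∧ HasLeg hX D.row q ρ then 1 else 0
  | .inr (.inr (.inr (s, m))), e => if D.PieceEdge z s m e then 1 else 0

variable {D}

theorem sum_leg_of_eq {z s} {m : Fin (2 * T + 1 + 1)} (y : DiscV T (2 * T) → ZMod 2)
    (h : D.beyond z s m = D.beyond z s (m + 1)) : (∑ q, if D.pos q = m then
      hX s q * (y (D.node z (.inr (.inr (.inl (q, D.row s))))) *
        D.Z₁ z (.inr (.inr (.inl (q, D.row s))))) else 0) = 0 := by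
  refine Finset.sum_eq_zero fun q _ => ?_
  by_cases hq : D.pos q = m
  · rw [if_pos hq, Z₁_leg]
    by_contra h0
    refine (beyond_ne_iff z s m).2 ⟨q, congrArg _ hq, left_ne_zero_of_mul h0, fun h1 => ?_⟩ h
    exact h0 (by simp [h1])
  · rw [if_neg hq]

theorem sum_leg_of_ne {z s} {m : Fin (2 * T + 1 + 1)} (y : DiscV T (2 * T) → ZMod 2)
    (h : D.beyond z s m ≠ D.beyond z s (m + 1)) : ∃ q, D.pos q = m ∧ hX s q ≠ 0 ∧ hZ z q ≠ 0 ∧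
      (∑ q, if D.pos q = m then hX s q * (y (D.node z (.inr (.inr (.inl (q, D.row s))))) *
        D.Z₁ z (.inr (.inr (.inl (q, D.row s))))) else 0) =
      y (D.node z (.inr (.inr (.inl (q, D.row s))))) := by
  obtain ⟨q, hq, h1, h2⟩ := (beyond_ne_iff z s m).1 h
  have hq : D.pos q = m := Fin.ext hq
  refine ⟨q, hq, h1, h2, ?_⟩
  rw [Fintype.sum_eq_single q fun q' hq' => ?_, if_pos hq, Z₁_leg,
    if_pos (show HasLeg hX D.row q (D.row s) from ⟨s, h1, rfl⟩),
    ZMod.two_eq_one_of_ne_zero h1, ZMod.two_eq_one_of_ne_zero h2, one_mul, mul_one]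
  by_cases h3 : D.pos q' = m
  · rw [if_pos h3]
    by_contra h0
    have h4 : hX s q' ≠ 0 := left_ne_zero_of_mul h0
    exact hq' (D.col_inj q' q s h4 h1 (D.col_eq_of_pos_eq (h3.trans hq.symm)))
  · rw [if_neg h3]

/-- Where the links begin to carry `z`, the leg sits in the gap after the position. -/
theorem sum_leg_right {z s} {j : Fin (2 * T + 1)} (y : DiscV T (2 * T) → ZMod 2)
    (h₁ : D.beyond z s j = 0) (h₂ : D.beyond z s (j + 1) ≠ 0) :
    (∑ q, if D.pos q = j.castSucc then hX s q * (y (D.node z (.inr (.inr (.inl (q, D.row s))))) *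
      D.Z₁ z (.inr (.inr (.inl (q, D.row s))))) else 0) = y (.G j (D.row s)) := by
  obtain ⟨q, hq, h3, h4, h5⟩ := sum_leg_of_ne (D := D) (z := z) (s := s) (m := j.castSucc) y (by
    rw [Fin.val_castSucc, h₁]; exact h₂.symm)
  rw [h5, node, if_pos, Fin.castSucc_inj.1 ((D.castSucc_gapR q).trans hq)]
  rw [on_row_iff ⟨q, h3, h4⟩, hq]
  exact h₂

/-- Where the links cease to carry `z`, the leg sits in the gap before the position. -/
theorem sum_leg_left {z s} {j : Fin (2 * T + 1)} (y : DiscV T (2 * T) → ZMod 2)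
    (h₁ : D.beyond z s (j + 1) ≠ 0) (h₂ : D.beyond z s (j + 1 + 1) = 0) :
    (∑ q, if D.pos q = j.succ then hX s q * (y (D.node z (.inr (.inr (.inl (q, D.row s))))) *
      D.Z₁ z (.inr (.inr (.inl (q, D.row s))))) else 0) = y (.G j (D.row s)) := by
  obtain ⟨q, hq, h3, h4, h5⟩ := sum_leg_of_ne (D := D) (z := z) (s := s) (m := j.succ) y (by
    rw [Fin.val_succ, h₂]; exact h₁)
  rw [h5, node, if_neg, Fin.succ_inj.1 ((D.succ_gapL q).trans hq)]
  rw [on_row_iff ⟨q, h3, h4⟩, hq, not_not]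
  exact h₂

variable (D)

theorem label_comm (z s) (y : DiscV T (2 * T) → ZMod 2) :
    ∑ x, D.X₁ s x * (y (D.node z x) * D.Z₁ z x) +
      ∑ e, D.label z s e * (y (Disc.src e) + y (Disc.tgt (D.Linked z) e)) = 0 := by
  classical
  have hadd : ∀ a : ZMod 2, a + a = 0 := CharTwo.add_self_eq_zero
  change (D.X₁ s ⬝ᵥ fun x => y (D.node z x) * D.Z₁ z x) + _ = 0
  rcases s with ⟨q, ρ⟩ | ⟨q, ρ⟩ | ⟨q, ρ⟩ | ⟨s, m⟩
  · rw [resX_front_dotProduct]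
    by_cases hz : hZ z q = 0
    · simp [Z₁_front, Z₁_back, hz, label]
    · simp [Z₁_front, Z₁_back, label, Disc.src, Disc.tgt, node,
        ZMod.two_eq_one_of_ne_zero hz, hadd]
  · rw [resX_back_dotProduct]
    by_cases hz : hZ z q = 0
    · simp [Z₁_front, Z₁_back, hz, label]
    · simp only [Z₁_front, Z₁_back, label, node, ZMod.two_eq_one_of_ne_zero hz]
      simp [Disc.src, Disc.tgt]
      rw [add_comm (y (.B _ _)), hadd]
  · rw [resX_leg_dotProduct]
    by_cases hz : hZ z q = 0
    · simp [Z₁_leg, Z₁_back, hz, label]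
    · by_cases hl : HasLeg hX D.row q ρ
      · simp only [Z₁_leg, Z₁_back, label, node, ZMod.two_eq_one_of_ne_zero hz, hl, if_true]
        by_cases ho : D.On z ρ (D.pos q + 1)
        · simp [legEdge, ho, Disc.src, Disc.tgt, castSucc_gapR, hadd]
        · simp [legEdge, ho, Disc.src, Disc.tgt, succ_gapL]
          rw [add_comm (y (.B _ _)), hadd]
      · simp [Z₁_leg, hl, label]
  · have hsum : ∀ e₀, (∀ e, D.PieceEdge z s m e ↔ e = e₀) →
        ∑ e, D.label z (.inr (.inr (.inr (s, m)))) e * (y (Disc.src e) +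
          y (Disc.tgt (D.Linked z) e)) = y (Disc.src e₀) + y (Disc.tgt (D.Linked z) e₀) := by
      intro e₀ he
      simp [label, he]
    have hcs : ∀ (j : Fin (2 * T + 1)) (g : Fin (2 * T + 1) → ZMod 2),
        (∑ i : Fin (2 * T + 1), if j.castSucc = i.castSucc then g i else 0) = g j := by simp
    have hsc : ∀ (j : Fin (2 * T + 1)) (g : Fin (2 * T + 1) → ZMod 2),
        (∑ i : Fin (2 * T + 1), if j.succ = i.succ then g i else 0) = g j := by simp
    have hlink : ∀ j, y (D.node z (.inr (.inr (.inr (s, j))))) *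
        D.Z₁ z (.inr (.inr (.inr (s, j)))) = y (.E j (D.row s)) * D.beyond z s (j + 1) :=
      fun j => by rw [Z₁_link]; rfl
    rw [resX_piece_dotProduct]
    simp only [hlink]
    -- the two sums over links, in terms of `beyond` at `m` and `m + 1`
    by_cases h1 : D.beyond z s m = 0 <;> by_cases h2 : D.beyond z s (m + 1) = 0
    · rw [sum_leg_of_eq y (h1.trans h2.symm), Fintype.sum_eq_zero, Fintype.sum_eq_zero,
        Fintype.sum_eq_zero]
      · simp
      · rintro (_ | _ | _ | _ | _ | _ | _) <;> simp [label, PieceEdge, h1, h2]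
      · intro j
        by_cases hj : m = j.succ
        · subst hj
          rw [Fin.val_succ] at h1
          simp [h1]
        · rw [if_neg hj]
      · intro j
        by_cases hj : m = j.castSucc
        · subst hj
          rw [Fin.val_castSucc] at h2
          simp [h2]
        · rw [if_neg hj]
    · obtain ⟨j, rfl⟩ : ∃ j : Fin (2 * T + 1), m = j.castSucc := by
        refine ⟨m.castPred fun h => h2 ?_, (Fin.castSucc_castPred _ _).symm⟩
        rw [h]
        exact beyond_last z s
      rw [hsum (.h j (D.row s)), sum_leg_right y h1 h2, hcs, Fintype.sum_eq_zero]
      · rw [Fin.val_castSucc] at h2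
        rw [ZMod.two_eq_one_of_ne_zero h2]
        simp [Disc.src, Disc.tgt, hadd]
      · intro i
        by_cases hj : j.castSucc = i.succ
        · rw [hj, Fin.val_succ] at h1
          simp [h1]
        · rw [if_neg hj]
      · simp only [Fin.val_castSucc] at h1 h2
        rintro (_ | _ | _ | _ | _ | _ | _) <;> simp [PieceEdge] <;>
          grind [Fin.castSucc_inj, Fin.succ_inj]
    · obtain ⟨j, rfl⟩ : ∃ j : Fin (2 * T + 1), m = j.succ := by
        refine ⟨m.pred fun h => h1 ?_, (Fin.succ_pred _ _).symm⟩
        rw [h]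
        exact beyond_zero z s
      rw [hsum (.h j (D.row s)), sum_leg_left y h1 h2, hsc, Fintype.sum_eq_zero]
      · rw [Fin.val_succ] at h1
        rw [ZMod.two_eq_one_of_ne_zero h1]
        simp [Disc.src, Disc.tgt, hadd]
      · intro i
        by_cases hj : j.succ = i.castSucc
        · rw [hj, Fin.val_castSucc] at h2
          simp [h2]
        · rw [if_neg hj]
      · simp only [Fin.val_succ] at h1 h2
        rintro (_ | _ | _ | _ | _ | _ | _) <;> simp [PieceEdge] <;>
          grind [Fin.castSucc_inj, Fin.succ_inj]
    · obtain ⟨k, rfl⟩ : ∃ j : Fin (2 * T + 1), m = j.castSucc := by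
        refine ⟨m.castPred fun h => h2 ?_, (Fin.castSucc_castPred _ _).symm⟩
        rw [h]
        exact beyond_last z s
      obtain ⟨l, rfl⟩ : ∃ l : Fin (2 * T), k = l.succ := by
        refine ⟨k.pred fun h => h1 ?_, (Fin.succ_pred _ _).symm⟩
        rw [h]
        exact beyond_zero z s
      rw [hsum (.t l (D.row s)), sum_leg_of_eq y, hcs, ← Fin.succ_castSucc, hsc]
      · have hL : D.Linked z l (D.row s) := ⟨⟨s, rfl, h1⟩, s, rfl, h2⟩
        simp only [Fin.val_castSucc, Fin.val_succ] at h1 h2 ⊢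
        rw [ZMod.two_eq_one_of_ne_zero h1, ZMod.two_eq_one_of_ne_zero h2]
        simp only [Disc.src, Disc.tgt, hL, if_true, mul_one]
        rw [zero_add, add_comm (y (.E l.succ _)), hadd]
      · rw [ZMod.two_eq_one_of_ne_zero h1, ZMod.two_eq_one_of_ne_zero h2]
      · simp only [Fin.val_castSucc, Fin.val_succ] at h1 h2
        rintro (_ | _ | _ | _ | _ | _ | _) <;> simp [PieceEdge] <;>
          grind [Fin.castSucc_inj, Fin.succ_inj]

/-- The fillings of the stabilizers of the resolved code. -/
noncomputable def sheet :
    Sheet D.X₁ D.Z₁ (DiscV T (2 * T)) (DiscE T (2 * T)) (DiscF T (2 * T)) where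
  src := Disc.src
  tgt z := Disc.tgt (D.Linked z)
  bd z := Disc.bd (D.Linked z)
  ν := D.node
  lab := D.label
  comm := D.label_comm
  face _ f y := Disc.face f y
  conn _ y h := Disc.conn y h
  exact _ α h := Disc.exact α h

end Layout

end Layout

end CSSCode

namespace CSSCode

open Matrix

/-! ### Degrees in the disc -/

namespace Disc

variable {R N : ℕ} {lk : Fin N → Fin (R + 1) → Prop}

theorem mem_bd_P₀ {e : DiscE R N} {j ρ} : e ∈ bd lk (.P₀ j ρ) ↔ e = .w₀ j.castSucc ρ ∨
    e = .w₀ j.succ ρ ∨ e = .ha j ρ ∨ e = .gl j ρ ∨ e = .gr j ρ := by simp [bd]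

theorem mem_bd_P₁ {e : DiscE R N} {j ρ} : e ∈ bd lk (.P₁ j ρ) ↔ e = .w₁ j.castSucc ρ ∨
    e = .w₁ j.succ ρ ∨ e = .gl j ρ.castSucc ∨ e = .gr j ρ.castSucc ∨ e = .ha j ρ.succ := by
  simp [bd]

theorem mem_bd_T {e : DiscE R N} {l ρ} : e ∈ bd lk (.T l ρ) ↔ e = .t l ρ ∨ lk l ρ ∧
    (e = .h l.castSucc ρ ∨ e = .h l.succ ρ ∨ e = .gr l.castSucc ρ ∨ e = .gl l.succ ρ) := by
  by_cases h : lk l ρ <;> simp [bd, h]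

theorem card_faces_le_two {w : DiscF R N → ZMod 2} {e : DiscE R N}
    (hw : ∀ f, w f ≠ 0 → e ∈ bd lk f)
    (he : (∃ i ρ, e = .w₀ i ρ) ∨ (∃ i ρ, e = .w₁ i ρ) ∨ (∃ j ρ, e = .ha j ρ) ∨
      (∃ j ρ, e = .gl j ρ ∧ ∀ l, l.succ = j → ¬ lk l ρ) ∨
      (∃ j ρ, e = .gr j ρ ∧ ∀ l, l.castSucc = j → ¬ lk l ρ) ∨ ∃ j ρ, e = .h j ρ) :
    hammingNorm w ≤ 2 := by
  refine hammingNorm_le_two (fun f => match f with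
    | .P₀ j ρ => e = .w₀ j.castSucc ρ ∨ e = .ha j ρ ∨ e = .gl j ρ ∨ e = .gr j ρ
    | .P₁ j ρ => e = .w₁ j.castSucc ρ
    | .T l ρ => e = .h l.castSucc ρ) ?_
  rintro (⟨j, ρ⟩ | ⟨j, ρ⟩ | ⟨l, ρ⟩) (⟨j', ρ'⟩ | ⟨j', ρ'⟩ | ⟨l', ρ'⟩) ha hb hab <;>
    replace ha := hw _ ha <;> replace hb := hw _ hb <;>
    simp only [mem_bd_P₀, mem_bd_P₁, mem_bd_T] at ha hb <;>
    rcases he with ⟨i, σ, rfl⟩ | ⟨i, σ, rfl⟩ | ⟨i, σ, rfl⟩ | ⟨i, σ, rfl, he⟩ | ⟨i, σ, rfl, he⟩ |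
      ⟨i, σ, rfl⟩ <;> simp at ha hb hab ⊢ <;> grind [Fin.castSucc_inj, Fin.succ_inj]

theorem card_faces_gl_le {w : DiscF R N → ZMod 2} {j ρ}
    (hw : ∀ f, w f ≠ 0 → DiscE.gl j ρ ∈ bd lk f) : hammingNorm w ≤ 3 := by
  refine (hammingNorm_le_card_of_injOn (β := Fin 3) (fun f => f.code.1) ?_).trans (by simp)
  rintro (⟨i, ρ⟩ | ⟨i, ρ⟩ | ⟨l, ρ⟩) (⟨i', ρ'⟩ | ⟨i', ρ'⟩ | ⟨l', ρ'⟩) ha hb hab <;>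
    replace ha := hw _ ha <;> replace hb := hw _ hb <;>
    simp only [mem_bd_P₀, mem_bd_P₁, mem_bd_T] at ha hb <;>
    simp [DiscF.code] at ha hb hab ⊢ <;> grind

theorem card_faces_gr_le {w : DiscF R N → ZMod 2} {j ρ}
    (hw : ∀ f, w f ≠ 0 → DiscE.gr j ρ ∈ bd lk f) : hammingNorm w ≤ 3 := by
  refine (hammingNorm_le_card_of_injOn (β := Fin 3) (fun f => f.code.1) ?_).trans (by simp)
  rintro (⟨i, ρ⟩ | ⟨i, ρ⟩ | ⟨l, ρ⟩) (⟨i', ρ'⟩ | ⟨i', ρ'⟩ | ⟨l', ρ'⟩) ha hb hab <;>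
    replace ha := hw _ ha <;> replace hb := hw _ hb <;>
    simp only [mem_bd_P₀, mem_bd_P₁, mem_bd_T] at ha hb <;>
    simp [DiscF.code] at ha hb hab ⊢ <;> grind

theorem card_faces_le_one {w : DiscF R N → ZMod 2} {e : DiscE R N}
    (hw : ∀ f, w f ≠ 0 → e ∈ bd lk f)
    (he : (∃ l ρ, e = .t l ρ) ∨ (∃ j ρ, e = .h j ρ ∧ ∀ l, l.succ = j → ¬ lk l ρ) ∨
      (∃ j ρ, e = .h j ρ ∧ ∀ l, l.castSucc = j → ¬ lk l ρ)) :
    hammingNorm w ≤ 1 := by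
  refine hammingNorm_le_one ?_
  rintro (⟨j, ρ⟩ | ⟨j, ρ⟩ | ⟨l, ρ⟩) (⟨j', ρ'⟩ | ⟨j', ρ'⟩ | ⟨l', ρ'⟩) ha hb <;>
    replace ha := hw _ ha <;> replace hb := hw _ hb <;>
    simp only [mem_bd_P₀, mem_bd_P₁, mem_bd_T] at ha hb <;>
    rcases he with ⟨i, σ, rfl⟩ | ⟨i, σ, rfl, he⟩ | ⟨i, σ, rfl, he⟩ <;> simp at ha hb ⊢ <;>
    grind [Fin.castSucc_inj, Fin.succ_inj]

theorem card_edges_A_le {w : DiscE R N → ZMod 2} {i ρ}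
    (hw : ∀ e, w e ≠ 0 → src e = .A i ρ ∨ tgt lk e = .A i ρ) : hammingNorm w ≤ 4 := by
  classical
  refine (hammingNorm_le_card_of_injOn (β := Fin 4) (fun e => match e with
    | .w₀ _ _ => 0
    | .w₁ _ _ => 1
    | .ha j _ => if j.castSucc = i then 2 else 3
    | _ => 0) ?_).trans (by simp)
  have ht : ∀ l ρ', tgt lk (.t l ρ') ≠ .A i ρ := fun l ρ' => by
    by_cases h : lk l ρ' <;> simp [tgt, h]
  rintro (⟨i, ρ⟩ | ⟨i, ρ⟩ | ⟨i, ρ⟩ | ⟨i, ρ⟩ | ⟨i, ρ⟩ | ⟨i, ρ⟩ | ⟨i, ρ⟩)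
    (⟨i', ρ'⟩ | ⟨i', ρ'⟩ | ⟨i', ρ'⟩ | ⟨i', ρ'⟩ | ⟨i', ρ'⟩ | ⟨i', ρ'⟩ | ⟨i', ρ'⟩) ha hb hab <;>
    replace ha := hw _ ha <;> replace hb := hw _ hb <;> simp [src, ht] at ha hb hab ⊢ <;>
    simp [tgt] at ha hb <;> grind

theorem card_edges_B_le {w : DiscE R N → ZMod 2} {i ρ}
    (hw : ∀ e, w e ≠ 0 → src e = .B i ρ ∨ tgt lk e = .B i ρ) : hammingNorm w ≤ 4 := by
  classical
  refine (hammingNorm_le_card_of_injOn (β := Fin 4) (fun e => match e with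
    | .w₀ _ _ => 0
    | .w₁ _ _ => 1
    | .gl _ _ => 2
    | .gr _ _ => 3
    | _ => 0) ?_).trans (by simp)
  have ht : ∀ l ρ', tgt lk (.t l ρ') ≠ .B i ρ := fun l ρ' => by
    by_cases h : lk l ρ' <;> simp [tgt, h]
  rintro (⟨i, ρ⟩ | ⟨i, ρ⟩ | ⟨i, ρ⟩ | ⟨i, ρ⟩ | ⟨i, ρ⟩ | ⟨i, ρ⟩ | ⟨i, ρ⟩)
    (⟨i', ρ'⟩ | ⟨i', ρ'⟩ | ⟨i', ρ'⟩ | ⟨i', ρ'⟩ | ⟨i', ρ'⟩ | ⟨i', ρ'⟩ | ⟨i', ρ'⟩) ha hb hab <;>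
    replace ha := hw _ ha <;> replace hb := hw _ hb <;> simp [src, ht] at ha hb hab ⊢ <;>
    simp [tgt] at ha hb <;> grind

theorem card_edges_G_le {w : DiscE R N → ZMod 2} {i ρ}
    (hw : ∀ e, w e ≠ 0 → src e = .G i ρ ∨ tgt lk e = .G i ρ) : hammingNorm w ≤ 3 := by
  classical
  refine (hammingNorm_le_card_of_injOn (β := Fin 3) (fun e => match e with
    | .gl _ _ => 0
    | .gr _ _ => 1
    | .h _ _ => 2
    | _ => 0) ?_).trans (by simp)
  have ht : ∀ l ρ', tgt lk (.t l ρ') ≠ .G i ρ := fun l ρ' => by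
    by_cases h : lk l ρ' <;> simp [tgt, h]
  rintro (⟨i, ρ⟩ | ⟨i, ρ⟩ | ⟨i, ρ⟩ | ⟨i, ρ⟩ | ⟨i, ρ⟩ | ⟨i, ρ⟩ | ⟨i, ρ⟩)
    (⟨i', ρ'⟩ | ⟨i', ρ'⟩ | ⟨i', ρ'⟩ | ⟨i', ρ'⟩ | ⟨i', ρ'⟩ | ⟨i', ρ'⟩ | ⟨i', ρ'⟩) ha hb hab <;>
    replace ha := hw _ ha <;> replace hb := hw _ hb <;> simp [src, ht] at ha hb hab ⊢ <;>
    simp [tgt] at ha hb <;> grind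

theorem card_edges_E_le {w : DiscE R N → ZMod 2} {i ρ}
    (hw : ∀ e, w e ≠ 0 → src e = .E i ρ ∨ tgt lk e = .E i ρ) : hammingNorm w ≤ 3 := by
  classical
  refine (hammingNorm_le_card_of_injOn (β := Fin 3) (fun e => match e with
    | .h _ _ => 0
    | .t l _ => if l.castSucc = i then 1 else 2
    | _ => 0) ?_).trans (by simp)
  have hw' : ∀ e, w e ≠ 0 → e = .h i ρ ∨ ∃ l, e = .t l ρ ∧ (l.castSucc = i ∨ l.succ = i) := by
    intro e he
    rcases e with _ | _ | _ | _ | _ | _ | ⟨l, ρ'⟩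
    case t =>
      by_cases h : lk l ρ' <;> have := hw _ he <;> simp [src, tgt, h] at this ⊢ <;> grind
    all_goals simpa [src, tgt] using hw _ he
  intro a b ha hb hab
  rcases hw' a ha with rfl | ⟨l, rfl, hl⟩ <;> rcases hw' b hb with rfl | ⟨l', rfl, hl'⟩ <;>
    simp at hab ⊢ <;> grind [Fin.castSucc_inj, Fin.succ_inj]

end Disc

end CSSCode

namespace CSSCode

open Matrix

/-! ### Weights of the resolved code -/

namespace Layout

variable {Q X Z : Type} [Fintype Q] [Fintype X] [Fintype Z] {hX : Matrix X Q (ZMod 2)}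
  {hZ : Matrix Z Q (ZMod 2)} {T : ℕ} {D : Layout hX hZ T}

theorem X₁_piece_leg_ne_zero {s m q ρ} :
    D.X₁ (.inr (.inr (.inr (s, m)))) (.inr (.inr (.inl (q, ρ)))) ≠ 0 ↔
      D.row s = ρ ∧ D.pos q = m ∧ hX s q ≠ 0 := by
  classical
  simp [resX]

theorem X₁_piece_link_ne_zero {s m t j} :
    D.X₁ (.inr (.inr (.inr (s, m)))) (.inr (.inr (.inr (t, j)))) ≠ 0 ↔
      t = s ∧ (m = j.castSucc ∨ m = j.succ) := by
  classical
  simp only [resX, of_apply, ne_eq, ite_eq_right_iff, Classical.not_imp]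
  simp

theorem hammingNorm_X₁_le (s) : hammingNorm (D.X₁ s) ≤ 3 := by
  classical
  rw [hammingNorm_sum, hammingNorm_sum, hammingNorm_sum]
  rcases s with ⟨q, ρ⟩ | ⟨q, ρ⟩ | ⟨q, ρ⟩ | ⟨s, m⟩
  · have h1 := hammingNorm_le_one (v := fun a => D.X₁ (.inl (q, ρ)) (.inl a)) (by
      intro a b ha hb; simp [resX] at ha hb; rw [ha, hb])
    have h2 := hammingNorm_le_one (v := fun a => D.X₁ (.inl (q, ρ)) (.inr (.inl a))) (by
      intro a b ha hb; simp [resX] at ha hb; rw [ha, hb])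
    have h3 := hammingNorm_le_zero (v := fun a => D.X₁ (.inl (q, ρ)) (.inr (.inr (.inl a)))) (by
      simp [resX])
    have h4 := hammingNorm_le_zero (v := fun a => D.X₁ (.inl (q, ρ)) (.inr (.inr (.inr a)))) (by
      simp [resX])
    omega
  · have h1 := hammingNorm_le_one (v := fun a => D.X₁ (.inr (.inl (q, ρ))) (.inl a)) (by
      intro a b ha hb; simp [resX] at ha hb; rw [ha, hb])
    have h2 := hammingNorm_le_one (v := fun a => D.X₁ (.inr (.inl (q, ρ))) (.inr (.inl a))) (by
      intro a b ha hb; simp [resX] at ha hb; rw [ha, hb])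
    have h3 := hammingNorm_le_zero (v := fun a => D.X₁ (.inr (.inl (q, ρ)))
      (.inr (.inr (.inl a)))) (by simp [resX])
    have h4 := hammingNorm_le_zero (v := fun a => D.X₁ (.inr (.inl (q, ρ)))
      (.inr (.inr (.inr a)))) (by simp [resX])
    omega
  · have h1 := hammingNorm_le_zero (v := fun a => D.X₁ (.inr (.inr (.inl (q, ρ)))) (.inl a)) (by
      simp [resX])
    have h2 := hammingNorm_le_one (v := fun a => D.X₁ (.inr (.inr (.inl (q, ρ))))
      (.inr (.inl a))) (by
        intro a b ha hb; simp [resX] at ha hb; rw [ha.1, hb.1])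
    have h3 := hammingNorm_le_one (v := fun a => D.X₁ (.inr (.inr (.inl (q, ρ))))
      (.inr (.inr (.inl a)))) (by
        intro a b ha hb; simp [resX] at ha hb; rw [ha, hb])
    have h4 := hammingNorm_le_zero (v := fun a => D.X₁ (.inr (.inr (.inl (q, ρ))))
      (.inr (.inr (.inr a)))) (by simp [resX])
    omega
  · have h1 := hammingNorm_le_zero (v := fun a => D.X₁ (.inr (.inr (.inr (s, m)))) (.inl a)) (by
      simp [resX])
    have h2 := hammingNorm_le_zero (v := fun a => D.X₁ (.inr (.inr (.inr (s, m))))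
      (.inr (.inl a))) (by simp [resX])
    have h3 := hammingNorm_le_one (v := fun a => D.X₁ (.inr (.inr (.inr (s, m))))
      (.inr (.inr (.inl a)))) (by
        rintro ⟨q, ρ⟩ ⟨q', ρ'⟩ ha hb
        obtain ⟨rfl, rfl, ha'⟩ := X₁_piece_leg_ne_zero.1 ha
        obtain ⟨rfl, h, hb'⟩ := X₁_piece_leg_ne_zero.1 hb
        rw [D.col_inj q q' s ha' hb' (D.col_eq_of_pos_eq h.symm)])
    have h4 := hammingNorm_le_two (v := fun a => D.X₁ (.inr (.inr (.inr (s, m))))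
      (.inr (.inr (.inr a)))) (fun a => m = a.2.castSucc) (by
        rintro ⟨q, ρ⟩ ⟨q', ρ'⟩ ha hb hab
        simp [resX] at ha hb hab
        ext <;> grind [Fin.castSucc_inj, Fin.succ_inj])
    omega

theorem hammingNorm_X₁_front_le (q ρ) : hammingNorm (fun s => D.X₁ s (.inl (q, ρ))) ≤ 2 := by
  classical
  rw [hammingNorm_sum, hammingNorm_sum, hammingNorm_sum]
  have h1 := hammingNorm_le_one (v := fun a => D.X₁ (.inl a) (.inl (q, ρ))) (by
    intro a b ha hb; simp [resX] at ha hb; rw [← ha, ← hb])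
  have h2 := hammingNorm_le_one (v := fun a => D.X₁ (.inr (.inl a)) (.inl (q, ρ))) (by
    rintro ⟨a, σ⟩ ⟨b, τ⟩ ha hb; simp [resX] at ha hb; ext <;> grind [Fin.succ_inj])
  have h3 := hammingNorm_le_zero (v := fun a => D.X₁ (.inr (.inr (.inl a))) (.inl (q, ρ))) (by
    simp [resX])
  have h4 := hammingNorm_le_zero (v := fun a => D.X₁ (.inr (.inr (.inr a))) (.inl (q, ρ))) (by
    simp [resX])
  omega

theorem hammingNorm_X₁_back_le (q ρ) :
    hammingNorm (fun s => D.X₁ s (.inr (.inl (q, ρ)))) ≤ 3 := by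
  classical
  rw [hammingNorm_sum, hammingNorm_sum, hammingNorm_sum]
  have h1 := hammingNorm_le_one (v := fun a => D.X₁ (.inl a) (.inr (.inl (q, ρ)))) (by
    intro a b ha hb; simp [resX] at ha hb; rw [← ha, ← hb])
  have h2 := hammingNorm_le_one (v := fun a => D.X₁ (.inr (.inl a)) (.inr (.inl (q, ρ)))) (by
    rintro ⟨a, σ⟩ ⟨b, τ⟩ ha hb; simp [resX] at ha hb; ext <;> grind [Fin.castSucc_inj])
  have h3 := hammingNorm_le_one (v := fun a => D.X₁ (.inr (.inr (.inl a)))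
    (.inr (.inl (q, ρ)))) (by
      rintro ⟨a, σ⟩ ⟨b, τ⟩ ha hb; simp [resX] at ha hb; ext <;> grind)
  have h4 := hammingNorm_le_zero (v := fun a => D.X₁ (.inr (.inr (.inr a)))
    (.inr (.inl (q, ρ)))) (by simp [resX])
  omega

theorem piece_unique {q ρ s m s' m'}
    (h : D.X₁ (.inr (.inr (.inr (s, m)))) (.inr (.inr (.inl (q, ρ)))) ≠ 0)
    (h' : D.X₁ (.inr (.inr (.inr (s', m')))) (.inr (.inr (.inl (q, ρ)))) ≠ 0) :
    (s, m) = (s', m') := by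
  classical
  obtain ⟨h1, rfl, h3⟩ := X₁_piece_leg_ne_zero.1 h
  obtain ⟨h1', rfl, h3'⟩ := X₁_piece_leg_ne_zero.1 h'
  rw [D.row_inj s s' q h3 h3' (h1.trans h1'.symm)]

theorem hammingNorm_X₁_leg_le (q ρ) :
    hammingNorm (fun s => D.X₁ s (.inr (.inr (.inl (q, ρ))))) ≤ 2 := by
  classical
  rw [hammingNorm_sum, hammingNorm_sum, hammingNorm_sum]
  have h1 := hammingNorm_le_zero (v := fun a => D.X₁ (.inl a) (.inr (.inr (.inl (q, ρ))))) (by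
    simp [resX])
  have h2 := hammingNorm_le_zero (v := fun a => D.X₁ (.inr (.inl a))
    (.inr (.inr (.inl (q, ρ))))) (by simp [resX])
  have h3 := hammingNorm_le_one (v := fun a => D.X₁ (.inr (.inr (.inl a)))
    (.inr (.inr (.inl (q, ρ))))) (by
      intro a b ha hb; simp [resX] at ha hb; rw [← ha, ← hb])
  have h4 := hammingNorm_le_one (v := fun a => D.X₁ (.inr (.inr (.inr a)))
    (.inr (.inr (.inl (q, ρ))))) fun a b ha hb => piece_unique ha hb
  omega

theorem X₁_link_ne_zero {s j s'} (h : D.X₁ s' (.inr (.inr (.inr (s, j)))) ≠ 0) :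
    s' = .inr (.inr (.inr (s, j.castSucc))) ∨ s' = .inr (.inr (.inr (s, j.succ))) := by
  classical
  rcases s' with ⟨q, ρ⟩ | ⟨q, ρ⟩ | ⟨q, ρ⟩ | ⟨s', m⟩
  · simp [resX] at h
  · simp [resX] at h
  · simp [resX] at h
  · rcases X₁_piece_link_ne_zero.1 h with ⟨rfl, rfl | rfl⟩ <;> simp

theorem hammingNorm_X₁_link_le (s j) :
    hammingNorm (fun s' => D.X₁ s' (.inr (.inr (.inr (s, j))))) ≤ 2 := by
  refine hammingNorm_le_two (fun s' => s' = .inr (.inr (.inr (s, j.castSucc)))) ?_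
  intro a b ha hb hab
  rcases X₁_link_ne_zero ha with h | h <;> rcases X₁_link_ne_zero hb with h' | h' <;> grind

/-- The `X`-check `s` of the resolved code comes from a qubit of `z` or from an `X`-check that
meets `z`. -/
def Over (D : Layout hX hZ T) (z : Z) : ResX Q X T (2 * T + 1) → Prop
  | .inl (q, _) => hZ z q ≠ 0
  | .inr (.inl (q, _)) => hZ z q ≠ 0
  | .inr (.inr (.inl (q, ρ))) => hZ z q ≠ 0 ∧ HasLeg hX D.row q ρ
  | .inr (.inr (.inr (s, _))) => Meets hX hZ s z

theorem Z₁_leg_ne_zero {z q ρ} (h : D.Z₁ z (.inr (.inr (.inl (q, ρ)))) ≠ 0) :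
    hZ z q ≠ 0 ∧ HasLeg hX D.row q ρ := by
  classical
  rw [Z₁_leg, ne_eq, ite_eq_right_iff, Classical.not_imp] at h
  exact h.symm

theorem over_of_meets {z s} (h : Meets D.X₁ D.Z₁ s z) : D.Over z s := by
  classical
  obtain ⟨x, hs, hz⟩ := h
  rcases s with ⟨q, ρ⟩ | ⟨q, ρ⟩ | ⟨q, ρ⟩ | ⟨s, m⟩ <;>
    rcases x with ⟨q', ρ'⟩ | ⟨q', ρ'⟩ | ⟨q', ρ'⟩ | ⟨s', j⟩
  case inr.inr.inr.inr.inr.inl =>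
    exact ⟨q', (X₁_piece_leg_ne_zero.1 hs).2.2, (Z₁_leg_ne_zero hz).1⟩
  case inr.inr.inr.inr.inr.inr =>
    rw [Z₁_link, (X₁_piece_link_ne_zero.1 hs).1] at hz
    exact meets_of_beyond hz
  all_goals simp [resX] at hs
  · obtain ⟨rfl, rfl⟩ := hs; exact hz
  · obtain ⟨rfl, rfl⟩ := hs; exact hz
  · obtain ⟨rfl, rfl⟩ := hs; exact hz
  · obtain ⟨rfl, rfl⟩ := hs; exact hz
  · obtain ⟨rfl, rfl, h⟩ := hs; exact ⟨hz, h⟩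
  · obtain ⟨rfl, rfl⟩ := hs; exact Z₁_leg_ne_zero hz

theorem eq_of_over {z z' s} (hz : D.slot z = D.slot z') (h : D.Over z s) (h' : D.Over z' s) :
    z = z' := by
  rcases s with ⟨q, ρ⟩ | ⟨q, ρ⟩ | ⟨q, ρ⟩ | ⟨s, m⟩
  · exact D.slot_inj z z' q h h' hz
  · exact D.slot_inj z z' q h h' hz
  · exact D.slot_inj z z' q h.1 h'.1 hz
  · exact D.slot_inj' z z' s h h' hz

theorem eq_of_Z₁ {z z' x} (hz : D.slot z = D.slot z') (h : D.Z₁ z x ≠ 0) (h' : D.Z₁ z' x ≠ 0) :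
    z = z' := by
  rcases x with ⟨q, ρ⟩ | ⟨q, ρ⟩ | ⟨q, ρ⟩ | ⟨s, j⟩
  · exact D.slot_inj z z' q h h' hz
  · exact D.slot_inj z z' q h h' hz
  · exact D.slot_inj z z' q (Z₁_leg_ne_zero h).1 (Z₁_leg_ne_zero h').1 hz
  · rw [Z₁_link] at h h'
    exact D.slot_inj' z z' s (meets_of_beyond h) (meets_of_beyond h') hz

theorem exists_over_of_evX {s k} (h : EvX D.X₁ D.Z₁ D.slot s k) :
    ∃ z, D.slot z = k ∧ D.Over z s := by
  obtain ⟨x, hx, z, hz, hzx⟩ := h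
  exact ⟨z, hz, over_of_meets ⟨x, hx, hzx⟩⟩

/-- If a link is not an event, then a piece of the check at one of its ends can only be one through
a change of parity at its position. -/
theorem exists_beyond_ne_of_evX {s m k j} (h : EvX D.X₁ D.Z₁ D.slot (.inr (.inr (.inr (s, m)))) k)
    (hx : ¬ EvQ D.Z₁ D.slot (.inr (.inr (.inr (s, j)))) k) (hm : m = j.castSucc ∨ m = j.succ) :
    ∃ z, D.beyond z s m ≠ D.beyond z s (m + 1) := by
  classical
  obtain ⟨x, hs, z, hz, hzx⟩ := h
  refine ⟨z, ?_⟩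
  have h0 : D.beyond z s (j + 1) = 0 := by
    by_contra h0
    exact hx ⟨z, hz, by rwa [Z₁_link]⟩
  rcases x with ⟨q', ρ'⟩ | ⟨q', ρ'⟩ | ⟨q', ρ'⟩ | ⟨s', i⟩
  · simp [resX] at hs
  · simp [resX] at hs
  · obtain ⟨-, h1, h2⟩ := X₁_piece_leg_ne_zero.1 hs
    rw [beyond_ne_iff]
    exact ⟨q', congrArg Fin.val h1, h2, (Z₁_leg_ne_zero hzx).1⟩
  · obtain ⟨rfl, hi⟩ := X₁_piece_link_ne_zero.1 hs
    rw [Z₁_link] at hzx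
    have hij : i ≠ j := fun h => hzx (by rw [h, h0])
    rcases hm with rfl | rfl <;> rcases hi with hi | hi
    · exact absurd (Fin.castSucc_inj.1 hi).symm hij
    · have hi' : (j : ℕ) = i + 1 := congrArg Fin.val hi
      rw [Fin.val_castSucc, h0, hi']
      exact hzx
    · have hi' : (j : ℕ) + 1 = i := congrArg Fin.val hi
      rw [Fin.val_succ, h0, hi']
      exact hzx.symm
    · exact absurd (Fin.succ_inj.1 hi).symm hij

theorem not_event {x k} (hx : ¬ EvQ D.Z₁ D.slot x k) (w : ResX Q X T (2 * T + 1) → ZMod 2)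
    (hw : ∀ s, w s ≠ 0 → D.X₁ s x ≠ 0 ∧ EvX D.X₁ D.Z₁ D.slot s k) :
    hammingNorm (fun s => D.X₁ s x) + hammingNorm w ≤ 3 := by
  classical
  rcases x with ⟨q, ρ⟩ | ⟨q, ρ⟩ | ⟨q, ρ⟩ | ⟨s, j⟩
  · have h1 := hammingNorm_le_zero (v := w) (by
      intro s
      by_contra h
      obtain ⟨h1, h2⟩ := hw s h
      obtain ⟨z, hz, ho⟩ := exists_over_of_evX h2
      refine hx ⟨z, hz, ?_⟩
      rcases s with ⟨q', ρ'⟩ | ⟨q', ρ'⟩ | ⟨q', ρ'⟩ | ⟨s, m⟩ <;> simp [resX] at h1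
      · obtain ⟨rfl, rfl⟩ := h1; exact ho
      · obtain ⟨rfl, rfl⟩ := h1; exact ho)
    have := hammingNorm_X₁_front_le (D := D) q ρ
    omega
  · have h1 := hammingNorm_le_zero (v := w) (by
      intro s
      by_contra h
      obtain ⟨h1, h2⟩ := hw s h
      obtain ⟨z, hz, ho⟩ := exists_over_of_evX h2
      refine hx ⟨z, hz, ?_⟩
      rcases s with ⟨q', ρ'⟩ | ⟨q', ρ'⟩ | ⟨q', ρ'⟩ | ⟨s, m⟩ <;> simp [resX] at h1
      · obtain ⟨rfl, rfl⟩ := h1; exact ho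
      · obtain ⟨rfl, rfl⟩ := h1; exact ho
      · obtain ⟨rfl, rfl, -⟩ := h1; exact ho.1)
    have := hammingNorm_X₁_back_le (D := D) q ρ
    omega
  · have hp : ∀ s, w s ≠ 0 → ∃ p, s = .inr (.inr (.inr p)) := by
      intro s h
      obtain ⟨h1, h2⟩ := hw s h
      rcases s with ⟨q', ρ'⟩ | ⟨q', ρ'⟩ | ⟨q', ρ'⟩ | p
      · simp [resX] at h1
      · simp [resX] at h1
      · simp [resX] at h1
        obtain ⟨rfl, rfl⟩ := h1
        obtain ⟨z, hz, ho⟩ := exists_over_of_evX h2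
        refine absurd ⟨z, hz, ?_⟩ hx
        rw [Z₁_leg, if_pos ho.2]
        exact ho.1
      · exact ⟨p, rfl⟩
    have h1 := hammingNorm_le_one (v := w) (by
      intro a b ha hb
      obtain ⟨⟨s, m⟩, rfl⟩ := hp a ha
      obtain ⟨⟨s', m'⟩, rfl⟩ := hp b hb
      rw [piece_unique (hw _ ha).1 (hw _ hb).1])
    have := hammingNorm_X₁_leg_le (D := D) q ρ
    omega
  · have h1 := hammingNorm_le_one (v := w) (by
      have key : ∀ {a b}, w a ≠ 0 → w b ≠ 0 → a = .inr (.inr (.inr (s, j.castSucc))) →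
          b = .inr (.inr (.inr (s, j.succ))) → False := by
        rintro _ _ ha hb rfl rfl
        obtain ⟨z, hz⟩ := exists_beyond_ne_of_evX (hw _ ha).2 hx (.inl rfl)
        obtain ⟨z', hz'⟩ := exists_beyond_ne_of_evX (hw _ hb).2 hx (.inr rfl)
        rcases beyond_eq_or_eq (D := D) z z' s s j with h | h
        · exact hz h
        · exact hz' h
      intro a b ha hb
      rcases X₁_link_ne_zero (hw a ha).1 with h | h <;>
        rcases X₁_link_ne_zero (hw b hb).1 with h' | h'
      · rw [h, h']
      · exact (key ha hb h h').elim
      · exact (key hb ha h' h).elim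
      · rw [h, h'])
    have := hammingNorm_X₁_link_le (D := D) s j
    omega

theorem label_meets {z s e} (h : D.label z s e ≠ 0) : Meets D.X₁ D.Z₁ s z := by
  classical
  rcases s with ⟨q, ρ⟩ | ⟨q, ρ⟩ | ⟨q, ρ⟩ | ⟨s, m⟩
  · simp [label] at h
    exact ⟨.inl (q, ρ), by simp [resX], h.2⟩
  · simp [label] at h
    exact ⟨.inl (q, ρ.succ), by simp [resX], h.2⟩
  · simp [label] at h
    exact ⟨.inr (.inl (q, ρ)), by simp [resX, h.2.2], h.2.1⟩
  · simp [label] at h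
    rcases e with _ | _ | _ | _ | _ | ⟨j, ρ⟩ | ⟨l, ρ⟩
    case h =>
      refine ⟨.inr (.inr (.inr (s, j))), ?_, ?_⟩
      · refine X₁_piece_link_ne_zero.2 ⟨rfl, ?_⟩
        rcases h.2 with h | h
        · exact .inl h.1
        · exact .inr h.1
      · rw [Z₁_link]
        rcases h.2 with ⟨rfl, -, h⟩ | ⟨rfl, h, -⟩
        · exact h
        · exact h
    case t =>
      obtain ⟨-, rfl, -, h⟩ := h
      refine ⟨.inr (.inr (.inr (s, l.succ))), by simp [resX], ?_⟩
      rw [Z₁_link]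
      exact h
    all_goals exact h.elim

theorem label_unique {z s e e'} (h : D.label z s e ≠ 0) (h' : D.label z s e' ≠ 0) : e = e' := by
  classical
  rcases s with ⟨q, ρ⟩ | ⟨q, ρ⟩ | ⟨q, ρ⟩ | ⟨s, m⟩
  · simp [label] at h h'
    rw [h.1, h'.1]
  · simp [label] at h h'
    rw [h.1, h'.1]
  · simp [label] at h h'
    rw [h.1, h'.1]
  · simp [label] at h h'
    rcases e with _ | _ | _ | _ | _ | _ | _ <;> rcases e' with _ | _ | _ | _ | _ | _ | _ <;>
      simp [PieceEdge] at h h' ⊢ <;> grind [Fin.castSucc_inj, Fin.succ_inj]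

end Layout

end CSSCode

namespace CSSCode

open Matrix

/-! ### Weights of the fillings -/

namespace Layout

variable {Q X Z : Type} [Fintype Q] [Fintype X] [Fintype Z] {hX : Matrix X Q (ZMod 2)}
  {hZ : Matrix Z Q (ZMod 2)} {T : ℕ} {D : Layout hX hZ T}

theorem linked_iff_of_meets {s z l} (h : Meets hX hZ s z) : D.Linked z l (D.row s) ↔
    D.beyond z s (l + 1) ≠ 0 ∧ D.beyond z s (l + 2) ≠ 0 := by
  rw [Linked, on_row_iff h, on_row_iff h]

theorem meets_of_pieceEdge {z s m e} (h : D.PieceEdge z s m e) : Meets hX hZ s z := by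
  rcases e with _ | _ | _ | _ | _ | ⟨j, ρ⟩ | ⟨l, ρ⟩
  case h => rcases h.2 with h | h; exacts [meets_of_beyond h.2.2, meets_of_beyond h.2.1]
  case t => exact meets_of_beyond h.2.2.1
  all_goals exact h.elim

theorem mem_bd_of_φ_ne_zero {z f e} (h : D.sheet.φ z f e ≠ 0) : e ∈ Disc.bd (D.Linked z) f := by
  classical
  by_contra h0
  refine h ?_
  rw [Sheet.φ, List.count_eq_zero_of_not_mem (show e ∉ D.sheet.bd z f from h0), Nat.cast_zero]

theorem edge_le (z e) : hammingNorm (fun s => D.label z s e) +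
    hammingNorm (fun f => D.sheet.φ z f e) ≤ 3 := by
  classical
  have hf : ∀ f, D.sheet.φ z f e ≠ 0 → e ∈ Disc.bd (D.Linked z) f := fun f => mem_bd_of_φ_ne_zero
  rw [hammingNorm_sum, hammingNorm_sum, hammingNorm_sum]
  -- an edge other than `h` and `t` is not attached to the pieces
  have h4 : (∀ s m, ¬ D.PieceEdge z s m e) →
      hammingNorm (fun a => D.label z (.inr (.inr (.inr a))) e) ≤ 0 :=
    fun h => hammingNorm_le_zero fun a => by simp [label, h]
  rcases e with ⟨i, ρ⟩ | ⟨i, ρ⟩ | ⟨i, ρ⟩ | ⟨j, ρ⟩ | ⟨j, ρ⟩ | ⟨j, ρ⟩ | ⟨l, ρ⟩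
  · have h0 := Disc.card_faces_le_two hf (by simp)
    have h1 := hammingNorm_le_one (v := fun a => D.label z (.inl a) (.w₀ i ρ)) (by
      rintro ⟨q, ρ⟩ ⟨q', ρ'⟩ ha hb
      simp [label] at ha hb
      obtain ⟨rfl, rfl, ha⟩ := ha
      obtain ⟨h, rfl, hb⟩ := hb
      rw [D.col_inj' q q' z ha hb (D.col_eq_of_pos_eq h)])
    have h2 := hammingNorm_le_zero (v := fun a => D.label z (.inr (.inl a)) (.w₀ i ρ)) (by
      simp [label])
    have h3 := hammingNorm_le_zero (v := fun a => D.label z (.inr (.inr (.inl a))) (.w₀ i ρ)) (by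
      rintro ⟨q, σ⟩
      by_cases ho : D.On z σ (D.pos q + 1) <;> simp [label, legEdge, ho])
    have := h4 fun s m h => h
    omega
  · have h0 := Disc.card_faces_le_two hf (by simp)
    have h1 := hammingNorm_le_zero (v := fun a => D.label z (.inl a) (.w₁ i ρ)) (by
      simp [label])
    have h2 := hammingNorm_le_one (v := fun a => D.label z (.inr (.inl a)) (.w₁ i ρ)) (by
      rintro ⟨q, ρ⟩ ⟨q', ρ'⟩ ha hb
      simp [label] at ha hb
      obtain ⟨rfl, rfl, ha⟩ := ha
      obtain ⟨h, rfl, hb⟩ := hb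
      rw [D.col_inj' q q' z ha hb (D.col_eq_of_pos_eq h)])
    have h3 := hammingNorm_le_zero (v := fun a => D.label z (.inr (.inr (.inl a))) (.w₁ i ρ)) (by
      rintro ⟨q, σ⟩
      by_cases ho : D.On z σ (D.pos q + 1) <;> simp [label, legEdge, ho])
    have := h4 fun s m h => h
    omega
  · have h0 := Disc.card_faces_le_two hf (by simp)
    have h1 := hammingNorm_le_zero (v := fun a => D.label z (.inl a) (.ha i ρ)) (by
      simp [label])
    have h2 := hammingNorm_le_zero (v := fun a => D.label z (.inr (.inl a)) (.ha i ρ)) (by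
      simp [label])
    have h3 := hammingNorm_le_zero (v := fun a => D.label z (.inr (.inr (.inl a))) (.ha i ρ)) (by
      rintro ⟨q, σ⟩
      by_cases ho : D.On z σ (D.pos q + 1) <;> simp [label, legEdge, ho])
    have := h4 fun s m h => h
    omega
  · have h1 := hammingNorm_le_zero (v := fun a => D.label z (.inl a) (.gl j ρ)) (by
      simp [label])
    have h2 := hammingNorm_le_zero (v := fun a => D.label z (.inr (.inl a)) (.gl j ρ)) (by
      simp [label])
    have := h4 fun s m h => h
    have key : ∀ q σ, D.label z (.inr (.inr (.inl (q, σ)))) (.gl j ρ) ≠ 0 →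
        σ = ρ ∧ D.gapR q = j ∧ hZ z q ≠ 0 ∧ HasLeg hX D.row q ρ ∧ D.On z ρ (D.pos q + 1) := by
      intro q σ h
      by_cases ho : D.On z σ (D.pos q + 1) <;> simp [label, legEdge, ho] at h
      obtain ⟨rfl, rfl, h5, h6⟩ := h
      exact ⟨rfl, rfl, h5, h6, ho⟩
    by_cases h5 : ∃ q σ, D.label z (.inr (.inr (.inl (q, σ)))) (.gl j ρ) ≠ 0
    · obtain ⟨q, σ, h5⟩ := h5
      obtain ⟨rfl, rfl, h6, ⟨s, hs, rfl⟩, h8⟩ := key q σ h5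
      have h0 := Disc.card_faces_le_two hf (by
        refine .inr (.inr (.inr (.inl ⟨_, _, rfl, fun l hl hlk => ?_⟩)))
        have hl' : (l : ℕ) + 1 = D.pos q := congrArg Fin.val hl
        rw [Linked, hl'] at hlk
        exact (on_iff_of_leg hs h6).1 hlk.1 h8)
      have h3 := hammingNorm_le_one (v := fun a => D.label z (.inr (.inr (.inl a)))
          (.gl (D.gapR q) (D.row s))) (by
        rintro ⟨q₁, σ₁⟩ ⟨q₂, σ₂⟩ ha hb
        obtain ⟨rfl, ha, ha', -⟩ := key _ _ ha
        obtain ⟨rfl, hb, hb', -⟩ := key _ _ hb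
        rw [D.col_inj' q₁ q₂ z ha' hb' (D.col_eq_of_pos_eq (by
          rw [← castSucc_gapR, ← castSucc_gapR, ha, hb]))])
      omega
    · push Not at h5
      have h3 := hammingNorm_le_zero (v := fun a => D.label z (.inr (.inr (.inl a)))
        (.gl j ρ)) fun a => h5 a.1 a.2
      have h0 := Disc.card_faces_gl_le hf
      omega
  · have h1 := hammingNorm_le_zero (v := fun a => D.label z (.inl a) (.gr j ρ)) (by
      simp [label])
    have h2 := hammingNorm_le_zero (v := fun a => D.label z (.inr (.inl a)) (.gr j ρ)) (by
      simp [label])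
    have := h4 fun s m h => h
    have key : ∀ q σ, D.label z (.inr (.inr (.inl (q, σ)))) (.gr j ρ) ≠ 0 →
        σ = ρ ∧ D.gapL q = j ∧ hZ z q ≠ 0 ∧ ¬ D.On z ρ (D.pos q + 1) := by
      intro q σ h
      by_cases ho : D.On z σ (D.pos q + 1) <;> simp [label, legEdge, ho] at h
      obtain ⟨rfl, rfl, h5, h6⟩ := h
      exact ⟨rfl, rfl, h5, ho⟩
    by_cases h5 : ∃ q σ, D.label z (.inr (.inr (.inl (q, σ)))) (.gr j ρ) ≠ 0
    · obtain ⟨q, σ, h5⟩ := h5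
      obtain ⟨rfl, rfl, h6, h8⟩ := key q σ h5
      have h0 := Disc.card_faces_le_two hf (by
        refine .inr (.inr (.inr (.inr (.inl ⟨_, _, rfl, fun l hl hlk => h8 ?_⟩))))
        have hl' : (l : ℕ) + 1 = D.pos q := congrArg (fun a => (Fin.val a) + 1) hl
        rw [← hl']
        exact hlk.2)
      have h3 := hammingNorm_le_one (v := fun a => D.label z (.inr (.inr (.inl a)))
          (.gr (D.gapL q) σ)) (by
        rintro ⟨q₁, σ₁⟩ ⟨q₂, σ₂⟩ ha hb
        obtain ⟨rfl, ga, ga', -⟩ := key _ _ ha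
        obtain ⟨rfl, gb, gb', -⟩ := key _ _ hb
        rw [D.col_inj' q₁ q₂ z ga' gb' (D.col_eq_of_pos_eq (by
          rw [← succ_gapL, ← succ_gapL, ga, gb]))])
      omega
    · push Not at h5
      have h3 := hammingNorm_le_zero (v := fun a => D.label z (.inr (.inr (.inl a)))
        (.gr j ρ)) fun a => h5 a.1 a.2
      have h0 := Disc.card_faces_gr_le hf
      omega
  · have h0 := Disc.card_faces_le_two hf (by simp)
    have h1 := hammingNorm_le_zero (v := fun a => D.label z (.inl a) (.h j ρ)) (by
      simp [label])
    have h2 := hammingNorm_le_zero (v := fun a => D.label z (.inr (.inl a)) (.h j ρ)) (by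
      simp [label])
    have h3 := hammingNorm_le_zero (v := fun a => D.label z (.inr (.inr (.inl a))) (.h j ρ)) (by
      rintro ⟨q, σ⟩
      by_cases ho : D.On z σ (D.pos q + 1) <;> simp [label, legEdge, ho])
    have h5 := hammingNorm_le_two (v := fun a => D.label z (.inr (.inr (.inr a))) (.h j ρ))
      (fun a => a.2 = j.castSucc) (by
        rintro ⟨s, m⟩ ⟨s', m'⟩ ha hb hab
        simp [label] at ha hb
        have hs := D.row_inj' s s' z (meets_of_pieceEdge ha) (meets_of_pieceEdge hb)
          (ha.1.symm.trans hb.1)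
        simp at hab
        have ha' := ha.2
        have hb' := hb.2
        ext <;> grind)
    by_cases h6 : ∃ s m, D.PieceEdge z s m (.h j ρ)
    · obtain ⟨s, m, h6⟩ := h6
      have hm := meets_of_pieceEdge h6
      obtain ⟨rfl, h6⟩ := h6
      have h7 := Disc.card_faces_le_one hf (by
        rcases h6 with ⟨rfl, h6, -⟩ | ⟨rfl, -, h6⟩
        · refine .inr (.inl ⟨_, _, rfl, fun l hl hlk => ?_⟩)
          rw [linked_iff_of_meets hm] at hlk
          subst hl
          exact hlk.1 h6
        · refine .inr (.inr ⟨_, _, rfl, fun l hl hlk => ?_⟩)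
          rw [linked_iff_of_meets hm] at hlk
          subst hl
          exact hlk.2 h6)
      omega
    · push Not at h6
      have := h4 h6
      omega
  · have h0 := Disc.card_faces_le_one hf (by simp)
    have h1 := hammingNorm_le_zero (v := fun a => D.label z (.inl a) (.t l ρ)) (by
      simp [label])
    have h2 := hammingNorm_le_zero (v := fun a => D.label z (.inr (.inl a)) (.t l ρ)) (by
      simp [label])
    have h3 := hammingNorm_le_zero (v := fun a => D.label z (.inr (.inr (.inl a))) (.t l ρ)) (by
      rintro ⟨q, σ⟩
      by_cases ho : D.On z σ (D.pos q + 1) <;> simp [label, legEdge, ho])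
    have h5 := hammingNorm_le_one (v := fun a => D.label z (.inr (.inr (.inr a))) (.t l ρ)) (by
        rintro ⟨s, m⟩ ⟨s', m'⟩ ha hb
        simp [label] at ha hb
        have hs := D.row_inj' s s' z (meets_of_pieceEdge ha) (meets_of_pieceEdge hb)
          (ha.1.symm.trans hb.1)
        rw [hs, ha.2.1, hb.2.1])
    omega

theorem d_ne_zero {z e v} (h : D.sheet.d z e v ≠ 0) :
    Disc.src e = v ∨ Disc.tgt (D.Linked z) e = v := by
  classical
  by_contra! h0
  refine h ?_
  change (if Disc.src e = v then (1 : ZMod 2) else 0) +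
    (if Disc.tgt (D.Linked z) e = v then 1 else 0) = 0
  rw [if_neg h0.1, if_neg h0.2, add_zero]

theorem node_le (z v) (w : ResQ Q X T (2 * T + 1) → ZMod 2)
    (hw : ∀ x, w x ≠ 0 → D.node z x = v ∧ D.Z₁ z x ≠ 0) :
    hammingNorm w + hammingNorm (fun e => D.sheet.d z e v) ≤ 5 := by
  classical
  have hd : ∀ e, D.sheet.d z e v ≠ 0 → Disc.src e = v ∨ Disc.tgt (D.Linked z) e = v :=
    fun e => d_ne_zero
  have hleg : ∀ q ρ, w (.inr (.inr (.inl (q, ρ)))) ≠ 0 →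
      (v = .G (D.gapR q) ρ ∨ v = .G (D.gapL q) ρ) ∧ hZ z q ≠ 0 := by
    intro q ρ h
    obtain ⟨h1, h2⟩ := hw _ h
    refine ⟨?_, (Z₁_leg_ne_zero h2).1⟩
    by_cases ho : D.On z ρ (D.pos q + 1) <;> simp [node, ho] at h1
    · exact .inl h1.symm
    · exact .inr h1.symm
  rw [hammingNorm_sum, hammingNorm_sum, hammingNorm_sum]
  rcases v with ⟨i, ρ⟩ | ⟨i, ρ⟩ | ⟨j, ρ⟩ | ⟨j, ρ⟩
  · have h0 := Disc.card_edges_A_le hd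
    have h1 := hammingNorm_le_one (v := fun a => w (.inl a)) (by
      rintro ⟨q, σ⟩ ⟨q', σ'⟩ ha hb
      obtain ⟨ha, ha'⟩ := hw _ ha
      obtain ⟨hb, hb'⟩ := hw _ hb
      simp [node] at ha hb
      rw [D.col_inj' q q' z ha' hb' (D.col_eq_of_pos_eq (ha.1.trans hb.1.symm)), ha.2, hb.2])
    have h2 := hammingNorm_le_zero (v := fun a => w (.inr (.inl a))) (by
      intro a; by_contra h; simpa [node] using (hw _ h).1)
    have h3 := hammingNorm_le_zero (v := fun a => w (.inr (.inr (.inl a)))) (by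
      intro a; by_contra h; simpa using (hleg a.1 a.2 h).1)
    have h4 := hammingNorm_le_zero (v := fun a => w (.inr (.inr (.inr a)))) (by
      intro a; by_contra h; simpa [node] using (hw _ h).1)
    omega
  · have h0 := Disc.card_edges_B_le hd
    have h1 := hammingNorm_le_zero (v := fun a => w (.inl a)) (by
      intro a; by_contra h; simpa [node] using (hw _ h).1)
    have h2 := hammingNorm_le_one (v := fun a => w (.inr (.inl a))) (by
      rintro ⟨q, σ⟩ ⟨q', σ'⟩ ha hb
      obtain ⟨ha, ha'⟩ := hw _ ha
      obtain ⟨hb, hb'⟩ := hw _ hb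
      simp [node] at ha hb
      rw [D.col_inj' q q' z ha' hb' (D.col_eq_of_pos_eq (ha.1.trans hb.1.symm)), ha.2, hb.2])
    have h3 := hammingNorm_le_zero (v := fun a => w (.inr (.inr (.inl a)))) (by
      intro a; by_contra h; simpa using (hleg a.1 a.2 h).1)
    have h4 := hammingNorm_le_zero (v := fun a => w (.inr (.inr (.inr a)))) (by
      intro a; by_contra h; simpa [node] using (hw _ h).1)
    omega
  · have h0 := Disc.card_edges_G_le hd
    have h1 := hammingNorm_le_zero (v := fun a => w (.inl a)) (by
      intro a; by_contra h; simpa [node] using (hw _ h).1)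
    have h2 := hammingNorm_le_zero (v := fun a => w (.inr (.inl a))) (by
      intro a; by_contra h; simpa [node] using (hw _ h).1)
    have h3 := hammingNorm_le_two (v := fun a => w (.inr (.inr (.inl a))))
      (fun a => j = D.gapR a.1) (by
        rintro ⟨q, σ⟩ ⟨q', σ'⟩ ha hb hab
        obtain ⟨ha, ha'⟩ := hleg _ _ ha
        obtain ⟨hb, hb'⟩ := hleg _ _ hb
        simp at ha hb hab
        have hσ : σ = σ' := by grind
        have hpos : D.pos q = D.pos q' := by
          have e1 := D.castSucc_gapR q
          have e2 := D.castSucc_gapR q'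
          have e3 := D.succ_gapL q
          have e4 := D.succ_gapL q'
          grind
        rw [D.col_inj' q q' z ha' hb' (D.col_eq_of_pos_eq hpos), hσ])
    have h4 := hammingNorm_le_zero (v := fun a => w (.inr (.inr (.inr a)))) (by
      intro a; by_contra h; simpa [node] using (hw _ h).1)
    omega
  · have h0 := Disc.card_edges_E_le hd
    have h1 := hammingNorm_le_zero (v := fun a => w (.inl a)) (by
      intro a; by_contra h; simpa [node] using (hw _ h).1)
    have h2 := hammingNorm_le_zero (v := fun a => w (.inr (.inl a))) (by
      intro a; by_contra h; simpa [node] using (hw _ h).1)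
    have h3 := hammingNorm_le_zero (v := fun a => w (.inr (.inr (.inl a)))) (by
      intro a; by_contra h; simpa using (hleg a.1 a.2 h).1)
    have h4 := hammingNorm_le_one (v := fun a => w (.inr (.inr (.inr a)))) (by
      rintro ⟨s, i⟩ ⟨s', i'⟩ ha hb
      obtain ⟨ha, ha'⟩ := hw _ ha
      obtain ⟨hb, hb'⟩ := hw _ hb
      rw [Z₁_link] at ha' hb'
      simp [node] at ha hb
      rw [D.row_inj' s s' z (meets_of_beyond ha') (meets_of_beyond hb') (ha.2.trans hb.2.symm),
        ha.1, hb.1])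
    omega

theorem isSparse : D.sheet.IsSparse D.slot where
  comm s z := isCycle_resolve (fun t => D.comm t z) s
  wX_le := hammingNorm_X₁_le
  qX_le x := by
    rcases x with ⟨q, ρ⟩ | ⟨q, ρ⟩ | ⟨q, ρ⟩ | ⟨s, j⟩
    · exact (hammingNorm_X₁_front_le q ρ).trans (by norm_num)
    · exact hammingNorm_X₁_back_le q ρ
    · exact (hammingNorm_X₁_leg_le q ρ).trans (by norm_num)
    · exact (hammingNorm_X₁_link_le s j).trans (by norm_num)
  eq_of_meets z z' s x x' h h1 h2 h3 h4 :=
    eq_of_over h (over_of_meets ⟨x, h1, h2⟩) (over_of_meets ⟨x', h3, h4⟩)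
  eq_of_common z z' x h h1 h2 := eq_of_Z₁ h h1 h2
  not_event x k := not_event
  lab_meets z s e := label_meets
  lab_unique z s e e' := label_unique
  face_le z f := Disc.length_bd_le f
  edge_le := edge_le
  node_le := node_le

theorem hammingNorm_Z₁_le {w m : ℕ} (z : Z) (hw : hammingNorm (hZ z) ≤ w)
    (hm : ∀ q, hammingNorm (fun s => hX s q) ≤ m) :
    hammingNorm (D.Z₁ z) ≤ (3 * (T + 1) + (2 * T + 1) * m) * w := by
  classical
  refine le_trans ?_ (Nat.mul_le_mul_left _ hw)
  refine hammingNorm_le_mul (fun q x => match x with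
    | .inl (q', _) => if q' = q then 1 else 0
    | .inr (.inl (q', _)) => if q' = q then 1 else 0
    | .inr (.inr (.inl (q', _))) => if q' = q then 1 else 0
    | .inr (.inr (.inr (s, _))) => hX s q) (fun q _ => ?_) fun x hx => ?_
  · have h1 : hammingNorm (fun a : Q × Fin (T + 1) => if a.1 = q then (1 : ZMod 2) else 0) ≤
        T + 1 := by
      refine (hammingNorm_le_card_of_injOn Prod.snd ?_).trans (by simp)
      rintro ⟨a, σ⟩ ⟨b, τ⟩ ha hb hab
      simp at ha hb hab
      rw [ha, hb, hab]
    have h2 := hammingNorm_prod_le (v := fun a : X × Fin (2 * T + 1) => hX a.1 q)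
      (w := fun s => hX s q) fun a b h => h
    rw [Fintype.card_fin] at h2
    have h3 := Nat.mul_le_mul_left (2 * T + 1) (hm q)
    rw [hammingNorm_sum, hammingNorm_sum, hammingNorm_sum]
    change hammingNorm (fun a : Q × Fin (T + 1) => if a.1 = q then (1 : ZMod 2) else 0) +
      (hammingNorm (fun a : Q × Fin (T + 1) => if a.1 = q then (1 : ZMod 2) else 0) +
      (hammingNorm (fun a : Q × Fin (T + 1) => if a.1 = q then (1 : ZMod 2) else 0) +
      hammingNorm (fun a : X × Fin (2 * T + 1) => hX a.1 q))) ≤ _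
    omega
  · rcases x with ⟨q, ρ⟩ | ⟨q, ρ⟩ | ⟨q, ρ⟩ | ⟨s, j⟩
    · exact ⟨q, hx, by simp⟩
    · exact ⟨q, hx, by simp⟩
    · exact ⟨q, (Z₁_leg_ne_zero hx).1, by simp⟩
    · rw [Z₁_link] at hx
      obtain ⟨q, h1, h2⟩ := meets_of_beyond hx
      exact ⟨q, h2, h1⟩

end Layout

end CSSCode

/-! ### Colourings -/

section Colouring

variable {α β : Type*} [Fintype α] [Fintype β]

/-- Greedy colouring: if each vertex conflicts with at most `k` vertices, then `k + 1` colours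
suffice. -/
theorem exists_coloring_of_card_le [DecidableEq α] {k : ℕ} (N : α → Finset α)
    (hN : ∀ v, (N v).card ≤ k) : ∃ c : α → Fin (k + 1),
      ∀ u v, u ∈ N v → v ∈ N u → c u = c v → u = v := by
  suffices h : ∀ s : Finset α, ∃ c : α → Fin (k + 1), ∀ u ∈ s, ∀ v ∈ s,
      u ∈ N v → v ∈ N u → c u = c v → u = v by
    obtain ⟨c, hc⟩ := h Finset.univ
    exact ⟨c, fun u v => hc u (Finset.mem_univ _) v (Finset.mem_univ _)⟩
  intro s
  induction s using Finset.induction_on with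
  | empty => exact ⟨fun _ => 0, by simp⟩
  | insert x s hx ih =>
    obtain ⟨c, hc⟩ := ih
    obtain ⟨i, hi⟩ : ∃ i, i ∉ (N x).image c := by
      by_contra! h
      have h1 : Finset.univ ⊆ (N x).image c := fun i _ => h i
      have h2 := (Finset.card_le_card h1).trans (Finset.card_image_le.trans (hN x))
      simp at h2
    refine ⟨Function.update c x i, fun u hu v hv huv hvu h => ?_⟩
    rw [Finset.mem_insert] at hu hv
    by_cases h1 : u = x <;> by_cases h2 : v = x
    · rw [h1, h2]
    · subst h1
      rw [Function.update_self, Function.update_of_ne h2] at h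
      exact absurd (Finset.mem_image.2 ⟨v, hvu, h.symm⟩) hi
    · subst h2
      rw [Function.update_self, Function.update_of_ne h1] at h
      exact absurd (Finset.mem_image.2 ⟨u, huv, h⟩) hi
    · rw [Function.update_of_ne h1, Function.update_of_ne h2] at h
      exact hc u (hu.resolve_left h1) v (hv.resolve_left h2) huv hvu h

open Classical in
/-- The columns of `M` with a nonzero entry in one of the rows in `s`. -/
noncomputable def neighbours (M : Matrix α β (ZMod 2)) (s : Finset α) : Finset β :=
  Finset.univ.filter fun b => ∃ a ∈ s, M a b ≠ 0

theorem mem_neighbours {M : Matrix α β (ZMod 2)} {s : Finset α} {b : β} :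
    b ∈ neighbours M s ↔ ∃ a ∈ s, M a b ≠ 0 := by
  simp [neighbours]

theorem card_neighbours_le {M : Matrix α β (ZMod 2)} {s : Finset α} {k l : ℕ}
    (hM : ∀ a, hammingNorm (M a) ≤ k) (hs : s.card ≤ l) : (neighbours M s).card ≤ k * l := by
  classical
  have h : neighbours M s ⊆ s.biUnion fun a => Finset.univ.filter fun b => M a b ≠ 0 := by
    intro b hb
    simpa using mem_neighbours.1 hb
  calc _ ≤ _ := Finset.card_le_card h
    _ ≤ ∑ a ∈ s, k := Finset.card_biUnion_le.trans (Finset.sum_le_sum fun a _ => hM a)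
    _ = k * s.card := by rw [Finset.sum_const, smul_eq_mul, mul_comm]
    _ ≤ k * l := Nat.mul_le_mul_left _ hs

end Colouring

namespace CSSCode

open Matrix

section Main

variable {Q X Z : Type} [Fintype Q] [Fintype X] [Fintype Z] {hX : Matrix X Q (ZMod 2)}
  {hZ : Matrix Z Q (ZMod 2)}

/-- The number of rows, columns and slots that suffice for a code whose weights are at most `m`. -/
def layoutSize (m : ℕ) : ℕ := m * m + m * (m * (m * m)) + 1

/-- Two objects have to be kept apart if they are joined by a path of length two or four between
qubits and stabilizers, so each object has at most `m ^ 2 + m ^ 4` conflicts. -/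
theorem nonempty_layout {m : ℕ} (comm : ∀ s z, hX s ⬝ᵥ hZ z = 0)
    (hwX : ∀ s, hammingNorm (hX s) ≤ m) (hwZ : ∀ z, hammingNorm (hZ z) ≤ m)
    (hqX : ∀ q, hammingNorm (fun s => hX s q) ≤ m) (hqZ : ∀ q, hammingNorm (fun z => hZ z q) ≤ m) :
    Nonempty (Layout hX hZ (layoutSize m)) := by
  classical
  have hqX' : ∀ q, hammingNorm (hXᵀ q) ≤ m := hqX
  have hqZ' : ∀ q, hammingNorm (hZᵀ q) ≤ m := hqZ
  have hsing : ∀ {α : Type} (a : α), ({a} : Finset α).card ≤ 1 := by simp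
  obtain ⟨cZ, hcZ⟩ := exists_coloring_of_card_le (k := m * m + m * (m * (m * m)))
    (fun z => neighbours hZᵀ (neighbours hZ {z}) ∪
      neighbours hZᵀ (neighbours hX (neighbours hXᵀ (neighbours hZ {z})))) fun z => by
    refine (Finset.card_union_le _ _).trans (add_le_add ?_ ?_)
    · have := card_neighbours_le hqZ' (card_neighbours_le hwZ (hsing z))
      simpa using this
    · have := card_neighbours_le hqZ' (card_neighbours_le hwX
        (card_neighbours_le hqX' (card_neighbours_le hwZ (hsing z))))
      simpa using this
  obtain ⟨cX, hcX⟩ := exists_coloring_of_card_le (k := m * m + m * (m * (m * m)))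
    (fun s => neighbours hXᵀ (neighbours hX {s}) ∪
      neighbours hXᵀ (neighbours hZ (neighbours hZᵀ (neighbours hX {s})))) fun s => by
    refine (Finset.card_union_le _ _).trans (add_le_add ?_ ?_)
    · have := card_neighbours_le hqX' (card_neighbours_le hwX (hsing s))
      simpa using this
    · have := card_neighbours_le hqX' (card_neighbours_le hwZ
        (card_neighbours_le hqZ' (card_neighbours_le hwX (hsing s))))
      simpa using this
  obtain ⟨cQ, hcQ⟩ := exists_coloring_of_card_le (k := m * m + m * (m * (m * m)))
    (fun q => neighbours hX (neighbours hXᵀ {q}) ∪ neighbours hZ (neighbours hZᵀ {q})) fun q => by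
    refine (Finset.card_union_le _ _).trans ?_
    have h1 := card_neighbours_le hwX (card_neighbours_le hqX' (hsing q))
    have h2 := card_neighbours_le hwZ (card_neighbours_le hqZ' (hsing q))
    have h3 : m * m ≤ m * (m * (m * m)) := by
      rcases Nat.eq_zero_or_pos m with rfl | hm
      · simp
      · exact Nat.mul_le_mul_left _ (Nat.le_mul_of_pos_right _ (Nat.mul_pos hm hm))
    rw [mul_one] at h1 h2
    exact add_le_add h1 (h2.trans h3)
  simp only [Finset.mem_union, mem_neighbours, Finset.mem_singleton, exists_eq_left,
    transpose_apply] at hcZ hcX hcQ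
  exact ⟨{
    row := fun s => (cX s).castSucc
    col := cQ
    slot := cZ
    comm := comm
    row_inj := fun s s' q h h' e => hcX s s' (.inl ⟨q, h', h⟩) (.inl ⟨q, h, h'⟩)
      (Fin.castSucc_inj.1 e)
    row_inj' := fun s s' z ⟨q, h1, h2⟩ ⟨q', h3, h4⟩ e => hcX s s'
      (.inr ⟨q, ⟨z, ⟨q', h3, h4⟩, h2⟩, h1⟩) (.inr ⟨q', ⟨z, ⟨q, h1, h2⟩, h4⟩, h3⟩)
      (Fin.castSucc_inj.1 e)
    col_inj := fun q q' s h h' e => hcQ q q' (.inl ⟨s, h', h⟩) (.inl ⟨s, h, h'⟩) e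
    col_inj' := fun q q' z h h' e => hcQ q q' (.inr ⟨z, h', h⟩) (.inr ⟨z, h, h'⟩) e
    slot_inj := fun z z' q h h' e => hcZ z z' (.inl ⟨q, h', h⟩) (.inl ⟨q, h, h'⟩) e
    slot_inj' := fun z z' s ⟨q, h1, h2⟩ ⟨q', h3, h4⟩ e => hcZ z z'
      (.inr ⟨q, ⟨s, ⟨q', h4, h3⟩, h1⟩, h2⟩) (.inr ⟨q', ⟨s, ⟨q, h2, h1⟩, h3⟩, h4⟩) e }⟩

end Main

theorem Reduces.mono {C C' : CSSCode} {F F' G G' : ℕ} (h : Reduces C C' F G) (hF : F ≤ F')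
    (hG : G ≤ G') : Reduces C C' F' G' where
  K_eq := h.K_eq
  dX_le := h.dX_le.trans (by gcongr)
  dZ_le := h.dZ_le.trans (by gcongr)

/-! ### Removing trivial stabilizers -/

section Prune

variable {Q X Z : Type} [Fintype Q] [Fintype X] [Fintype Z]

/-- The indices of the nonzero rows of a matrix. -/
def NonzeroRow (M : Matrix X Q (ZMod 2)) : Type := {s : X // M s ≠ 0}

noncomputable instance (M : Matrix X Q (ZMod 2)) : Fintype (NonzeroRow M) :=
  Fintype.ofInjective (β := X) Subtype.val Subtype.val_injective

/-- The matrix with its zero rows removed. -/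
def pruneRows (M : Matrix X Q (ZMod 2)) : Matrix (NonzeroRow M) Q (ZMod 2) :=
  Matrix.of fun s => M s.1

theorem hammingNorm_pruneRows_col_le (M : Matrix X Q (ZMod 2)) (q : Q) :
    hammingNorm (fun s => pruneRows M s q) ≤ hammingNorm fun s => M s q :=
  hammingNorm_le_of_injOn Subtype.val (fun _ h => h) fun _ _ _ _ h => Subtype.ext h

/-- Removing trivial generators changes neither cycles nor boundaries. -/
def pruneLocalQuasiIso (hX : Matrix X Q (ZMod 2)) (hZ : Matrix Z Q (ZMod 2)) :
    LocalQuasiIso hX hZ (pruneRows hX) (pruneRows hZ) 1 1 where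
  toFun := LinearMap.id
  cycle v hv s := hv s.1
  boundary z := by
    by_cases hz : hZ z = 0
    · exact ⟨0, fun q => by simp [hz]⟩
    · exact IsBoundary.row (pruneRows hZ) ⟨z, hz⟩
  inj v _ hb := by
    rw [isBoundary_iff] at hb ⊢
    refine Submodule.span_mono ?_ hb
    rintro _ ⟨z, rfl⟩
    exact ⟨z.1, rfl⟩
  surj v hv := by
    refine ⟨v, fun s => ?_, ⟨0, fun q => ?_⟩, by rw [one_mul]⟩
    · by_cases hs : hX s = 0
      · rw [hs, zero_dotProduct]
      · exact hv ⟨s, hs⟩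
    · simp [CharTwo.add_self_eq_zero]
  row q := by
    classical
    refine ⟨Pi.single q 1, hammingNorm_le_one fun a b ha hb => ?_, fun v hv => ⟨q, hv, by simp⟩⟩
    rw [ne_eq, Pi.single_apply, ite_eq_right_iff, Classical.not_imp] at ha hb
    rw [ha.1, hb.1]

end Prune

/-- The code with the generators that act on no qubit removed. -/
noncomputable def prune (C : CSSCode) : CSSCode where
  Qubit := C.Qubit
  XStab := NonzeroRow C.hX
  ZStab := NonzeroRow C.hZ
  hX := pruneRows C.hX
  hZ := pruneRows C.hZ
  comm := by
    ext s z
    exact congrFun (congrFun C.comm s.1) z.1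

/-- If no generator is trivial, there are not too many of them. -/
theorem card_le_mul_of_row_ne_zero {Q X : Type*} [Fintype Q] [Fintype X] {M : Matrix X Q (ZMod 2)}
    {m : ℕ} (h : ∀ s, M s ≠ 0) (hm : ∀ q, hammingNorm (fun s => M s q) ≤ m) :
    Fintype.card X ≤ m * Fintype.card Q := by
  have h1 := hammingNorm_le_mul (v := fun _ : X => 1) (w := fun _ : Q => 1) (fun q s => M s q)
    (fun q _ => hm q) fun s _ => by
      obtain ⟨q, hq⟩ := Function.ne_iff.1 (h s)
      exact ⟨q, one_ne_zero, hq⟩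
  simpa [hammingNorm] using h1

/-! ### The sparse code -/

namespace Layout

variable {Q X Z : Type} [Fintype Q] [Fintype X] [Fintype Z] {hX : Matrix X Q (ZMod 2)}
  {hZ : Matrix Z Q (ZMod 2)} {T : ℕ} (D : Layout hX hZ T)

/-- The resolved code. -/
noncomputable def resCode : CSSCode where
  Qubit := ResQ Q X T (2 * T + 1)
  XStab := ResX Q X T (2 * T + 1)
  ZStab := Z
  hX := D.X₁
  hZ := D.Z₁
  comm := by
    ext s z
    exact D.isSparse.comm s z

/-- The sparse code: the code is resolved and thickened, and all its `Z`-stabilizers are filled. -/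
noncomputable def code : CSSCode := D.sheet.code D.slot

theorem card_qubit_code_le {m : ℕ} (h₁ : Fintype.card X ≤ m * Fintype.card Q)
    (h₂ : Fintype.card Z ≤ m * Fintype.card Q) :
    D.code.N ≤ 34 * (T + 1) ^ 2 * (Fintype.card Q * (m + 1)) := by
  have hE := DiscE.card_le (R := T) (N := 2 * T)
  change Fintype.card (ThickQ (ResQ Q X T (2 * T + 1)) (ResX Q X T (2 * T + 1)) T ⊕
    Z × DiscE T (2 * T)) ≤ _
  simp only [Fintype.card_sum, Fintype.card_prod, Fintype.card_fin]
  generalize Fintype.card Q = nQ at *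
  generalize Fintype.card X = nX at *
  generalize Fintype.card Z = nZ at *
  generalize Fintype.card (DiscE T (2 * T)) = nE at *
  have h3 : nQ ≤ nQ * (m + 1) := Nat.le_mul_of_pos_right _ (Nat.succ_pos m)
  have h4 : m * nQ ≤ nQ * (m + 1) := by rw [mul_comm]; gcongr; omega
  generalize nQ * (m + 1) = k at *
  calc _ ≤ (((k * (T + 1) + (k * (T + 1) + (k * (T + 1) + k * (2 * (T + 1))))) * (T + 1)) +
      ((k * (T + 1) + (k * (T + 1) + (k * (T + 1) + k * (2 * (T + 1))))) * (T + 1) +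
        ((k * (T + 1) + (k * (T + 1) + (k * (T + 1) + k * (2 * (T + 1))))) * (T + 1) +
        (k * (T + 1) + (k * (T + 1) + (k * (T + 1) + k * (2 * (T + 1))))) * (T + 1)))) +
        k * (7 * ((2 * T + 2) * (T + 1))) := by
        gcongr <;> omega
    _ = 34 * (T + 1) ^ 2 * k := by ring

end Layout

/-- A bound for the factors lost to the construction, for codes whose weights are at most `m`. -/
def lossBound (m : ℕ) : ℕ := 136 * (1 + m) ^ 9

/-- Every code can be made sparse, with losses bounded in terms of its weights. -/
theorem exists_sparse (C : CSSCode) (m : ℕ) (hwX : C.wX ≤ m) (hwZ : C.wZ ≤ m) (hqX : C.qX ≤ m)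
    (hqZ : C.qZ ≤ m) : ∃ C' : CSSCode, C'.wX ≤ 5 ∧ C'.qX ≤ 3 ∧ C'.wZ ≤ 5 ∧ C'.qZ ≤ 3 ∧
      C'.N ≤ C.N * lossBound m ∧ Reduces C C' (lossBound m) (lossBound m) := by
  have hwX' : ∀ s, hammingNorm (pruneRows C.hX s) ≤ m := fun s => wX_le_iff.1 hwX s.1
  have hwZ' : ∀ z, hammingNorm (pruneRows C.hZ z) ≤ m := fun z => wZ_le_iff.1 hwZ z.1
  have hqX' : ∀ q, hammingNorm (fun s => pruneRows C.hX s q) ≤ m := fun q =>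
    (hammingNorm_pruneRows_col_le _ q).trans (qX_le_iff.1 hqX q)
  have hqZ' : ∀ q, hammingNorm (fun z => pruneRows C.hZ z q) ≤ m := fun q =>
    (hammingNorm_pruneRows_col_le _ q).trans (qZ_le_iff.1 hqZ q)
  obtain ⟨D⟩ := nonempty_layout (fun s z => congrFun (congrFun C.prune.comm s) z)
    hwX' hwZ' hqX' hqZ'
  have hS := D.isSparse
  have hT : layoutSize m + 1 ≤ 2 * (1 + m) ^ 4 := by
    rw [layoutSize]
    ring_nf
    nlinarith [Nat.zero_le m, Nat.zero_le (m ^ 2), Nat.zero_le (m ^ 3)]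
  refine ⟨D.code, wX_le_iff.2 hS.hammingNorm_coneX_le, qX_le_iff.2 hS.hammingNorm_coneX_col_le,
    wZ_le_iff.2 hS.hammingNorm_coneZ_le, qZ_le_iff.2 hS.hammingNorm_coneZ_col_le, ?_, ?_⟩
  · refine (D.card_qubit_code_le (card_le_mul_of_row_ne_zero (fun s => s.2) hqX')
      (card_le_mul_of_row_ne_zero (fun z => z.2) hqZ')).trans ?_
    calc 34 * (layoutSize m + 1) ^ 2 * (C.N * (m + 1))
        ≤ 34 * (2 * (1 + m) ^ 4) ^ 2 * (C.N * (m + 1)) := by gcongr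
      _ = C.N * lossBound m := by rw [lossBound]; ring
  · have r1 : Reduces C C.prune 1 1 :=
      LocalQuasiIso.reduces (C' := C.prune) (pruneLocalQuasiIso C.hX C.hZ) le_rfl le_rfl
    have r2 : Reduces C.prune D.resCode (1 + m) 1 :=
      LocalQuasiIso.reduces (C := C.prune) (C' := D.resCode)
        (resLocalQuasiIso (pruneRows C.hZ) (1 + m) (by omega) fun s => (hwX' s).trans (by omega))
        (by omega) le_rfl
    have r3 : Reduces D.resCode (Sheet.thickCode D.slot hS.comm) 1 1 :=
      LocalQuasiIso.reduces (C := D.resCode) (C' := Sheet.thickCode D.slot hS.comm)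
        (thickLocalQuasiIso hS.comm) le_rfl le_rfl
    have r4 := LocalQuasiIso.reduces (C := Sheet.thickCode D.slot hS.comm) (C' := D.code)
      ((D.sheet.filling D.slot).localQuasiIso _ (D.sheet.filling_support D.slot _ fun z =>
        Layout.hammingNorm_Z₁_le z (hwZ' z) hqX')) le_rfl (Nat.le_add_right 1 _)
    refine (((r1.trans r2).trans r3).trans r4).mono ?_ ?_
    · rw [lossBound]
      calc 1 * (1 * ((1 + m) * 1)) = 1 * (1 + m) ^ 1 := by ring
        _ ≤ 136 * (1 + m) ^ 9 := Nat.mul_le_mul (by norm_num)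
          (Nat.pow_le_pow_right (by omega) (by norm_num))
    · rw [lossBound]
      generalize layoutSize m = T at hT
      have h1 : 1 ≤ T + 1 := by omega
      have h2 : 1 ≤ 1 + m := by omega
      calc (1 + (3 * (T + 1) + (2 * T + 1) * m) * m) * (1 * (1 * 1))
          ≤ (T + 1) * (1 + m) ^ 2 + (3 * (T + 1) * (1 + m) + 2 * (T + 1) * (1 + m)) * (1 + m) := by
            rw [mul_one, mul_one, mul_one]
            refine add_le_add ?_ (Nat.mul_le_mul (add_le_add ?_ ?_) (by omega))
            · exact Nat.mul_pos h1 (Nat.pow_pos h2)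
            · exact Nat.le_mul_of_pos_right _ h2
            · exact Nat.mul_le_mul (by omega) (by omega)
        _ = 6 * (T + 1) * (1 + m) ^ 2 := by ring
        _ ≤ 6 * (2 * (1 + m) ^ 4) * (1 + m) ^ 2 := by gcongr
        _ = 12 * (1 + m) ^ 6 := by ring
        _ ≤ 136 * (1 + m) ^ 9 := Nat.mul_le_mul (by norm_num)
          (Nat.pow_le_pow_right h2 (by norm_num))

end CSSCode

theorem mainTheorem1 :
    (∃ w A a b : ℕ, ∀ C : CSSCode, ∃ C' : CSSCode,
      C'.wX ≤ w ∧ C'.qX ≤ w ∧ C'.wZ ≤ w ∧ C'.qZ ≤ w ∧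
      C'.K = C.K ∧
      C'.N ≤ C.N * (A * (1 + C.dev) ^ a * (1 + Nat.log 2 C.N) ^ b) ∧
      C.dX ≤ C'.dX * ((A * (1 + C.dev) ^ a * (1 + Nat.log 2 C.N) ^ b : ℕ) : ℕ∞) ∧
      C.dZ ≤ C'.dZ * ((A * (1 + C.dev) ^ a * (1 + Nat.log 2 C.N) ^ b : ℕ) : ℕ∞)) ∧
    (∀ c : ℕ, ∃ A : ℕ, ∀ C : CSSCode,
      C.wX ≤ c → C.qX ≤ c → C.wZ ≤ c → C.qZ ≤ c →
      ∃ C' : CSSCode,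
        C'.wX ≤ 5 ∧ C'.qX ≤ 3 ∧ C'.wZ ≤ 5 ∧ C'.qZ ≤ 5 ∧
        C'.K = C.K ∧
        C'.N ≤ A * C.N ∧
        C.dX ≤ C'.dX * (A : ℕ∞) ∧
        C.dZ ≤ C'.dZ * (A : ℕ∞)) := by
  constructor
  · refine ⟨5, 136, 9, 0, fun C => ?_⟩
    obtain ⟨C', h1, h2, h3, h4, h5, h6⟩ := C.exists_sparse C.dev
      (by unfold CSSCode.dev; omega) (by unfold CSSCode.dev; omega)
      (by unfold CSSCode.dev; omega) (by unfold CSSCode.dev; omega)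
    rw [pow_zero, mul_one]
    exact ⟨C', h1, h2.trans (by norm_num), h3, h4.trans (by norm_num), h6.K_eq, h5, h6.dX_le,
      h6.dZ_le⟩
  · refine fun c => ⟨CSSCode.lossBound c, fun C hwX hqX hwZ hqZ => ?_⟩
    obtain ⟨C', h1, h2, h3, h4, h5, h6⟩ := C.exists_sparse c hwX hwZ hqX hqZ
    refine ⟨C', h1, h2, h3, h4.trans (by norm_num), h6.K_eq, ?_, h6.dX_le, h6.dZ_le⟩
    rw [mul_comm]
    exact h5
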